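/- Here a Boolean space is a zero-dimensional compact Hausdorff space; a space $X$ is homogeneous if for all $x,y\in X$ some autohomeomorphism of $X$ maps $x$ to $y$; $X$ is c.c.c. if every family of pairwise disjoint nonempty open subsets of $X$ is countable; the weight of $X$ is the least cardinality of a base. For an ordinal $\gamma$, the space $2^\gamma$ is the set of all $0$-$1$-sequences of length $\gamma$ with the order topology of the lexicographic order. The interval algebra $B(L)$ of a linear order $L$ is the subalgebra of $\mathcal P(L)$ generated by the intervals $[x,y)$ with $x\in L$, $y\in L\cup\{\infty\}$, $x<y$, and $\operatorname{Ult}(B)$ is the Stone space of ultrafilters of a Boolean algebra $B$. A tree is a partial order in which the set of predecessors of each element is well-ordered; its $\alpha$-th level consists of the elements whose set of predecessors has order type $\alpha$, and its height is the least $\alpha$ such that the $\alpha$-th level is empty. A tree is Aronszajn if it has height $\omega_1$, countable levels and no uncountable chain. **Theorem 3.10.** (1) There is a homogeneous Boolean space $X$ of weight $\aleph_1$ which is first countable, not c.c.c., and not a continuous image of any of the lexicographically ordered spaces $2^\gamma$, $\gamma<\omega_1$. Moreover, $X$ can be chosen homeomorphic to $\operatorname{Ult}(B(L))$ for a linear order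 $L$ on an Aronszajn tree $T$ of the following form: $T$ is a set of sequences of rational numbers of countable ordinal length which is closed under initial segments and is an Aronszajn tree when ordered by extension, and $L$ is the set $T$ ordered lexicographically after identifying each $x\in T$ with the sequence $x^\frown\pi$ (that is, $x$ followed by the real number $\pi$). (2) Let $\gamma<\omega_1$ and let $\mathcal T$ be a set of clopen subsets of $2^\gamma$ such that $(\mathcal T,\supseteq)$ is a tree all of whose levels are countable, and such that any two $\supseteq$-incomparable elements of $\mathcal T$ are disjoint. Then $\mathcal T$ is countable. -/

import Mathlib

open Set TopologicalSpace
open scoped Cardinal Ordinal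

/-! ### Topological notions -/

/-- A Boolean space: a zero-dimensional compact Hausdorff space. (For compact Hausdorff spaces,
having a base of clopen sets is the same as being totally disconnected.) -/
def IsBooleanSpace (X : Type*) [TopologicalSpace X] : Prop :=
  CompactSpace X ∧ T2Space X ∧ IsTopologicalBasis {U : Set X | IsClopen U}

/-- A space is homogeneous if any point can be moved to any other by an autohomeomorphism. -/
def IsHomogeneousSpace (X : Type*) [TopologicalSpace X] : Prop :=
  ∀ x y : X, ∃ h : X ≃ₜ X, h x = y

/-- The weight of a space: the least cardinality of a base of its topology. -/
noncomputable def spaceWeight (X : Type*) [TopologicalSpace X] : Cardinal :=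
  sInf {κ | ∃ B : Set (Set X), IsTopologicalBasis B ∧ #B = κ}

/-- The countable chain condition: every family of pairwise disjoint nonempty open sets is
countable. -/
def SatisfiesCCC (X : Type*) [TopologicalSpace X] : Prop :=
  ∀ 𝒰 : Set (Set X), (∀ U ∈ 𝒰, IsOpen U ∧ U.Nonempty) → 𝒰.PairwiseDisjoint id → 𝒰.Countable

/-- `X` is a continuous image of `Y`. -/
def IsContinuousImageOf (X Y : Type*) [TopologicalSpace X] [TopologicalSpace Y] : Prop :=
  ∃ f : Y → X, Continuous f ∧ Function.Surjective f

/-! ### Stone spaces and interval algebras -/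

/-- An ultrafilter of a Boolean algebra. -/
@[ext]
structure BoolUltrafilter (B : Type*) [BooleanAlgebra B] where
  carrier : Set B
  bot_notMem : ⊥ ∉ carrier
  top_mem : ⊤ ∈ carrier
  inf_mem : ∀ a ∈ carrier, ∀ b ∈ carrier, a ⊓ b ∈ carrier
  mem_of_le : ∀ a ∈ carrier, ∀ b, a ≤ b → b ∈ carrier
  mem_or_compl_mem : ∀ a, a ∈ carrier ∨ aᶜ ∈ carrier

/-- The Stone topology on the set of ultrafilters of `B`: it is generated by the sets of all
ultrafilters containing a given element of `B`. -/
instance (B : Type*) [BooleanAlgebra B] : TopologicalSpace (BoolUltrafilter B) :=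
  generateFrom {U | ∃ b : B, U = {F | b ∈ F.carrier}}

/-- The interval algebra of a linear order `L`: the subalgebra of the power set of `L` generated by
the half-open intervals `[x, y)` with `x ∈ L`, `y ∈ L ∪ {∞}` and `x < y`. -/
def intervalAlgebra (L : Type*) [LinearOrder L] : BooleanSubalgebra (Set L) :=
  BooleanSubalgebra.closure {s | (∃ x y : L, x < y ∧ s = Ico x y) ∨ ∃ x : L, s = Ici x}

/-! ### Trees -/

/-- A tree: a partial order in which the predecessors of each element are well-ordered. -/
def IsOrderTree (T : Type*) [PartialOrder T] : Prop :=
  ∀ t : T, IsWellOrder (Iio t) (· < ·)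

/-- The `α`-th level of a tree: the elements whose set of predecessors has order type `α`. -/
def treeLevel (T : Type*) [PartialOrder T] (α : Ordinal) : Set T :=
  {t | ∃ _ : IsWellOrder (Iio t) (· < ·), Ordinal.type (α := Iio t) (· < ·) = α}

/-- An Aronszajn tree: a tree of height `ω₁` all of whose levels are countable and which has no
uncountable chain. -/
structure IsAronszajnTree (T : Type*) [PartialOrder T] : Prop where
  isTree : IsOrderTree T
  level_nonempty_iff : ∀ α : Ordinal, (treeLevel T α).Nonempty ↔ α < ω₁
  level_countable : ∀ α : Ordinal, (treeLevel T α).Countable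
  chain_countable : ∀ C : Set T, IsChain (· ≤ ·) C → C.Countable

/-! ### Trees of transfinite sequences of rationals and their lexicographic order -/

/-- A sequence of rational numbers whose length is a countable ordinal. The well-order `ω₁.ToType`
has order type `ω₁`, and the ordinal `len` is identified with the initial segment of `ω₁.ToType`
of the elements below it, on which the sequence is defined. -/
structure RatSeq where
  len : (ω₁ : Ordinal.{0}).ToType
  val : Iio len → ℚ

namespace RatSeq

theorem eq_of_len_val {x y : RatSeq} (h : x.len = y.len)
    (hv : ∀ i (hx : i < x.len) (hy : i < y.len), x.val ⟨i, hx⟩ = y.val ⟨i, hy⟩) : x = y := by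
  obtain ⟨l, v⟩ := x
  obtain ⟨m, w⟩ := y
  obtain rfl : l = m := h
  congr
  funext i
  exact hv i i.2 i.2

/-- Sequences are partially ordered by extension: `x ≤ y` if `x` is an initial segment of `y`. -/
instance : PartialOrder RatSeq where
  le x y := ∃ h : x.len ≤ y.len, ∀ i : Iio x.len, y.val ⟨i, lt_of_lt_of_le i.2 h⟩ = x.val i
  le_refl x := ⟨le_rfl, fun _ => rfl⟩
  le_trans x y z := by
    rintro ⟨h, hv⟩ ⟨k, kv⟩
    exact ⟨h.trans k, fun i => (kv ⟨i, lt_of_lt_of_le i.2 h⟩).trans (hv i)⟩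
  le_antisymm x y := by
    rintro ⟨h, hv⟩ ⟨k, _⟩
    exact eq_of_len_val (le_antisymm h k) fun i hx hy => (hv ⟨i, hx⟩).symm

/-- The sequence `x ⌢ π` of real numbers, padded with zeros to length `ω₁`. (As `π` is irrational,
for `x ≠ y` the sequences `x ⌢ π` and `y ⌢ π` already differ at a place where both are defined, so
that the padding has no influence on the lexicographic order.) -/
noncomputable def appendPi (x : RatSeq) : Lex ((ω₁ : Ordinal.{0}).ToType → ℝ) :=
  toLex fun i => if h : i < x.len then (x.val ⟨i, h⟩ : ℝ) else if i = x.len then Real.pi else 0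

theorem appendPi_injective : Function.Injective appendPi := by
  have key : ∀ x y : RatSeq, appendPi x = appendPi y → ¬ x.len < y.len := by
    intro x y h hlt
    have h1 := congrFun (congrArg ofLex h) x.len
    simp only [appendPi, ofLex_toLex, lt_irrefl, dite_false, if_true, hlt, dite_true] at h1
    exact irrational_pi ⟨_, h1.symm⟩
  intro x y h
  have hl : x.len = y.len := le_antisymm (not_lt.1 (key y x h.symm)) (not_lt.1 (key x y h))
  refine eq_of_len_val hl fun i hx hy => ?_
  have h1 := congrFun (congrArg ofLex h) i
  simp only [appendPi, ofLex_toLex, hx, hy, dite_true] at h1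
  exact_mod_cast h1

end RatSeq

/-- The set `T` of sequences, to be ordered lexicographically instead of by extension. -/
def PiLex (T : Set RatSeq) : Type := ↥T

/-- `T` is ordered lexicographically after identifying each `x ∈ T` with `x ⌢ π`. -/
noncomputable instance (T : Set RatSeq) : LinearOrder (PiLex T) :=
  LinearOrder.lift' (fun x : ↥T => x.1.appendPi)
    (RatSeq.appendPi_injective.comp Subtype.val_injective)

/-! ### The lexicographically ordered spaces `2^γ` -/

/-- The set `2^γ` of all 0-1-sequences of length `γ`. -/
def LexCube (γ : Ordinal.{0}) : Type := Lex (γ.ToType → Bool)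

/-- The lexicographic order on `2^γ`, with `false < true`. -/
noncomputable instance (γ : Ordinal.{0}) : LinearOrder (LexCube γ) :=
  inferInstanceAs (LinearOrder (Lex (γ.ToType → Bool)))

/-- `2^γ` carries the order topology of the lexicographic order. -/
noncomputable instance (γ : Ordinal.{0}) : TopologicalSpace (LexCube γ) := Preorder.topology (LexCube γ)

/-! For part (2), the elements of a clopen tree that contain a given point form a countable chain:
in a compact first countable space, an uncountable chain of clopen sets with countable sets of
predecessors would have an open intersection, and compactness would put a least member in the chain.
So each countable set of points meets only countably many members of the tree. By induction on the
coordinate `i`, all but countably many members `t` then have the property that no interval inside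
`t` has endpoints differing at `i`. Otherwise `t` would contain one of countably many points, the
splitting points at `i` of the finitely many intervals that make up the sets in one countable level.
As `γ` is countable, all but countably many members contain only one-point intervals and are finite,
and a tree of clopen sets with this property is countable (`countable_of_clopen_tree`).

For part (1), `L` is a tree `T` of sequences of rationals that is a submonoid under concatenation
and is also closed under initial and final segments. The cone above any `t ∈ T` is therefore a copy
of `L`, and Cantor's theorem on countable dense orders shows that `L` is isomorphic to `ℚ ×ₗ L` and
to each of its open half-lines. The sequences in `T` take each value finitely often, which forbids
uncountable chains. The generators `gen δ k` have length at least `δ`, so only countably many of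
them are relevant below a given countable height, and the levels are countable.

The Stone space of the interval algebra is the space of cuts of `L`
(`CutSpace.homeomorphUltrafilter`). A cut splits only a chain of cones, hence countably many, so it
has a countable cofinal set on both sides; this gives first countability. The complement of a point
is then a disjoint union of infinitely many clopen pieces, each determined by finitely many elements
of `L`. Since half-lines are copies of `L`, each piece is a copy of the whole space `X`. So `X` is
the one-point compactification of `ℕ × X` with an arbitrary given point at infinity, and `X` is
homogeneous (`CutSpace.isHomogeneousSpace`).

The clopen sets `clopenAt x` of cuts between `x ⌢ 0` and `x ⌢ 1` are disjoint for incomparable `x`,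
so an uncountable antichain of `T` refutes the c.c.c., and this in turn forces the weight up to
`ℵ₁`. Restricted to the sequences with values in `(0, 1)` they form an uncountable tree with
countable levels. Its preimage under a continuous surjection from `2^γ` would contradict part (2).
-/

open Topology Filter

/-! ### Trees and their levels -/

theorem IsOrderTree.wellFoundedLT {P : Type*} [PartialOrder P] (hT : IsOrderTree P) :
    WellFoundedLT P := by
  refine ⟨WellFounded.wellFounded_iff_has_min.2 fun S ⟨t, ht⟩ => ?_⟩
  by_cases h : ∃ s ∈ S, s < t
  · obtain ⟨s, hs, hst⟩ := h
    have := hT t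
    have hwf : WellFounded ((· < ·) : Iio t → Iio t → Prop) := IsWellFounded.wf
    obtain ⟨m, hm, hmin⟩ := hwf.has_min {x | x.1 ∈ S} ⟨⟨s, hst⟩, hs⟩
    refine ⟨m, hm, fun x hx hxm => hmin ⟨x, hxm.trans m.2⟩ hx hxm⟩
  · exact ⟨t, ht, fun x hx hxt => h ⟨x, hx, hxt⟩⟩

/-- The order type of the set of predecessors. -/
noncomputable def IsOrderTree.rank {P : Type*} [PartialOrder P] (hT : IsOrderTree P) (t : P) :
    Ordinal :=
  @Ordinal.type (Iio t) (· < ·) (hT t)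

theorem IsOrderTree.treeLevel_eq {P : Type*} [PartialOrder P] (hT : IsOrderTree P) (α : Ordinal) :
    treeLevel P α = {t | hT.rank t = α} := by
  ext t
  exact ⟨fun ⟨_, h⟩ => h, fun h => ⟨hT t, h⟩⟩

theorem IsOrderTree.exists_rank_eq {P : Type*} [PartialOrder P] (hT : IsOrderTree P) {t : P}
    {α : Ordinal} (h : α < hT.rank t) : ∃ s < t, hT.rank s = α := by
  have := hT t
  let s : Iio t := Ordinal.enum (α := Iio t) (· < ·) ⟨α, h⟩
  refine ⟨s, s.2, ?_⟩
  have h1 : Ordinal.typein (α := Iio t) (· < ·) s = α := Ordinal.typein_enum _ h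
  rw [← h1]
  have := hT s
  refine Ordinal.type_eq.2 ⟨⟨⟨fun x => ⟨⟨x.1, x.2.trans s.2⟩, x.2⟩, fun x => ⟨x.1.1, x.2⟩,
    fun x => rfl, fun x => rfl⟩, ?_⟩⟩
  intro a b
  exact Iff.rfl

theorem IsOrderTree.exists_le_rank_eq {P : Type*} [PartialOrder P] (hT : IsOrderTree P) {t : P}
    {α : Ordinal} (h : α ≤ hT.rank t) : ∃ s ≤ t, hT.rank s = α := by
  rcases h.lt_or_eq with h | h
  · obtain ⟨s, hs, h⟩ := hT.exists_rank_eq h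
    exact ⟨s, hs.le, h⟩
  · exact ⟨t, le_rfl, h.symm⟩

theorem countable_toType {γ : Ordinal.{0}} (h : γ < ω₁) : Countable γ.ToType := by
  rw [← Cardinal.mk_le_aleph0_iff, Cardinal.mk_toType, ← Cardinal.lt_aleph_one_iff,
    ← Cardinal.lt_ord, Cardinal.ord_aleph]
  exact h

theorem countable_Iio_of_lt_omega_one {γ : Ordinal.{0}} (h : γ < ω₁) : (Iio γ).Countable := by
  have := countable_toType h
  exact (Ordinal.ToType.mk (o := γ)).toEquiv.countable_iff.2 this

theorem lt_omega_one_of_countable_Iio {γ : Ordinal.{0}} (h : (Iio γ).Countable) : γ < ω₁ := by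
  have : Countable γ.ToType := (Ordinal.ToType.mk (o := γ)).toEquiv.countable_iff.1 h.to_subtype
  rw [← Cardinal.mk_le_aleph0_iff, Cardinal.mk_toType, ← Cardinal.lt_aleph_one_iff,
    ← Cardinal.lt_ord, Cardinal.ord_aleph] at this
  exact this

/-- A countable union of countable initial segments is countable: `ω₁` has uncountable cofinality.
-/
theorem exists_bound_lt_omega_one {ι : Type} [Countable ι] (f : ι → Ordinal.{0})
    (hf : ∀ i, f i < ω₁) : ∃ ρ < ω₁, ∀ i, f i < ρ := by
  have h : (⋃ i, Iio (f i + 1)).Countable := countable_iUnion fun i =>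
    countable_Iio_of_lt_omega_one ((Cardinal.isSuccLimit_omega 1).succ_lt (hf i))
  refine ⟨⨆ i, (f i + 1), lt_omega_one_of_countable_Iio (h.mono fun x hx => ?_), fun i => ?_⟩
  · obtain ⟨i, hi⟩ := (Ordinal.lt_iSup_iff).1 hx
    exact mem_iUnion.2 ⟨i, hi⟩
  · exact (lt_add_one (f i)).trans_le (Ordinal.le_iSup (fun i => f i + 1) i)

theorem IsOrderTree.rank_lt_omega_one {P : Type} [PartialOrder P] (hT : IsOrderTree P) {t : P}
    (h : (Iio t).Countable) : hT.rank t < ω₁ := by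
  have := hT t
  have : Countable (Iio t) := h.to_subtype
  rw [← Cardinal.ord_aleph, Cardinal.lt_ord, Cardinal.lt_aleph_one_iff]
  exact Cardinal.mk_le_aleph0_iff.2 this

/-- In a tree with countable levels, almost all elements lie above countably many elements
outside of a given countable set. -/
theorem IsOrderTree.exists_countable_basis {P : Type} [PartialOrder P] (hT : IsOrderTree P)
    (hlev : ∀ α : Ordinal.{0}, (treeLevel P α).Countable) {S : Set P} (hS : S.Countable)
    (hS' : ∀ s ∈ S, (Iio s).Countable) :
    ∃ Λ : Set P, Λ.Countable ∧ Disjoint Λ S ∧ ∀ᶠ t in cocountable, ∃ l ∈ Λ, l ≤ t := by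
  have := hS.to_subtype
  obtain ⟨ρ, hρ, hb⟩ := exists_bound_lt_omega_one (fun s : S => hT.rank s.1)
    fun s => hT.rank_lt_omega_one (hS' s s.2)
  refine ⟨treeLevel P ρ, hlev ρ, ?_, ?_⟩
  · rw [hT.treeLevel_eq, Set.disjoint_left]
    intro s hs hs'
    exact (hb ⟨s, hs'⟩).ne hs
  · have h : (⋃ α ∈ Iio ρ, treeLevel P α).Countable :=
      (countable_Iio_of_lt_omega_one hρ).biUnion fun α _ => hlev α
    refine mem_cocountable.2 (h.mono fun t ht => ?_)
    by_contra hcon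
    apply ht
    have h2 : ρ ≤ hT.rank t := by
      by_contra h3
      apply hcon
      simp only [mem_iUnion]
      exact ⟨hT.rank t, not_le.1 h3, by rw [hT.treeLevel_eq]; rfl⟩
    obtain ⟨s, hs, h3⟩ := hT.exists_le_rank_eq h2
    exact ⟨s, by rw [hT.treeLevel_eq]; exact h3, hs⟩

/-! ### Chains of clopen sets in first countable compact spaces -/

/-- If `C` is uncountable, its intersection is open: at each of its points, one basic neighbourhood
lies in uncountably many members of `C`, and these are cofinal in `C` under reverse inclusion. By
compactness some member lies inside the intersection, so all others are among its countably many
predecessors. -/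
theorem countable_of_isChain_isClopen {Y : Type*} [TopologicalSpace Y] [CompactSpace Y]
    [FirstCountableTopology Y] {C : Set (Set Y)} (hcl : ∀ t ∈ C, IsClopen t)
    (hC : IsChain (· ⊆ ·) C) (hpred : ∀ t ∈ C, {s ∈ C | t ⊂ s}.Countable) : C.Countable := by
  by_contra hunc
  have hne : Nonempty C := by
    by_contra h
    exact hunc (by rw [Set.nonempty_coe_sort, not_nonempty_iff_eq_empty] at h; simp [h])
  have key : ∀ y ∈ ⋂ t : C, t.1, (⋂ t : C, t.1) ∈ 𝓝 y := by
    intro y hy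
    obtain ⟨N, hN⟩ := (𝓝 y).exists_antitone_basis
    have h1 : ∃ n, ¬ {t ∈ C | N n ⊆ t}.Countable := by
      by_contra! h
      refine hunc ((countable_iUnion h).mono fun t ht => ?_)
      obtain ⟨n, -, hn⟩ := hN.1.mem_iff.1 ((hcl t ht).isOpen.mem_nhds (mem_iInter.1 hy ⟨t, ht⟩))
      exact mem_iUnion.2 ⟨n, ht, hn⟩
    obtain ⟨n, hn⟩ := h1
    refine mem_of_superset (hN.1.mem_of_mem (i := n) trivial) (subset_iInter fun s => ?_)
    -- Uncountably many members contain `N n`, so not all of them are strict supersets of `s`.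
    obtain ⟨t, ht, hts⟩ := Set.not_subset.1 fun h => hn ((hpred s s.2).mono h)
    rcases hC.total ht.1 s.2 with h | h
    · exact ht.2.trans h
    · have : s.1 = t := by
        by_contra hne
        exact hts ⟨ht.1, h.ssubset_of_ne hne⟩
      exact this ▸ ht.2
  obtain ⟨m, hm⟩ := exists_subset_nhds_of_compactSpace (V := fun t : C => t.1)
    (fun a b => by
      rcases hC.total a.2 b.2 with h | h
      · exact ⟨a, Subset.rfl, h⟩
      · exact ⟨b, h, Subset.rfl⟩) (fun t => (hcl t t.2).isClosed) key
  refine hunc (((hpred m m.2).insert m.1).mono fun s hs => ?_)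
  have h1 : m.1 ⊆ s := hm.trans (iInter_subset (fun t : C => t.1) ⟨s, hs⟩)
  by_cases h : m.1 = s
  · exact Or.inl h.symm
  · exact Or.inr ⟨hs, h1.ssubset_of_ne h⟩

/-- Sets sharing the point `d` are comparable. Well-founded induction supplies the countability of
predecessor sets that the lemma on chains needs. -/
theorem countable_of_tree_of_mem {Y P : Type*} [TopologicalSpace Y] [CompactSpace Y]
    [FirstCountableTopology Y] [PartialOrder P] (hT : IsOrderTree P) {c : P → Set Y}
    (hcl : ∀ t, IsClopen (c t)) (hle : ∀ s t, s ≤ t ↔ c t ⊆ c s)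
    (hdisj : ∀ s t, s ≤ t ∨ t ≤ s ∨ Disjoint (c s) (c t)) (d : Y) : {t | d ∈ c t}.Countable := by
  have := hT.wellFoundedLT
  have hinj : Function.Injective c := fun s t h =>
    le_antisymm ((hle _ _).2 h.ge) ((hle _ _).2 h.le)
  have hlt : ∀ s t, s < t ↔ c t ⊂ c s := fun s t => by
    rw [lt_iff_le_not_ge, ssubset_iff_subset_not_subset, hle, hle]
  have hch : ∀ s t, d ∈ c s → d ∈ c t → s ≤ t ∨ t ≤ s := fun s t hs ht => by
    rcases hdisj s t with h | h | h
    · exact Or.inl h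
    · exact Or.inr h
    · exact (Set.disjoint_left.1 h hs ht).elim
  have main : ∀ Q : Set P, (∀ t ∈ Q, d ∈ c t) → (∀ t ∈ Q, {s | d ∈ c s ∧ s < t}.Countable) →
      Q.Countable := by
    intro Q hQ hQ'
    refine countable_of_injective_of_countable_image hinj.injOn
      (countable_of_isChain_isClopen (C := c '' Q) ?_ ?_ ?_)
    · rintro _ ⟨t, -, rfl⟩
      exact hcl t
    · rintro _ ⟨s, hs, rfl⟩ _ ⟨t, ht, rfl⟩ -
      exact (hch s t (hQ s hs) (hQ t ht)).symm.imp (hle _ _).1 (hle _ _).1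
    · rintro _ ⟨t, ht, rfl⟩
      refine ((hQ' t ht).image c).mono ?_
      rintro _ ⟨⟨s, hs, rfl⟩, h⟩
      exact ⟨s, ⟨hQ s hs, (hlt _ _).2 h⟩, rfl⟩
  have hind : ∀ t, {s | d ∈ c s ∧ s < t}.Countable := by
    intro t
    induction t using WellFoundedLT.induction with
    | ind t ih => exact main _ (fun s hs => hs.1) fun s hs => ih s hs.2
  exact main _ (fun t ht => ht) fun t _ => hind t

/-! ### The spaces `2^γ` -/

namespace LexCube

variable {γ : Ordinal.{0}}

theorem lt_iff {x y : LexCube γ} :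
    x < y ↔ ∃ i : γ.ToType, (∀ j < i, ofLex x j = ofLex y j) ∧ ofLex x i < ofLex y i :=
  Iff.rfl

instance : OrderTopology (LexCube γ) := ⟨rfl⟩

noncomputable instance : CompleteLinearOrder (LexCube γ) :=
  inferInstanceAs (CompleteLinearOrder (Lex (γ.ToType → Bool)))

/-- The largest sequence that is below `y` and first differs from `y` at `i`. -/
noncomputable def lower (y : LexCube γ) (i : γ.ToType) : LexCube γ :=
  toLex fun j => if j < i then ofLex y j else if j = i then false else true

/-- The smallest sequence that is above `y` and first differs from `y` at `i`. -/
noncomputable def upper (y : LexCube γ) (i : γ.ToType) : LexCube γ :=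
  toLex fun j => if j < i then ofLex y j else if j = i then true else false

theorem lower_apply (y : LexCube γ) (i j : γ.ToType) :
    ofLex (lower y i) j = if j < i then ofLex y j else if j = i then false else true := rfl

theorem upper_apply (y : LexCube γ) (i j : γ.ToType) :
    ofLex (upper y i) j = if j < i then ofLex y j else if j = i then true else false := rfl

theorem lower_lt {y : LexCube γ} {i : γ.ToType} (h : ofLex y i = true) : lower y i < y :=
  lt_iff.2 ⟨i, fun j hj => by simp [lower_apply, hj], by simp [lower_apply, h]⟩

theorem lt_upper {y : LexCube γ} {i : γ.ToType} (h : ofLex y i = false) : y < upper y i :=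
  lt_iff.2 ⟨i, fun j hj => by simp [upper_apply, hj], by simp [upper_apply, h]⟩

theorem le_lower {x y : LexCube γ} {i : γ.ToType} (h : ∀ j < i, ofLex x j = ofLex y j)
    (hi : ofLex x i = false) : x ≤ lower y i := by
  by_contra hcon
  obtain ⟨k, -, hk⟩ := lt_iff.1 (not_le.1 hcon)
  rw [lower_apply] at hk
  split_ifs at hk with h1 h2
  · exact hk.ne (h k h1).symm
  · subst h2
    simp [hi] at hk
  · exact absurd hk (by simp)

theorem upper_le {x y : LexCube γ} {i : γ.ToType} (h : ∀ j < i, ofLex x j = ofLex y j)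
    (hi : ofLex x i = true) : upper y i ≤ x := by
  by_contra hcon
  obtain ⟨k, -, hk⟩ := lt_iff.1 (not_le.1 hcon)
  rw [upper_apply] at hk
  split_ifs at hk with h1 h2
  · exact hk.ne (h k h1)
  · subst h2
    simp [hi] at hk
  · exact absurd hk (by simp)

/-- The points `lower y i` are cofinal below `y` and the points `upper y i` are coinitial above it,
and there are only countably many places `i`. -/
theorem firstCountableTopology (hγ : γ < ω₁) : FirstCountableTopology (LexCube γ) := by
  have := countable_toType hγ
  refine ⟨fun y => ?_⟩
  have h : 𝓝 y = (⨅ i : {i // ofLex y i = true}, 𝓟 (Ioi (lower y i))) ⊓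
      ⨅ i : {i // ofLex y i = false}, 𝓟 (Iio (upper y i)) := by
    rw [nhds_eq_order]
    congr 1
    · refine le_antisymm (le_iInf fun i => iInf₂_le (lower y i.1) (mem_Iio.2 (lower_lt i.2)))
        (le_iInf₂ fun x hx => ?_)
      obtain ⟨i, h1, h2⟩ := lt_iff.1 hx
      obtain ⟨h3, h4⟩ := Bool.lt_iff.1 h2
      exact (iInf_le _ ⟨i, h4⟩).trans (principal_mono.2 (Ioi_subset_Ioi (le_lower h1 h3)))
    · refine le_antisymm (le_iInf fun i => iInf₂_le (upper y i.1) (mem_Ioi.2 (lt_upper i.2)))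
        (le_iInf₂ fun x hx => ?_)
      obtain ⟨i, h1, h2⟩ := lt_iff.1 hx
      obtain ⟨h3, h4⟩ := Bool.lt_iff.1 h2
      exact (iInf_le _ ⟨i, h3⟩).trans (principal_mono.2 (Iio_subset_Iio
        (upper_le (fun j hj => (h1 j hj).symm) h4)))
  rw [h]
  infer_instance

end LexCube

/-! ### Trees of clopen subsets of `2^γ` -/

instance countableInterFilter_cocountable {α : Type*} :
    CountableInterFilter (cocountable : Filter α) :=
  ⟨fun S hS h => mem_cocountable.2 (by
    rw [compl_sInter]
    exact (hS.image _).sUnion (by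
      rintro _ ⟨s, hs, rfl⟩
      exact mem_cocountable.1 (h s hs)))⟩

theorem Set.Countable.compl_mem_cocountable {α : Type*} {s : Set α} (hs : s.Countable) :
    sᶜ ∈ (cocountable : Filter α) :=
  mem_cocountable.2 (by rwa [compl_compl])

/-- Openness gives every point a closed interval as a neighbourhood inside `t`; compactness leaves
finitely many. -/
theorem IsClopen.exists_finset_Icc {Y : Type*} [LinearOrder Y] [TopologicalSpace Y]
    [OrderTopology Y] [CompactSpace Y] {t : Set Y} (ht : IsClopen t) :
    ∃ F : Finset (Y × Y), t = ⋃ p ∈ F, Icc p.1 p.2 := by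
  classical
  choose! b c hbc hN hsub using fun (y : Y) (hy : y ∈ t) =>
    exists_Icc_mem_subset_of_mem_nhds (ht.isOpen.mem_nhds hy)
  obtain ⟨G, hG, hcov⟩ := ht.isClosed.isCompact.elim_nhds_subcover (fun y => Icc (b y) (c y)) hN
  refine ⟨G.image fun y => (b y, c y), subset_antisymm ?_ ?_⟩
  · intro y hy
    obtain ⟨z, hz, h⟩ := mem_iUnion₂.1 (hcov hy)
    exact mem_iUnion₂.2 ⟨_, Finset.mem_image_of_mem _ hz, h⟩
  · refine iUnion₂_subset fun p hp => ?_
    obtain ⟨z, hz, rfl⟩ := Finset.mem_image.1 hp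
    exact hsub z (hG z hz)

/-- A tree with countable levels that embeds into the clopen subsets of `2^γ`, with incomparable
elements going to disjoint sets, is countable. -/
theorem countable_of_clopen_tree {γ : Ordinal.{0}} (hγ : γ < ω₁) {P : Type} [PartialOrder P]
    (hT : IsOrderTree P) (hlev : ∀ α : Ordinal.{0}, (treeLevel P α).Countable)
    {c : P → Set (LexCube γ)} (hcl : ∀ t, IsClopen (c t)) (hle : ∀ s t, s ≤ t ↔ c t ⊆ c s)
    (hdisj : ∀ s t, s ≤ t ∨ t ≤ s ∨ Disjoint (c s) (c t)) : Countable P := by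
  have := LexCube.firstCountableTopology hγ
  have := countable_toType hγ
  have hpt := countable_of_tree_of_mem hT hcl hle hdisj
  have hpred : ∀ s, (c s).Nonempty → (Iio s).Countable := fun s ⟨d, hd⟩ =>
    (hpt d).mono fun t ht => (hle t s).1 (le_of_lt ht) hd
  -- An element with `c t = ∅` lies above all others and could have uncountably many predecessors,
  -- so it must not be an exception to `p`. The remaining exceptions have countable sets of
  -- predecessors.
  have hbasis : ∀ p : P → Prop, (∀ t, c t = ∅ → p t) → (∀ᶠ t in cocountable, p t) →
      ∃ Λ : Set P, Λ.Countable ∧ (∀ l ∈ Λ, p l) ∧ ∀ᶠ t in cocountable, ∃ l ∈ Λ, l ≤ t := by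
    intro p hp hev
    obtain ⟨Λ, h1, h2, h3⟩ := hT.exists_countable_basis hlev (S := {t | ¬ p t})
      (mem_cocountable.1 hev) fun s hs => hpred s <| by
        by_contra h
        exact hs (hp s (not_nonempty_iff_eq_empty.1 h))
    exact ⟨Λ, h1, fun l hl => by_contra fun h => Set.disjoint_left.1 h2 hl h, h3⟩
  choose F hF using fun t => (hcl t).exists_finset_Icc
  -- Intervals inside `c t` do not split at coordinate `i`, for almost all `t`.
  have hmain : ∀ i : γ.ToType, ∀ᶠ t in cocountable, ∀ p q, p ≤ q → Icc p q ⊆ c t →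
      ofLex p i = ofLex q i := by
    intro i
    induction i using WellFoundedLT.induction with
    | ind i ih =>
      have hev : ∀ᶠ t in cocountable, ∀ p q, p ≤ q → Icc p q ⊆ c t →
          ∀ j < i, ofLex p j = ofLex q j := by
        have := eventually_countable_forall.2 fun j : Iio i => ih j j.2
        filter_upwards [this] with t ht p q hpq hs j hj
        exact ht ⟨j, hj⟩ p q hpq hs
      obtain ⟨Λ, hΛ, hΛ', hbig⟩ := hbasis _ (fun t ht p q hpq hs => by
        rw [ht] at hs
        exact (hs (left_mem_Icc.2 hpq)).elim) hev
      -- In an interval of `c l` with left end `d.1`, all points agree below `i`, so `d.1.upper i`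
      -- is the only place where it can split at `i`. The sets `c t` that contain one of these
      -- countably many points are discarded.
      have hD : (⋃ l ∈ Λ, ⋃ d ∈ (F l : Set (LexCube γ × LexCube γ)),
          {t | d.1.upper i ∈ c t}).Countable :=
        hΛ.biUnion fun l _ => (F l).countable_toSet.biUnion fun d _ => hpt _
      filter_upwards [hbig, hD.compl_mem_cocountable] with t
        ⟨l, hl, hlt⟩ htD p q hpq hs
      have hsl := hs.trans ((hle _ _).1 hlt)
      have hag := hΛ' l hl p q hpq hsl
      by_contra hne
      have hpq' : ofLex p i = false ∧ ofLex q i = true := by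
        rcases hpq.eq_or_lt with h | h
        · exact (hne (by rw [h])).elim
        · obtain ⟨k, hk, hk'⟩ := LexCube.lt_iff.1 h
          rcases lt_trichotomy k i with h | rfl | h
          · exact (hk'.ne (hag k h)).elim
          · exact Bool.lt_iff.1 hk'
          · exact (hne (hk i h)).elim
      have hp : p ∈ c l := hsl (left_mem_Icc.2 hpq)
      rw [hF l] at hp
      obtain ⟨d, hd, hpd⟩ := mem_iUnion₂.1 hp
      have hag' := hΛ' l hl d.1 p hpd.1 <| by
        rw [hF l]
        exact (Icc_subset_Icc_right hpd.2).trans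
          (subset_biUnion_of_mem (u := fun p => Icc p.1 p.2) hd)
      -- As `p`, `q` and `d.1` agree below `i`, and `p`, `q` have the values `false`, `true` at `i`,
      -- the splitting point lies in `Icc p q`.
      refine htD (mem_biUnion hl (mem_biUnion (x := d) hd (hs ⟨?_, ?_⟩)))
      · refine (LexCube.lt_iff.2 ⟨i, fun j hj => ?_, ?_⟩).le
        · rw [LexCube.upper_apply, if_pos hj, hag' j hj]
        · rw [LexCube.upper_apply, hpq'.1]
          simp
      · exact LexCube.upper_le (fun j hj => ((hag' j hj).trans (hag j hj)).symm) hpq'.2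
  -- There are countably many coordinates, so for almost all `t` none of them splits, and the
  -- finitely many intervals that make up `c t` are single points.
  have hfin : ∀ᶠ t in cocountable, (c t).Finite := by
    filter_upwards [eventually_countable_forall.2 hmain] with t ht
    rw [hF t]
    refine (F t).finite_toSet.biUnion fun d hd => Set.Subsingleton.finite ?_
    have hsub : Icc d.1 d.2 ⊆ c t := by
      rw [hF t]
      exact subset_biUnion_of_mem (u := fun p : LexCube γ × LexCube γ => Icc p.1 p.2) hd
    have hconst : ∀ x ∈ Icc d.1 d.2, d.1 = x := fun x hx => by
      have := fun i => ht i d.1 x hx.1 ((Icc_subset_Icc_right hx.2).trans hsub)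
      exact congrArg toLex (funext this)
    exact fun x hx y hy => (hconst x hx).symm.trans (hconst y hy)
  obtain ⟨Λ, hΛ, hΛ', hbig⟩ := hbasis _ (fun t ht => by simp [ht]) hfin
  have hinj : Function.Injective c := fun s t h =>
    le_antisymm ((hle _ _).2 h.ge) ((hle _ _).2 h.le)
  -- A finite set `c l` has finitely many subsets, hence finitely many elements of the tree lie
  -- above `l`.
  have h2 : (⋃ l ∈ Λ, {t | l ≤ t}).Countable := hΛ.biUnion fun l hl =>
    (Set.Finite.of_finite_image ((hΛ' l hl).finite_subsets.subset (by
      rintro _ ⟨t, ht, rfl⟩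
      exact (hle _ _).1 ht)) hinj.injOn).countable
  refine countable_univ_iff.1 ((h2.union (mem_cocountable.1 hbig)).mono fun t _ => ?_)
  by_cases h : ∃ l ∈ Λ, l ≤ t
  · obtain ⟨l, hl, h⟩ := h
    exact Or.inl (mem_biUnion hl h)
  · exact Or.inr h

theorem countable_of_clopens_tree {γ : Ordinal.{0}} (hγ : γ < ω₁) (𝒯 : Set (Clopens (LexCube γ)))
    (hT : IsOrderTree (↥𝒯)ᵒᵈ) (hdisj : ∀ a ∈ 𝒯, ∀ b ∈ 𝒯, a ≤ b ∨ b ≤ a ∨ Disjoint a b)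
    (hlev : ∀ α : Ordinal.{0}, (treeLevel (↥𝒯)ᵒᵈ α).Countable) : 𝒯.Countable := by
  have := countable_of_clopen_tree hγ hT hlev (c := fun t => (OrderDual.ofDual t).1)
    (fun t => (OrderDual.ofDual t).1.isClopen) (fun s t => Iff.rfl) fun s t => by
      rcases hdisj _ (OrderDual.ofDual s).2 _ (OrderDual.ofDual t).2 with h | h | h
      · exact Or.inr (Or.inl h)
      · exact Or.inl h
      · refine Or.inr (Or.inr (Set.disjoint_left.2 fun x hx hy => ?_))
        have h1 : x ∈ ((OrderDual.ofDual s).1 ⊓ (OrderDual.ofDual t).1 : Clopens (LexCube γ)) :=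
          ⟨hx, hy⟩
        rw [h.eq_bot] at h1
        exact h1
  exact this

/-! ### The space of cuts of a linear order -/

/-- The cuts of a linear order, represented by the characteristic functions of their lower parts,
with the topology of pointwise convergence. -/
def CutSpace (L : Type*) [LinearOrder L] : Type _ := {f : L → Bool // Antitone f}

namespace CutSpace

variable {L L' : Type*} [LinearOrder L] [LinearOrder L']

instance : FunLike (CutSpace L) L Bool := ⟨Subtype.val, Subtype.val_injective⟩

instance : TopologicalSpace (CutSpace L) := instTopologicalSpaceSubtype

@[ext] theorem ext {f g : CutSpace L} (h : ∀ x, f x = g x) : f = g := DFunLike.ext _ _ h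

theorem antitone (f : CutSpace L) : Antitone f := f.2

theorem eq_true_of_le (f : CutSpace L) {x y : L} (h : x ≤ y) (hy : f y = true) : f x = true :=
  Bool.eq_true_of_true_le (hy ▸ f.antitone h)

theorem eq_false_of_le (f : CutSpace L) {x y : L} (h : x ≤ y) (hx : f x = false) : f y = false :=
  Bool.eq_false_of_le_false (hx ▸ f.antitone h)

@[fun_prop] theorem continuous_eval (x : L) : Continuous fun f : CutSpace L => f x :=
  (continuous_apply x).comp continuous_subtype_val

theorem continuous_iff {Z : Type*} [TopologicalSpace Z] {e : Z → CutSpace L} :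
    Continuous e ↔ ∀ x, Continuous fun z => e z x := by
  exact continuous_induced_rng.trans continuous_pi_iff

theorem isClopen_eval (x : L) (b : Bool) : IsClopen {f : CutSpace L | f x = b} :=
  (isClopen_discrete {b}).preimage (continuous_eval x)

theorem isClosed_antitone : IsClosed {f : L → Bool | Antitone f} := by
  have : {f : L → Bool | Antitone f} = ⋂ (x) (y) (_ : x ≤ y), {f | f y ≤ f x} := by
    ext f
    simp [Antitone]
  rw [this]
  refine isClosed_iInter fun x => isClosed_iInter fun y => isClosed_iInter fun _ => ?_
  have h : Continuous fun f : L → Bool => (f y, f x) := by fun_prop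
  exact IsClosed.preimage h (t := {p | p.1 ≤ p.2}) (isClosed_discrete _)

instance : CompactSpace (CutSpace L) := isCompact_iff_compactSpace.1 isClosed_antitone.isCompact

instance : T2Space (CutSpace L) := inferInstanceAs (T2Space (Subtype _))

instance : TotallyDisconnectedSpace (CutSpace L) :=
  inferInstanceAs (TotallyDisconnectedSpace (Subtype _))

theorem isBooleanSpace : IsBooleanSpace (CutSpace L) :=
  ⟨inferInstance, inferInstance, isTopologicalBasis_isClopen⟩

theorem nhds_eq (f : CutSpace L) : 𝓝 f = ⨅ x, 𝓟 {g | g x = f x} := by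
  have h : 𝓝 f = comap (fun g : CutSpace L => (g : L → Bool)) (𝓝 (f : L → Bool)) := nhds_induced _ _
  rw [h, nhds_pi, Filter.pi, comap_iInf]
  congr 1
  ext1 x
  rw [nhds_discrete, ← principal_singleton, comap_principal, comap_principal]
  rfl

/-! #### The Stone space of the interval algebra -/

/-- The half-line determined by the position of `x` relative to a cut. -/
def side (f : CutSpace L) (x : L) : Set L := if f x = true then Ici x else Iio x

/-- The filter of neighbourhoods of a cut. -/
def filter (f : CutSpace L) : Filter L := Filter.generate (range f.side)

theorem side_mem (f : CutSpace L) (x : L) : f.side x ∈ f.filter :=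
  Filter.mem_generate_of_mem ⟨x, rfl⟩

/-- The largest element of `F` in the lower part of the cut works. If there is none, any point below
`F` does, which is where the absence of a minimum enters; with a minimum, the cut with empty lower
part would correspond to no ultrafilter. -/
theorem exists_forall_mem_side [NoMinOrder L] [Nonempty L] (f : CutSpace L) {F : Set L}
    (hF : F.Finite) : ∃ z, ∀ x ∈ F, z ∈ f.side x := by
  by_cases h : (F ∩ {x | f x = true}).Nonempty
  · obtain ⟨m, hm, hmax⟩ := (hF.inter_of_left _).exists_maximal h
    refine ⟨m, fun x hx => ?_⟩
    unfold side
    split_ifs with h1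
    · exact (le_total x m).elim id fun h2 => hmax ⟨hx, h1⟩ h2
    · by_contra h2
      exact h1 (f.eq_true_of_le (not_lt.1 h2) hm.2)
  · have hfalse : ∀ x ∈ F, f x ≠ true := fun x hx hx' => h ⟨x, hx, hx'⟩
    obtain ⟨m, hm⟩ := hF.bddBelow
    obtain ⟨z, hz⟩ := exists_lt m
    refine ⟨z, fun x hx => ?_⟩
    rw [side, if_neg (hfalse x hx)]
    exact hz.trans_le (hm hx)

theorem filter_neBot [NoMinOrder L] [Nonempty L] (f : CutSpace L) : f.filter.NeBot := by
  rw [filter, Filter.generate_neBot_iff]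
  intro t ht htf
  obtain ⟨F, -, hF, rfl⟩ := exists_subset_image_finite_and.1 ⟨t, image_univ ▸ ht, htf, rfl⟩
  obtain ⟨z, hz⟩ := f.exists_forall_mem_side hF
  refine ⟨z, ?_⟩
  rintro _ ⟨x, hx, rfl⟩
  exact hz x hx

theorem Ici_mem_filter [NoMinOrder L] [Nonempty L] {f : CutSpace L} {x : L} :
    Ici x ∈ f.filter ↔ f x = true := by
  have h := f.side_mem x
  unfold side at h
  split_ifs at h with hx
  · simp [h, hx]
  · refine iff_of_false (fun h' => ?_) hx
    have := f.filter_neBot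
    obtain ⟨z, hz⟩ := Filter.nonempty_of_mem (inter_mem h h')
    exact not_le.2 hz.1 hz.2

theorem Iio_mem_filter [NoMinOrder L] [Nonempty L] {f : CutSpace L} {x : L} :
    Iio x ∈ f.filter ↔ f x = false := by
  have h := f.side_mem x
  unfold side at h
  split_ifs at h with hx
  · refine iff_of_false (fun h' => ?_) (by simp [hx])
    have := f.filter_neBot
    obtain ⟨z, hz⟩ := Filter.nonempty_of_mem (inter_mem h' h)
    exact not_le.2 hz.1 hz.2
  · simp [h, hx]

end CutSpace

/-! ### The interval algebra and its ultrafilters -/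

namespace IntervalAlgebra

variable {L : Type*} [LinearOrder L]

/-- The half-line `[x, ∞)` as an element of the interval algebra. -/
def ici (x : L) : intervalAlgebra L := ⟨Ici x, BooleanSubalgebra.subset_closure (Or.inr ⟨x, rfl⟩)⟩

/-- The half-lines `[x, ∞)` alone generate, because `[x, y)` is the difference of two of them. -/
theorem induction {p : intervalAlgebra L → Prop} (ici : ∀ x, p (ici x)) (bot : p ⊥)
    (sup : ∀ a b, p a → p b → p (a ⊔ b)) (compl : ∀ a, p a → p aᶜ) (b : intervalAlgebra L) :
    p b := by
  obtain ⟨s, hs⟩ := b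
  refine BooleanSubalgebra.closure_bot_sup_induction (p := fun s hs => p ⟨s, hs⟩) ?_ bot
    (fun s hs t ht => sup ⟨s, hs⟩ ⟨t, ht⟩) (fun s hs => compl ⟨s, hs⟩) hs
  rintro _ (⟨x, y, hxy, rfl⟩ | ⟨x, rfl⟩)
  · have h := compl _ (sup _ _ (compl _ (ici x)) (ici y))
    convert h
    ext z
    change z ∈ Ico x y ↔ z ∈ ((Ici x)ᶜ ∪ Ici y)ᶜ
    simp
  · exact ici x

end IntervalAlgebra

namespace BoolUltrafilter

variable {B : Type*} [BooleanAlgebra B]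

theorem compl_mem_iff (F : BoolUltrafilter B) {a : B} : aᶜ ∈ F.carrier ↔ a ∉ F.carrier := by
  refine ⟨fun h h' => F.bot_notMem ?_, fun h => (F.mem_or_compl_mem a).resolve_left h⟩
  have := F.inf_mem _ h' _ h
  rwa [inf_compl_self] at this

theorem sup_mem_iff (F : BoolUltrafilter B) {a b : B} :
    a ⊔ b ∈ F.carrier ↔ a ∈ F.carrier ∨ b ∈ F.carrier := by
  refine ⟨fun h => ?_, fun h => ?_⟩
  · by_contra! hcon
    have h1 := F.inf_mem _ (F.compl_mem_iff.2 hcon.1) _ (F.compl_mem_iff.2 hcon.2)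
    rw [← compl_sup] at h1
    exact F.compl_mem_iff.1 h1 h
  · rcases h with h | h
    · exact F.mem_of_le _ h _ le_sup_left
    · exact F.mem_of_le _ h _ le_sup_right

theorem isOpen_setOf_mem (b : B) : IsOpen {F : BoolUltrafilter B | b ∈ F.carrier} :=
  isOpen_generateFrom_of_mem ⟨b, rfl⟩

instance : T2Space (BoolUltrafilter B) := by
  refine ⟨fun F G hne => ?_⟩
  have key : ∀ F G : BoolUltrafilter B, (∃ b ∈ F.carrier, b ∉ G.carrier) →
      ∃ u v : Set (BoolUltrafilter B), IsOpen u ∧ IsOpen v ∧ F ∈ u ∧ G ∈ v ∧ Disjoint u v := by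
    rintro F G ⟨b, hF, hG⟩
    refine ⟨_, _, isOpen_setOf_mem b, isOpen_setOf_mem bᶜ, hF, G.compl_mem_iff.2 hG, ?_⟩
    exact Set.disjoint_left.2 fun H h1 h2 => H.compl_mem_iff.1 h2 h1
  have : ¬ F.carrier ⊆ G.carrier ∨ ¬ G.carrier ⊆ F.carrier := by
    by_contra! h
    exact hne (BoolUltrafilter.ext (h.1.antisymm h.2))
  rcases this with h | h
  · exact key F G (Set.not_subset.1 h)
  · obtain ⟨u, v, hu, hv, h1, h2, h3⟩ := key G F (Set.not_subset.1 h)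
    exact ⟨v, u, hv, hu, h2, h1, h3.symm⟩

end BoolUltrafilter

namespace CutSpace

variable {L L' : Type*} [LinearOrder L] [LinearOrder L']

section

variable [NoMinOrder L] [Nonempty L]

theorem mem_or_compl_mem_filter (f : CutSpace L) (b : intervalAlgebra L) :
    b.1 ∈ f.filter ∨ (bᶜ).1 ∈ f.filter := by
  induction b using IntervalAlgebra.induction with
  | ici x =>
    change Ici x ∈ _ ∨ (Ici x)ᶜ ∈ _
    rw [compl_Ici, Ici_mem_filter, Iio_mem_filter]
    cases f x <;> simp
  | bot =>
    rw [compl_bot]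
    exact Or.inr univ_mem
  | sup a b ha hb =>
    rw [compl_sup]
    rcases ha with ha | ha
    · exact Or.inl (mem_of_superset ha subset_union_left)
    rcases hb with hb | hb
    · exact Or.inl (mem_of_superset hb subset_union_right)
    · exact Or.inr (inter_mem ha hb)
  | compl a ha =>
    rw [compl_compl]
    exact ha.symm

/-- The ultrafilter of the interval algebra that corresponds to a cut. -/
def toUltrafilter (f : CutSpace L) : BoolUltrafilter (intervalAlgebra L) where
  carrier := {b | b.1 ∈ f.filter}
  bot_notMem h := by
    have := f.filter_neBot
    exact Filter.empty_notMem f.filter h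
  top_mem := by
    change univ ∈ f.filter
    exact Filter.univ_mem
  inf_mem a ha b hb := by
    change a.1 ∩ b.1 ∈ f.filter
    exact Filter.inter_mem ha hb
  mem_of_le a ha b hab := by
    change b.1 ∈ f.filter
    exact Filter.mem_of_superset ha hab
  mem_or_compl_mem b := f.mem_or_compl_mem_filter b

theorem ici_mem_toUltrafilter {f : CutSpace L} {x : L} :
    IntervalAlgebra.ici x ∈ f.toUltrafilter.carrier ↔ f x = true := by
  change Ici x ∈ f.filter ↔ _
  exact Ici_mem_filter

theorem toUltrafilter_injective : Function.Injective (toUltrafilter (L := L)) := by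
  intro f g h
  ext x
  rw [Bool.eq_iff_iff, ← ici_mem_toUltrafilter, h, ici_mem_toUltrafilter]

/-- The half-lines in an ultrafilter define a cut. Two ultrafilters with the same half-lines
coincide, since the half-lines generate the algebra. -/
theorem toUltrafilter_surjective : Function.Surjective (toUltrafilter (L := L)) := by
  classical
  intro F
  let f : CutSpace L := ⟨fun x => decide (IntervalAlgebra.ici x ∈ F.carrier), fun x y hxy => by
    rw [Bool.le_iff_imp]
    simp only [decide_eq_true_eq]
    exact fun h => F.mem_of_le _ h _ (Ici_subset_Ici.2 hxy : Ici y ⊆ Ici x)⟩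
  refine ⟨f, ?_⟩
  ext b
  induction b using IntervalAlgebra.induction with
  | ici x => exact ici_mem_toUltrafilter.trans decide_eq_true_iff
  | bot => exact iff_of_false f.toUltrafilter.bot_notMem F.bot_notMem
  | sup a b ha hb => rw [BoolUltrafilter.sup_mem_iff, BoolUltrafilter.sup_mem_iff, ha, hb]
  | compl a ha => rw [BoolUltrafilter.compl_mem_iff, BoolUltrafilter.compl_mem_iff, ha]

theorem isClopen_setOf_mem_toUltrafilter (b : intervalAlgebra L) :
    IsClopen {f : CutSpace L | b ∈ f.toUltrafilter.carrier} := by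
  induction b using IntervalAlgebra.induction with
  | ici x =>
    simp only [ici_mem_toUltrafilter]
    exact isClopen_eval x true
  | bot =>
    simp only [BoolUltrafilter.bot_notMem]
    exact isClopen_empty
  | sup a b ha hb =>
    simp only [BoolUltrafilter.sup_mem_iff]
    exact ha.union hb
  | compl a ha =>
    simp only [BoolUltrafilter.compl_mem_iff]
    exact ha.compl

theorem continuous_toUltrafilter : Continuous (toUltrafilter (L := L)) := by
  refine continuous_generateFrom_iff.2 ?_
  rintro _ ⟨b, rfl⟩
  exact (isClopen_setOf_mem_toUltrafilter b).isOpen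

/-- The space of cuts of `L` is the Stone space of the interval algebra of `L`. -/
noncomputable def homeomorphUltrafilter : CutSpace L ≃ₜ BoolUltrafilter (intervalAlgebra L) :=
  continuous_toUltrafilter.homeoOfEquivCompactToT2
    (f := Equiv.ofBijective _ ⟨toUltrafilter_injective, toUltrafilter_surjective⟩)

end

end CutSpace

/-! ### Homogeneity from partitions into copies of the whole space -/

/-- A subset of a space that is the image of the whole space under a continuous injection. -/
def IsCopy {X : Type*} [TopologicalSpace X] (C : Set X) : Prop :=
  ∃ e : X → X, Continuous e ∧ Function.Injective e ∧ range e = C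

theorem IsCopy.univ {X : Type*} [TopologicalSpace X] : IsCopy (univ : Set X) :=
  ⟨id, continuous_id, Function.injective_id, range_id⟩

theorem IsCopy.image {X : Type*} [TopologicalSpace X] {C : Set X} (hC : IsCopy C) {e : X → X}
    (he : Continuous e) (hi : Function.Injective e) : IsCopy (e '' C) := by
  obtain ⟨a, ha, hai, rfl⟩ := hC
  exact ⟨e ∘ a, he.comp ha, hi.comp hai, range_comp e a⟩

theorem Function.Injective.sumElim_of_disjoint {α β γ : Type*} {f : α → γ} {g : β → γ}
    (hf : Function.Injective f) (hg : Function.Injective g) (h : Disjoint (range f) (range g)) :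
    Function.Injective (Sum.elim f g) :=
  hf.sumElim hg fun a b hab => Set.disjoint_left.1 h ⟨a, rfl⟩ (hab ▸ ⟨b, rfl⟩)

/-- The copies `A` and `Aᶜ` show that `X` is homeomorphic to `X ⊕ X`, which maps injectively onto `C
∪ D`. -/
theorem IsCopy.union {X : Type*} [TopologicalSpace X] [CompactSpace X] [T2Space X] {A C D : Set X}
    (hA : IsCopy A) (hA' : IsCopy Aᶜ) (hC : IsCopy C) (hD : IsCopy D) (hCD : Disjoint C D) :
    IsCopy (C ∪ D) := by
  obtain ⟨a, ha, hai, rfl⟩ := hA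
  obtain ⟨b, hb, hbi, hab⟩ := hA'
  obtain ⟨c, hc, hci, rfl⟩ := hC
  obtain ⟨d, hd, hdi, rfl⟩ := hD
  have hbij : Function.Bijective (Sum.elim a b) := by
    refine ⟨hai.sumElim_of_disjoint hbi (hab ▸ disjoint_compl_right), ?_⟩
    rw [← range_eq_univ, Sum.elim_range, hab, union_compl_self]
  let φ : X ⊕ X ≃ₜ X := Continuous.homeoOfEquivCompactToT2 (f := Equiv.ofBijective _ hbij)
    (ha.sumElim hb)
  refine ⟨Sum.elim c d ∘ φ.symm, (hc.sumElim hd).comp φ.symm.continuous,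
    (hci.sumElim_of_disjoint hdi hCD).comp φ.symm.injective, ?_⟩
  rw [φ.symm.surjective.range_comp, Sum.elim_range]

/-- If the complement of a point `p` is the disjoint union of infinitely many clopen copies of a
compact space `X`, then `X` is homeomorphic to the one-point compactification of `ℕ × X`. -/
theorem exists_homeomorph_onePoint {X : Type*} [TopologicalSpace X] [CompactSpace X] [T2Space X]
    {p : X} {P : ℕ → Set X} (hcopy : ∀ n, IsCopy (P n)) (hopen : ∀ n, IsOpen (P n))
    (hdisj : Pairwise (Function.onFun Disjoint P)) (hunion : ⋃ n, P n = {p}ᶜ) :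
    ∃ h : OnePoint (ℕ × X) ≃ₜ X, h OnePoint.infty = p := by
  choose e he hei her using hcopy
  have hne : ∀ n x, e n x ≠ p := fun n x h => by
    have : p ∈ ({p}ᶜ : Set X) := hunion ▸ mem_iUnion.2 ⟨n, by rw [← her, ← h]; exact ⟨x, rfl⟩⟩
    exact this rfl
  let g : OnePoint (ℕ × X) → X := fun z => z.elim p fun q => e q.1 q.2
  have hg : Continuous g := by
    rw [OnePoint.continuous_iff]
    constructor
    · rw [tendsto_nhds]
      intro U hU hpU
      -- Continuity at infinity: the complement of a neighbourhood of `p` is compact, so it meets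
      -- only finitely many of the disjoint open sets `P n`.
      have hcov : Uᶜ ⊆ ⋃ n, P n := by
        rw [hunion]
        exact fun x hx hxp => hx (hxp ▸ hpU)
      obtain ⟨t, ht⟩ := hU.isClosed_compl.isCompact.elim_finite_subcover P hopen hcov
      refine hasBasis_coclosedCompact.mem_iff.2 ⟨(t : Set ℕ) ×ˢ Set.univ, ⟨?_, ?_⟩, ?_⟩
      · exact (isClosed_discrete _).prod isClosed_univ
      · exact t.finite_toSet.isCompact.prod isCompact_univ
      · rintro ⟨n, x⟩ hq
        by_contra hx
        obtain ⟨m, hm, hxm⟩ := mem_iUnion₂.1 (ht hx)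
        have hmn : m = n := by
          by_contra hmn
          exact Set.disjoint_left.1 (hdisj hmn) hxm (by rw [← her]; exact ⟨x, rfl⟩)
        exact hq ⟨hmn ▸ hm, trivial⟩
    · exact continuous_prod_of_discrete_left.2 he
  have hgb : Function.Bijective g := by
    constructor
    · intro a b hab
      induction a using OnePoint.rec with
      | infty =>
        induction b using OnePoint.rec with
        | infty => rfl
        | coe b => exact (hne _ _ hab.symm).elim
      | coe a =>
        induction b using OnePoint.rec with
        | infty => exact (hne _ _ hab).elim
        | coe b =>
          have hab' : e a.1 a.2 = e b.1 b.2 := hab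
          have h1 : a.1 = b.1 := by
            by_contra h
            exact Set.disjoint_left.1 (hdisj h) (by rw [← her]; exact ⟨a.2, rfl⟩)
              (by rw [hab', ← her]; exact ⟨b.2, rfl⟩)
          rw [h1] at hab'
          rw [Prod.ext h1 (hei _ hab')]
    · intro x
      by_cases hx : x = p
      · exact ⟨OnePoint.infty, hx.symm⟩
      · have : x ∈ ⋃ n, P n := hunion ▸ hx
        obtain ⟨n, hn⟩ := mem_iUnion.1 this
        rw [← her] at hn
        obtain ⟨y, rfl⟩ := hn
        exact ⟨((n, y) : ℕ × X), rfl⟩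
  exact ⟨Continuous.homeoOfEquivCompactToT2 (f := Equiv.ofBijective g hgb) hg, rfl⟩

/-- A version of `exists_homeomorph_onePoint` for partitions that may have empty parts. -/
theorem exists_homeomorph_onePoint_of_infinite {X : Type*} [TopologicalSpace X] [CompactSpace X]
    [T2Space X] {p : X} {P : ℕ → Set X} (hcopy : ∀ n, (P n).Nonempty → IsCopy (P n))
    (hopen : ∀ n, IsOpen (P n)) (hdisj : Pairwise (Function.onFun Disjoint P))
    (hunion : ⋃ n, P n = {p}ᶜ) (hinf : {n | (P n).Nonempty}.Infinite) :
    ∃ h : OnePoint (ℕ × X) ≃ₜ X, h OnePoint.infty = p := by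
  have := hinf.to_subtype
  obtain ⟨φ⟩ : Nonempty (ℕ ≃ {n | (P n).Nonempty}) := nonempty_equiv_of_countable
  refine exists_homeomorph_onePoint (P := fun n => P (φ n)) (fun n => hcopy _ (φ n).2)
    (fun n => hopen _) (fun m n hmn => hdisj fun h => hmn (φ.injective (Subtype.ext h))) ?_
  rw [← hunion]
  refine subset_antisymm (iUnion_subset fun n => subset_iUnion P _) (iUnion_subset fun n x hx => ?_)
  refine mem_iUnion.2 ⟨φ.symm ⟨n, x, hx⟩, ?_⟩
  rwa [φ.apply_symm_apply]

/-! ### Copies of the cut space, homogeneity, first countability and weight -/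

namespace CutSpace

variable {L L' : Type*} [LinearOrder L] [LinearOrder L']

/-- A set of cuts that is determined by the position of the elements of `F`. -/
def DeterminedBy (C : Set (CutSpace L)) (F : Set L) : Prop :=
  ∀ g g' : CutSpace L, (∀ x ∈ F, g x = g' x) → g ∈ C → g' ∈ C

/-- The continuous embedding of the cuts of `L` that is induced by an isomorphism from an initial
segment of `L` to `L`. -/
noncomputable def extendIio {x : L} (φ : Iio x ≃o L) (f : CutSpace L) : CutSpace L :=
  ⟨fun y => if h : y < x then f (φ ⟨y, h⟩) else false, fun y z hyz => by
    dsimp only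
    split_ifs with h1 h2 h2
    · exact f.antitone (φ.monotone hyz)
    · exact (h2 (hyz.trans_lt h1)).elim
    · exact Bool.false_le _
    · exact le_rfl⟩

/-- The continuous embedding of the cuts of `L` that is induced by an isomorphism from a final
segment of `L` to `L`. -/
noncomputable def extendIoi {x : L} (φ : Ioi x ≃o L) (f : CutSpace L) : CutSpace L :=
  ⟨fun y => if h : x < y then f (φ ⟨y, h⟩) else true, fun y z hyz => by
    dsimp only
    split_ifs with h1 h2 h2
    · exact f.antitone (φ.monotone hyz)
    · exact Bool.le_true _
    · exact (h1 (h2.trans_le hyz)).elim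
    · exact le_rfl⟩

theorem extendIio_apply {x : L} (φ : Iio x ≃o L) (f : CutSpace L) (y : L) :
    extendIio φ f y = if h : y < x then f (φ ⟨y, h⟩) else false := rfl

theorem extendIoi_apply {x : L} (φ : Ioi x ≃o L) (f : CutSpace L) (y : L) :
    extendIoi φ f y = if h : x < y then f (φ ⟨y, h⟩) else true := rfl

theorem continuous_extendIio {x : L} (φ : Iio x ≃o L) : Continuous (extendIio φ) := by
  refine continuous_iff.2 fun y => ?_
  simp only [extendIio_apply]
  split_ifs
  · exact continuous_eval _
  · exact continuous_const

theorem continuous_extendIoi {x : L} (φ : Ioi x ≃o L) : Continuous (extendIoi φ) := by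
  refine continuous_iff.2 fun y => ?_
  simp only [extendIoi_apply]
  split_ifs
  · exact continuous_eval _
  · exact continuous_const

theorem extendIio_injective {x : L} (φ : Iio x ≃o L) : Function.Injective (extendIio φ) := by
  intro f g h
  ext y
  have := DFunLike.congr_fun h (φ.symm y).1
  have h1 : (φ.symm y).1 < x := (φ.symm y).2
  have h2 : φ ⟨(φ.symm y).1, h1⟩ = y := φ.apply_symm_apply y
  rwa [extendIio_apply, extendIio_apply, dif_pos h1, dif_pos h1, h2] at this

theorem extendIoi_injective {x : L} (φ : Ioi x ≃o L) : Function.Injective (extendIoi φ) := by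
  intro f g h
  ext y
  have := DFunLike.congr_fun h (φ.symm y).1
  have h1 : x < (φ.symm y).1 := (φ.symm y).2
  have h2 : φ ⟨(φ.symm y).1, h1⟩ = y := φ.apply_symm_apply y
  rwa [extendIoi_apply, extendIoi_apply, dif_pos h1, dif_pos h1, h2] at this

theorem range_extendIio {x : L} (φ : Iio x ≃o L) : range (extendIio φ) = {f | f x = false} := by
  refine subset_antisymm ?_ fun f hf => ?_
  · rintro _ ⟨f, rfl⟩
    simp [extendIio_apply]
  · refine ⟨⟨fun y => f (φ.symm y), fun y z hyz => f.antitone (φ.symm.monotone hyz)⟩, ?_⟩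
    ext y
    change (if h : y < x then f (φ.symm (φ ⟨y, h⟩)).1 else false) = f y
    split_ifs with h
    · rw [φ.symm_apply_apply]
    · exact (f.eq_false_of_le (not_lt.1 h) hf).symm

theorem range_extendIoi {x : L} (φ : Ioi x ≃o L) : range (extendIoi φ) = {f | f x = true} := by
  refine subset_antisymm ?_ fun f hf => ?_
  · rintro _ ⟨f, rfl⟩
    simp [extendIoi_apply]
  · refine ⟨⟨fun y => f (φ.symm y), fun y z hyz => f.antitone (φ.symm.monotone hyz)⟩, ?_⟩
    ext y
    change (if h : x < y then f (φ.symm (φ ⟨y, h⟩)).1 else true) = f y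
    split_ifs with h
    · rw [φ.symm_apply_apply]
    · exact (f.eq_true_of_le (not_lt.1 h) hf).symm

/-- If all open half-lines of `L` are isomorphic to `L`, then any nonempty set of cuts that is
determined by finitely many elements is a copy of the whole space. -/
theorem isCopy_of_determinedBy (hl : ∀ x : L, Nonempty (Iio x ≃o L))
    (hr : ∀ x : L, Nonempty (Ioi x ≃o L)) (F : Finset L) {C : Set (CutSpace L)}
    (hC : DeterminedBy C F) (hne : C.Nonempty) : IsCopy C := by
  classical
  induction hn : F.card using Nat.strong_induction_on generalizing F C with
  | _ n ih =>
  subst hn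
  rcases F.eq_empty_or_nonempty with rfl | ⟨x, hx⟩
  · obtain ⟨f, hf⟩ := hne
    rw [show C = Set.univ from eq_univ_of_forall fun g => hC f g (by simp) hf]
    exact IsCopy.univ
  · obtain ⟨φ⟩ := hl x
    obtain ⟨ψ⟩ := hr x
    -- The half of `C` inside the range of `e` is the image under `e` of the preimage of `C`. That
    -- preimage is determined by `θ` of the elements of `F` strictly on one side of `x`; these are
    -- fewer than `F`, so the induction hypothesis applies.
    have key : ∀ (e : CutSpace L → CutSpace L) (G : Finset L) (θ : L → L), Continuous e →
        Function.Injective e → G ⊆ F.erase x →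
        (∀ f g, (∀ y ∈ G, f (θ y) = g (θ y)) → ∀ y ∈ F, e f y = e g y) →
        (C ∩ range e).Nonempty → IsCopy (C ∩ range e) := by
      intro e G θ he hei hG hdet hne
      rw [← image_preimage_eq_inter_range]
      refine IsCopy.image ?_ he hei
      refine ih (G.image θ).card ?_ (G.image θ) ?_ ?_ rfl
      · exact (Finset.card_image_le.trans (Finset.card_le_card hG)).trans_lt
          (Finset.card_erase_lt_of_mem hx)
      · intro g g' hgg hg
        refine hC _ _ (hdet g g' fun y hy => hgg _ ?_) hg
        exact Finset.mem_coe.2 (Finset.mem_image_of_mem θ hy)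
      · obtain ⟨_, h1, f, rfl⟩ := hne
        exact ⟨f, h1⟩
    have hl' : (C ∩ {f | f x = false}).Nonempty → IsCopy (C ∩ {f | f x = false}) := by
      rw [← range_extendIio φ]
      refine key _ (F.filter (· < x)) (fun y => if h : y < x then φ ⟨y, h⟩ else y)
        (continuous_extendIio φ) (extendIio_injective φ) ?_ ?_
      · intro y hy
        obtain ⟨h1, h2⟩ := Finset.mem_filter.1 hy
        exact Finset.mem_erase.2 ⟨h2.ne, h1⟩
      · intro f g h y hy
        rw [extendIio_apply, extendIio_apply]
        split_ifs with hyx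
        · simpa [hyx] using h y (Finset.mem_filter.2 ⟨hy, hyx⟩)
        · rfl
    have hr' : (C ∩ {f | f x = true}).Nonempty → IsCopy (C ∩ {f | f x = true}) := by
      rw [← range_extendIoi ψ]
      refine key _ (F.filter (x < ·)) (fun y => if h : x < y then ψ ⟨y, h⟩ else y)
        (continuous_extendIoi ψ) (extendIoi_injective ψ) ?_ ?_
      · intro y hy
        obtain ⟨h1, h2⟩ := Finset.mem_filter.1 hy
        exact Finset.mem_erase.2 ⟨h2.ne', h1⟩
      · intro f g h y hy
        rw [extendIoi_apply, extendIoi_apply]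
        split_ifs with hyx
        · simpa [hyx] using h y (Finset.mem_filter.2 ⟨hy, hyx⟩)
        · rfl
    have hcompl : {f : CutSpace L | f x = false}ᶜ = {f | f x = true} := by
      ext f
      simp
    have hsplit : C = (C ∩ {f | f x = false}) ∪ (C ∩ {f | f x = true}) := by
      rw [← inter_union_distrib_left, ← hcompl, union_compl_self, inter_univ]
    rcases (C ∩ {f | f x = false}).eq_empty_or_nonempty with h0 | h0
    · rw [h0, empty_union] at hsplit
      rw [hsplit]
      exact hr' (hsplit ▸ hne)
    rcases (C ∩ {f | f x = true}).eq_empty_or_nonempty with h1 | h1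
    · rw [h1, union_empty] at hsplit
      rw [hsplit]
      exact hl' (hsplit ▸ hne)
    rw [hsplit]
    refine IsCopy.union (A := {f | f x = false}) ⟨_, continuous_extendIio φ,
      extendIio_injective φ, range_extendIio φ⟩ ?_ (hl' h0) (hr' h1) ?_
    · rw [hcompl]
      exact ⟨_, continuous_extendIoi ψ, extendIoi_injective ψ, range_extendIoi ψ⟩
    · rw [← hcompl]
      exact disjoint_compl_right.mono inter_subset_right inter_subset_right

/-- A set of elements that is cofinal in the lower part and coinitial in the upper part of a
cut. -/
def IsCofinalIn (E : Set L) (f : CutSpace L) : Prop :=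
  (∀ x, f x = true → ∃ e ∈ E, x ≤ e ∧ f e = true) ∧ ∀ x, f x = false → ∃ e ∈ E, e ≤ x ∧ f e = false

/-- Cuts are monotone, so the value at an element of `E` lying between `x` and the cut forces the
value at `x`. -/
theorem IsCofinalIn.exists_forall {E : Set L} {f : CutSpace L} (hE : IsCofinalIn E f) (x : L) :
    ∃ e ∈ E, ∀ g : CutSpace L, g e = f e → g x = f x := by
  cases hx : f x
  · obtain ⟨e, he, hle, h⟩ := hE.2 x hx
    exact ⟨e, he, fun g hg => g.eq_false_of_le hle (hg.trans h)⟩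
  · obtain ⟨e, he, hle, h⟩ := hE.1 x hx
    exact ⟨e, he, fun g hg => g.eq_true_of_le hle (hg.trans h)⟩

theorem firstCountableTopology
    (hE : ∀ f : CutSpace L, ∃ E : Set L, E.Countable ∧ IsCofinalIn E f) :
    FirstCountableTopology (CutSpace L) := by
  refine ⟨fun f => ?_⟩
  obtain ⟨E, hc, hE⟩ := hE f
  have := hc.to_subtype
  have h : 𝓝 f = ⨅ e : E, 𝓟 {g | g e = f e} := by
    rw [nhds_eq]
    refine le_antisymm (le_iInf fun e => iInf_le _ e.1) (le_iInf fun x => ?_)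
    obtain ⟨e, he, h⟩ := hE.exists_forall x
    exact (iInf_le (fun e : E => 𝓟 {g : CutSpace L | g e = f e}) ⟨e, he⟩).trans
      (principal_mono.2 fun g hg => h g hg)
  rw [h]
  infer_instance

/-- A countable set cofinal in `p` gives a decreasing sequence of clopen sets `U n` with
intersection `{p}`. The differences `U n \ U (n + 1)` are finitely determined, so the nonempty ones
are copies of the space, and `X` is the one-point compactification of `ℕ × X` with `p` at infinity.
This model does not depend on `p`. -/
theorem isHomogeneousSpace [Nonempty L] (hl : ∀ x : L, Nonempty (Iio x ≃o L))
    (hr : ∀ x : L, Nonempty (Ioi x ≃o L))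
    (hE : ∀ f : CutSpace L, ∃ E : Set L, E.Countable ∧ IsCofinalIn E f) :
    IsHomogeneousSpace (CutSpace L) := by
  classical
  suffices hp : ∀ p : CutSpace L,
      ∃ h : OnePoint (ℕ × CutSpace L) ≃ₜ CutSpace L, h OnePoint.infty = p by
    intro p q
    obtain ⟨h, hhp⟩ := hp p
    obtain ⟨k, hkq⟩ := hp q
    exact ⟨h.symm.trans k, by rw [Homeomorph.trans_apply, ← hhp, h.symm_apply_apply, hkq]⟩
  intro p
  obtain ⟨E, hc, hE⟩ := hE p
  have hEne : E.Nonempty := by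
    obtain ⟨x⟩ := ‹Nonempty L›
    obtain ⟨e, he, -⟩ := hE.exists_forall x
    exact ⟨e, he⟩
  obtain ⟨e, rfl⟩ := hc.exists_eq_range hEne
  let U : ℕ → Set (CutSpace L) := fun n => {g | ∀ i < n, g (e i) = p (e i)}
  have hU : ∀ n, DeterminedBy (U n) ((Finset.range n).image e : Finset L) := by
    intro n g g' h hg i hi
    rw [← hg i hi]
    exact (h _ (Finset.mem_coe.2 (Finset.mem_image_of_mem e (Finset.mem_range.2 hi)))).symm
  have hUcl : ∀ n, IsClopen (U n) := by
    intro n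
    have : U n = ⋂ i ∈ Finset.range n, {g | g (e i) = p (e i)} := by
      ext g
      simp [U]
    rw [this]
    exact isClopen_biInter_finset fun i _ => isClopen_eval _ _
  have hUanti : Antitone U := fun m n hmn g hg i hi => hg i (hi.trans_le hmn)
  have hUp : ∀ n, p ∈ U n := fun n i _ => rfl
  have hUinter : ∀ g, (∀ n, g ∈ U n) → g = p := by
    intro g hg
    ext x
    obtain ⟨_, ⟨n, rfl⟩, h⟩ := hE.exists_forall x
    exact h g (hg (n + 1) n n.lt_succ_self)
  refine exists_homeomorph_onePoint_of_infinite (P := fun n => U n \ U (n + 1))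
    (fun n hn => ?_) (fun n => ((hUcl n).diff (hUcl _)).isOpen) ?_ ?_ ?_
  · refine isCopy_of_determinedBy hl hr ((Finset.range (n + 1)).image e) ?_ hn
    intro g g' h hg
    refine ⟨hU n g g' (fun x hx => h x ?_) hg.1, fun hg' => hg.2 (hU (n + 1) g' g
      (fun x hx => (h x hx).symm) hg')⟩
    exact Finset.coe_subset.2 (Finset.image_subset_image
      (Finset.range_subset_range.2 n.le_succ)) hx
  · have : ∀ m n, m < n → Disjoint (U m \ U (m + 1)) (U n \ U (n + 1)) := fun m n hmn =>
      Set.disjoint_left.2 fun g hg hg' => hg.2 (hUanti hmn hg'.1)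
    intro m n hmn
    rcases hmn.lt_or_gt with h | h
    · exact this m n h
    · exact (this n m h).symm
  · refine subset_antisymm (iUnion_subset fun n g hg hgp => hg.2 ?_) fun g hg => ?_
    · rw [mem_singleton_iff.1 hgp]
      exact hUp _
    · by_contra hcon
      refine hg (hUinter g fun n => ?_)
      induction n with
      | zero => exact fun i hi => (Nat.not_lt_zero i hi).elim
      | succ n ih =>
        by_contra h
        exact hcon (mem_iUnion.2 ⟨n, ih, h⟩)
  -- If almost all differences were empty, some `U (N + 1)` would be `{p}`. Being finitely
  -- determined, it would be a copy of the whole space, which has at least two points.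
  · intro hfin
    obtain ⟨N, hN⟩ := hfin.bddAbove
    have hconst : ∀ n, U (N + 1) ⊆ U (N + 1 + n) := by
      intro n
      induction n with
      | zero => exact Subset.rfl
      | succ n ih =>
        intro g hg
        by_contra h
        have : N + 1 + n ≤ N := hN ⟨g, ih hg, h⟩
        omega
    have hsing : U (N + 1) = {p} := by
      refine subset_antisymm (fun g hg => hUinter g fun n => ?_) (singleton_subset_iff.2 (hUp _))
      exact hUanti (Nat.le_add_left n (N + 1)) (hconst n hg)
    obtain ⟨c, -, hci, hcr⟩ := isCopy_of_determinedBy hl hr _ (hU (N + 1)) ⟨p, hUp _⟩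
    rw [hsing] at hcr
    let f₀ : CutSpace L := ⟨fun _ => false, fun _ _ _ => le_rfl⟩
    let f₁ : CutSpace L := ⟨fun _ => true, fun _ _ _ => le_rfl⟩
    have h01 : f₀ = f₁ := hci <| by
      have h0 : c f₀ ∈ ({p} : Set (CutSpace L)) := hcr ▸ ⟨f₀, rfl⟩
      have h1 : c f₁ ∈ ({p} : Set (CutSpace L)) := hcr ▸ ⟨f₁, rfl⟩
      rw [mem_singleton_iff.1 h0, mem_singleton_iff.1 h1]
    obtain ⟨x⟩ := ‹Nonempty L›
    exact absurd (DFunLike.congr_fun h01 x) Bool.false_ne_true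

theorem eq_generateFrom : (inferInstance : TopologicalSpace (CutSpace L)) =
    generateFrom (range fun q : L × Bool => {f : CutSpace L | f q.1 = q.2}) := by
  refine le_antisymm (le_generateFrom ?_) ?_
  · rintro _ ⟨q, rfl⟩
    exact (isClopen_eval _ _).isOpen
  · rw [le_iff_nhds]
    intro f
    rw [nhds_eq, nhds_generateFrom]
    refine le_iInf fun x => iInf₂_le _ ⟨?_, ⟨(x, f x), rfl⟩⟩
    exact rfl

/-- The finite intersections of the sets `{f | f x = b}` form a base, indexed by finite subsets of
`L × Bool`. -/
theorem spaceWeight_le [Infinite L] : spaceWeight (CutSpace L) ≤ #L := by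
  have h := isTopologicalBasis_of_subbasis (eq_generateFrom (L := L))
  have h0 : spaceWeight (CutSpace L) ≤ #(_ : Set (Set (CutSpace L))) := csInf_le' ⟨_, h, rfl⟩
  refine h0.trans ?_
  have hsub : (fun f => ⋂₀ f) '' {f : Set (Set (CutSpace L)) | f.Finite ∧
      f ⊆ range fun q : L × Bool => {f : CutSpace L | f q.1 = q.2}} ⊆
      range fun F : Finset (L × Bool) =>
        ⋂₀ ((fun q : L × Bool => {f : CutSpace L | f q.1 = q.2}) '' F) := by
    rintro _ ⟨f, ⟨hf, hsub⟩, rfl⟩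
    obtain ⟨F, -, hF, rfl⟩ := exists_subset_image_finite_and.1 ⟨f, image_univ ▸ hsub, hf, rfl⟩
    exact ⟨hF.toFinset, by simp⟩
  refine (Cardinal.mk_le_mk_of_subset hsub).trans (Cardinal.mk_range_le.trans ?_)
  rw [Cardinal.mk_finset_of_infinite, Cardinal.mk_prod]
  simp only [Cardinal.lift_uzero, Cardinal.mk_bool, Cardinal.lift_ofNat]
  rw [Cardinal.mul_eq_left (Cardinal.aleph0_le_mk L) ?_ two_ne_zero]
  exact (Cardinal.natCast_lt_aleph0 (n := 2)).le.trans (Cardinal.aleph0_le_mk L)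

end CutSpace

/-- With a countable base, disjoint nonempty open sets contain distinct nonempty basic sets, so
there are only countably many. -/
theorem aleph_one_le_spaceWeight {X : Type*} [TopologicalSpace X] (h : ¬ SatisfiesCCC X) :
    ℵ₁ ≤ spaceWeight X := by
  refine le_csInf ⟨_, _, isTopologicalBasis_opens, rfl⟩ ?_
  rintro _ ⟨B, hB, rfl⟩
  by_contra hlt
  refine h fun 𝒰 hU hdisj => ?_
  rw [not_le, Cardinal.lt_aleph_one_iff, Cardinal.mk_le_aleph0_iff] at hlt
  have hBc : B.Countable := hlt
  have : SecondCountableTopology X := hB.secondCountableTopology hBc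
  have hex : ∀ U ∈ 𝒰, ∃ V ∈ B, V.Nonempty ∧ V ⊆ U := fun U hUm => by
    obtain ⟨x, hx⟩ := (hU U hUm).2
    obtain ⟨V, hV, hxV, hVU⟩ := hB.exists_subset_of_mem_open hx (hU U hUm).1
    exact ⟨V, hV, ⟨x, hxV⟩, hVU⟩
  choose! V hV hVne hVsub using hex
  refine MapsTo.countable_of_injOn (t := B) (f := V) hV ?_ hBc
  intro U₁ h₁ U₂ h₂ heq
  by_contra hne
  obtain ⟨x, hx⟩ := hVne U₁ h₁
  exact Set.disjoint_left.1 (hdisj h₁ h₂ hne) (hVsub _ h₁ hx) (hVsub _ h₂ (heq ▸ hx))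

/-! ### Sums of linear orders -/

/-- A subtype of a subtype, as an ordered set. -/
def OrderIso.subtypeSubtype {α : Type*} [LE α] {p : α → Prop} (q : {x // p x} → Prop)
    (r : α → Prop) (h : ∀ x, r x ↔ ∃ hx : p x, q ⟨x, hx⟩) :
    {x : {x // p x} // q x} ≃o {x // r x} where
  toFun x := ⟨x.1.1, (h _).2 ⟨x.1.2, x.2⟩⟩
  invFun x := ⟨⟨x.1, ((h _).1 x.2).1⟩, ((h _).1 x.2).2⟩
  left_inv _ := rfl
  right_inv _ := rfl
  map_rel_iff' := Iff.rfl

/-- Predicates that are equivalent define isomorphic subtypes. -/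
def OrderIso.subtypeCongr {α : Type*} [LE α] {p q : α → Prop} (h : ∀ x, p x ↔ q x) :
    {x // p x} ≃o {x // q x} where
  toFun x := ⟨x.1, (h _).1 x.2⟩
  invFun x := ⟨x.1, (h _).2 x.2⟩
  left_inv _ := rfl
  right_inv _ := rfl
  map_rel_iff' := Iff.rfl

/-- Two linear orders with monotone maps to the same linear order are isomorphic if the
corresponding fibres are isomorphic. -/
theorem nonempty_orderIso_of_fibers {A B I : Type*} [LinearOrder A] [LinearOrder B]
    [LinearOrder I] {f : A → I} (hf : Monotone f) {g : B → I} (hg : Monotone g)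
    (h : ∀ i, Nonempty ({a // f a = i} ≃o {b // g b = i})) : Nonempty (A ≃o B) := by
  have e := fun i => (h i).some
  let F : A → B := fun a => (e (f a) ⟨a, rfl⟩).1
  have hF : ∀ a i (h : f a = i), F a = (e i ⟨a, h⟩).1 := by
    rintro a i rfl
    rfl
  have hgF : ∀ a, g (F a) = f a := fun a => (e (f a) ⟨a, rfl⟩).2
  have hmono : StrictMono F := by
    intro a b hab
    rcases (hf hab.le).lt_or_eq with h | h
    · rw [← hgF, ← hgF] at h
      exact lt_of_not_ge fun h' => not_le.2 h (hg h')
    · rw [hF a _ h, hF b _ rfl]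
      exact (e (f b)).strictMono hab
  refine ⟨hmono.orderIsoOfSurjective F fun b => ?_⟩
  refine ⟨((e (g b)).symm ⟨b, rfl⟩).1, ?_⟩
  rw [hF _ (g b) ((e (g b)).symm ⟨b, rfl⟩).2]
  change ((e (g b)) ((e (g b)).symm ⟨b, rfl⟩)).1 = b
  rw [OrderIso.apply_symm_apply]

theorem nonempty_orderIso_prodLex {A B I : Type*} [LinearOrder A] [LinearOrder B] [LinearOrder I]
    {f : A → I} (hf : Monotone f) (h : ∀ i, Nonempty ({a // f a = i} ≃o B)) :
    Nonempty (A ≃o I ×ₗ B) := by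
  refine nonempty_orderIso_of_fibers hf (g := fun p => (ofLex p).1)
    (fun p q hpq => Prod.Lex.monotone_fst _ _ hpq) fun i => ?_
  obtain ⟨e⟩ := h i
  refine ⟨e.trans ⟨⟨fun b => ⟨toLex (i, b), rfl⟩, fun p => (ofLex p.1).2, fun b => rfl, ?_⟩, ?_⟩⟩
  · rintro ⟨p, rfl⟩
    rfl
  · intro b b'
    change toLex (i, b) ≤ toLex (i, b') ↔ _
    rw [Prod.Lex.toLex_le_toLex]
    simp

/-- A linear order whose elements have a first coordinate in `ℚ ∪ {π}`, such that the elements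
with first coordinate `q` form a copy of the whole order for every rational `q`. -/
structure IsSelfSimilar {L : Type*} [LinearOrder L] (hd : L → ℝ) : Prop where
  monotone : Monotone hd
  fiber : ∀ q : ℚ, Nonempty ({x // hd x = q} ≃o L)
  eq_or : ∀ x, hd x = Real.pi ∨ ∃ q : ℚ, hd x = q

namespace IsSelfSimilar

variable {L : Type*} [LinearOrder L] {hd : L → ℝ}

/-- By Cantor's theorem the rationals in `S` are order isomorphic to `ℚ`, and each of them carries a
fibre isomorphic to `L`. -/
theorem orderIso_of_pi_notMem (h : IsSelfSimilar hd) {S : Set ℝ} (hS : IsOpen S)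
    (hc : S.OrdConnected) (hne : S.Nonempty) (hpi : Real.pi ∉ S) :
    Nonempty ({x // hd x ∈ S} ≃o ℚ ×ₗ L) := by
  let Q := {q : ℚ // (q : ℝ) ∈ S}
  have hQ : Nonempty (Q ≃o ℚ) := by
    have : Nonempty Q := by
      obtain ⟨q, hq⟩ := Rat.denseRange_cast.exists_mem_open hS hne
      exact ⟨q, hq⟩
    have : DenselyOrdered Q := ⟨fun a b hab => by
      obtain ⟨c, h1, h2⟩ := exists_between (show a.1 < b.1 from hab)
      exact ⟨⟨c, hc.out a.2 b.2 ⟨by exact_mod_cast h1.le, by exact_mod_cast h2.le⟩⟩, h1, h2⟩⟩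
    have : NoMinOrder Q := ⟨fun a => by
      obtain ⟨l, hl, hl'⟩ := exists_Ioc_subset_of_mem_nhds (hS.mem_nhds a.2) (exists_lt _)
      obtain ⟨q, h1, h2⟩ := exists_rat_btwn hl
      exact ⟨⟨q, hl' ⟨h1, h2.le⟩⟩, show q < a.1 by exact_mod_cast h2⟩⟩
    have : NoMaxOrder Q := ⟨fun a => by
      obtain ⟨l, hl, hl'⟩ := exists_Ico_subset_of_mem_nhds (hS.mem_nhds a.2) (exists_gt _)
      obtain ⟨q, h1, h2⟩ := exists_rat_btwn hl
      exact ⟨⟨q, hl' ⟨h1.le, h2⟩⟩, show a.1 < q by exact_mod_cast h1⟩⟩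
    exact Order.iso_of_countable_dense Q ℚ
  have hex : ∀ x : {x // hd x ∈ S}, ∃ q : Q, hd x.1 = q.1 := by
    rintro ⟨x, hx⟩
    rcases h.eq_or x with h | ⟨q, hq⟩
    · exact (hpi (h ▸ hx)).elim
    · exact ⟨⟨q, hq ▸ hx⟩, hq⟩
  choose f hf using hex
  have hfm : Monotone f := fun x y hxy => by
    have := h.monotone hxy
    rw [hf, hf] at this
    exact_mod_cast this
  obtain ⟨e⟩ := nonempty_orderIso_prodLex (B := L) hfm fun q => by
    obtain ⟨e⟩ := h.fiber q.1
    refine ⟨(OrderIso.subtypeSubtype (fun x => f x = q) _ fun x => ?_).trans e⟩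
    constructor
    · intro hx
      refine ⟨hx ▸ q.2, Subtype.ext ?_⟩
      have := (hf ⟨x, hx ▸ q.2⟩).symm.trans hx
      exact_mod_cast this
    · rintro ⟨hx, rfl⟩
      exact hf ⟨x, hx⟩
  obtain ⟨e'⟩ := hQ
  exact ⟨e.trans (Prod.Lex.prodLexCongr e' (OrderIso.refl L))⟩

/-- Split by the sign of `hd x - π`. The fibre over `π` is common to both sides, and the parts to
its left and right are all isomorphic to `ℚ ×ₗ L`. -/
theorem orderIso_of_pi_mem (h : IsSelfSimilar hd) {S S' : Set ℝ} (hS : IsOpen S)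
    (hc : S.OrdConnected) (hpi : Real.pi ∈ S) (hS' : IsOpen S') (hc' : S'.OrdConnected)
    (hpi' : Real.pi ∈ S') : Nonempty ({x // hd x ∈ S} ≃o {x // hd x ∈ S'}) := by
  let s : ℝ → SignType := fun r => SignType.sign (r - Real.pi)
  have hs : Monotone fun x => s (hd x) := fun x y hxy =>
    SignType.sign.monotone (sub_le_sub_right (h.monotone hxy) _)
  have key : ∀ {S : Set ℝ}, IsOpen S → S.OrdConnected → Real.pi ∈ S → ∀ i : SignType, i ≠ 0 →
      Nonempty ({x : {x // hd x ∈ S} // s (hd x) = i} ≃o ℚ ×ₗ L) := by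
    intro S hS hc hpi i hi
    suffices ∃ S' : Set ℝ, IsOpen S' ∧ S'.OrdConnected ∧ S'.Nonempty ∧ Real.pi ∉ S' ∧
        ∀ r, r ∈ S' ↔ r ∈ S ∧ s r = i by
      obtain ⟨S', h1, h2, h3, h4, h5⟩ := this
      obtain ⟨e⟩ := h.orderIso_of_pi_notMem h1 h2 h3 h4
      refine ⟨(OrderIso.subtypeSubtype _ (fun x => hd x ∈ S') fun x => ?_).trans e⟩
      rw [h5]
      simp
    cases i with
    | zero => exact (hi rfl).elim
    | neg =>
      refine ⟨S ∩ Iio Real.pi, hS.inter isOpen_Iio, hc.inter ordConnected_Iio, ?_, by simp, ?_⟩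
      · obtain ⟨l, hl, hl'⟩ := exists_Ioc_subset_of_mem_nhds (hS.mem_nhds hpi) (exists_lt _)
        obtain ⟨q, h1, h2⟩ := exists_between hl
        exact ⟨q, hl' ⟨h1, h2.le⟩, h2⟩
      · intro r
        change _ ↔ _ ∧ SignType.sign _ = -1
        rw [sign_eq_neg_one_iff, sub_neg]
        rfl
    | pos =>
      refine ⟨S ∩ Ioi Real.pi, hS.inter isOpen_Ioi, hc.inter ordConnected_Ioi, ?_, by simp, ?_⟩
      · obtain ⟨l, hl, hl'⟩ := exists_Ico_subset_of_mem_nhds (hS.mem_nhds hpi) (exists_gt _)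
        obtain ⟨q, h1, h2⟩ := exists_between hl
        exact ⟨q, hl' ⟨h1.le, h2⟩, h1⟩
      · intro r
        change _ ↔ _ ∧ SignType.sign _ = 1
        rw [sign_eq_one_iff, sub_pos]
        rfl
  refine nonempty_orderIso_of_fibers (f := fun x => s (hd x)) (g := fun x => s (hd x))
    (fun x y hxy => hs hxy) (fun x y hxy => hs hxy) fun i => ?_
  by_cases hi : i = 0
  · subst hi
    have hz : ∀ {S : Set ℝ}, Real.pi ∈ S → ∀ x : L, hd x = Real.pi ↔
        ∃ _ : hd x ∈ S, s (hd x) = 0 := by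
      intro S hpi x
      simp only [s, sign_eq_zero_iff, sub_eq_zero, exists_prop]
      exact ⟨fun h => ⟨h ▸ hpi, h⟩, fun h => h.2⟩
    exact ⟨(OrderIso.subtypeSubtype _ _ (hz hpi)).trans
      (OrderIso.subtypeSubtype _ _ (hz hpi')).symm⟩
  · obtain ⟨e⟩ := key hS hc hpi i hi
    obtain ⟨e'⟩ := key hS' hc' hpi' i hi
    exact ⟨e.trans e'.symm⟩

theorem orderIso_subtype_of_pi_mem (h : IsSelfSimilar hd) {S : Set ℝ} (hS : IsOpen S)
    (hc : S.OrdConnected) (hpi : Real.pi ∈ S) : Nonempty ({x // hd x ∈ S} ≃o L) := by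
  obtain ⟨e⟩ := h.orderIso_of_pi_mem hS hc hpi isOpen_univ ordConnected_univ (mem_univ _)
  refine ⟨e.trans ⟨⟨fun x => x.1, fun x => ⟨x, trivial⟩, fun x => rfl, fun x => rfl⟩, Iff.rfl⟩⟩

/-- The fibre over `π` need not be a copy of `L`, but the part over the interval `(π - 1, π + 1)`
is. Collapsing this interval to one point leaves the index set `Q`, which is countable, dense and
without endpoints, and over each of its points lies a copy of `L`. -/
theorem orderIso_rat_prodLex (h : IsSelfSimilar hd) : Nonempty (L ≃o ℚ ×ₗ L) := by
  classical
  let Q := {r : ℝ // r = Real.pi ∨ ∃ q : ℚ, r = q ∧ (r < Real.pi - 1 ∨ Real.pi + 1 < r)}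
  have hQ : Nonempty (Q ≃o ℚ) := by
    have : Nonempty Q := ⟨⟨Real.pi, Or.inl rfl⟩⟩
    have : Countable Q := by
      refine Set.Countable.to_subtype (((countable_range ((↑) : ℚ → ℝ)).insert Real.pi).mono ?_)
      rintro r (hr | ⟨q, rfl, -⟩)
      · exact Or.inl hr
      · exact Or.inr ⟨q, rfl⟩
    have hlow : ∀ a : Q, a.1 < Real.pi → a.1 < Real.pi - 1 := by
      rintro ⟨a, ha⟩ (h' : a < Real.pi)
      change a < Real.pi - 1
      rcases ha with ha | ⟨q, -, ha | ha⟩ <;> linarith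
    have hhigh : ∀ a : Q, Real.pi < a.1 → Real.pi + 1 < a.1 := by
      rintro ⟨a, ha⟩ (h' : Real.pi < a)
      change Real.pi + 1 < a
      rcases ha with ha | ⟨q, -, ha | ha⟩ <;> linarith
    have : DenselyOrdered Q := ⟨fun a b hab => by
      have hab' : a.1 < b.1 := hab
      rcases le_or_gt b.1 Real.pi with hb | hb
      · obtain ⟨q, h1, h2⟩ := exists_rat_btwn (lt_min hab' (hlow a (hab'.trans_le hb)))
        obtain ⟨h2, h3⟩ := lt_min_iff.1 h2
        exact ⟨⟨q, Or.inr ⟨q, rfl, Or.inl h3⟩⟩, h1, h2⟩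
      · obtain ⟨q, h1, h2⟩ := exists_rat_btwn (max_lt hab' (hhigh b hb))
        obtain ⟨h1, h3⟩ := max_lt_iff.1 h1
        exact ⟨⟨q, Or.inr ⟨q, rfl, Or.inr h3⟩⟩, h1, h2⟩⟩
    have : NoMinOrder Q := ⟨fun a => by
      obtain ⟨q, h2⟩ := exists_rat_lt (min a.1 (Real.pi - 1))
      obtain ⟨h2, h3⟩ := lt_min_iff.1 h2
      exact ⟨⟨q, Or.inr ⟨q, rfl, Or.inl h3⟩⟩, h2⟩⟩
    have : NoMaxOrder Q := ⟨fun a => by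
      obtain ⟨q, h1⟩ := exists_rat_gt (max a.1 (Real.pi + 1))
      obtain ⟨h1, h3⟩ := max_lt_iff.1 h1
      exact ⟨⟨q, Or.inr ⟨q, rfl, Or.inr h3⟩⟩, h1⟩⟩
    exact Order.iso_of_countable_dense Q ℚ
  let S : Set ℝ := Ioo (Real.pi - 1) (Real.pi + 1)
  have hirr : ∀ x, hd x ∉ S → hd x < Real.pi - 1 ∨ Real.pi + 1 < hd x := by
    intro x hx
    rcases h.eq_or x with h | ⟨q, hq⟩
    · exact (hx (by rw [h]; constructor <;> linarith)).elim
    -- The ends of the interval are irrational, so no first coordinate falls on them.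
    · have h1 : hd x ≠ Real.pi - 1 := fun h => irrational_pi ⟨q + 1, by push_cast; linarith⟩
      have h2 : hd x ≠ Real.pi + 1 := fun h => irrational_pi ⟨q - 1, by push_cast; linarith⟩
      by_contra! h3
      exact hx ⟨lt_of_le_of_ne h3.1 h1.symm, lt_of_le_of_ne h3.2 h2⟩
  let f : L → Q := fun x => if hx : hd x ∈ S then ⟨Real.pi, Or.inl rfl⟩ else
    ⟨hd x, (h.eq_or x).imp_right fun ⟨q, hq⟩ => ⟨q, hq, hirr x hx⟩⟩
  have hf : ∀ x, (f x).1 = if hd x ∈ S then Real.pi else hd x := fun x => by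
    dsimp only [f]
    split_ifs <;> rfl
  have hfm : Monotone f := by
    intro x y hxy
    change (f x).1 ≤ (f y).1
    rw [hf, hf]
    have hm := h.monotone hxy
    split_ifs with h1 h2 h2
    · exact le_rfl
    · rcases hirr y h2 with h3 | h3
      · linarith [h1.1]
      · linarith
    · rcases hirr x h1 with h3 | h3
      · linarith
      · linarith [h2.2]
    · exact hm
  obtain ⟨e⟩ := nonempty_orderIso_prodLex (B := L) hfm fun r => by
    obtain ⟨r, hr⟩ := r
    have hfr : ∀ x, f x = ⟨r, hr⟩ ↔ (if hd x ∈ S then Real.pi else hd x) = r := fun x => by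
      rw [← hf, Subtype.ext_iff]
    by_cases hrpi : r = Real.pi
    · obtain ⟨e⟩ := h.orderIso_subtype_of_pi_mem (S := S) isOpen_Ioo ordConnected_Ioo
        (by constructor <;> linarith)
      refine ⟨(OrderIso.subtypeCongr fun x => ?_).trans e⟩
      rw [hfr, hrpi]
      refine ⟨fun hx => ?_, fun hx => if_pos hx⟩
      by_contra hxS
      rw [if_neg hxS] at hx
      rcases hirr x hxS with h3 | h3 <;> linarith
    · obtain ⟨q, hq, hr⟩ := hr.resolve_left hrpi
      obtain ⟨e⟩ := h.fiber q
      refine ⟨(OrderIso.subtypeCongr fun x => ?_).trans e⟩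
      rw [hfr]
      constructor
      · intro hx
        split_ifs at hx with hxS
        · exact (hrpi hx.symm).elim
        · rw [hx, hq]
      · intro hx
        have hxS : hd x ∉ S := fun hxS => by
          rw [hx, ← hq] at hxS
          rcases hr with hr | hr
          · linarith [hxS.1]
          · linarith [hxS.2]
        rw [if_neg hxS, hx, hq]
  obtain ⟨e'⟩ := hQ
  exact ⟨e.trans (Prod.Lex.prodLexCongr e' (OrderIso.refl L))⟩

theorem orderIso_subtype (h : IsSelfSimilar hd) {S : Set ℝ} (hS : IsOpen S)
    (hc : S.OrdConnected) (hne : S.Nonempty) : Nonempty ({x // hd x ∈ S} ≃o L) := by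
  by_cases hpi : Real.pi ∈ S
  · exact h.orderIso_subtype_of_pi_mem hS hc hpi
  · obtain ⟨e⟩ := h.orderIso_of_pi_notMem hS hc hne hpi
    obtain ⟨e'⟩ := h.orderIso_rat_prodLex
    exact ⟨e.trans e'.symm⟩

/-- A countable sum of copies of a self-similar order is isomorphic to the order itself. -/
theorem orderIso_of_fibers (h : IsSelfSimilar hd) {A I : Type*} [LinearOrder A] [LinearOrder I]
    [Countable I] [Nonempty I] {f : A → I} (hf : Monotone f)
    (hfib : ∀ i, Nonempty ({a // f a = i} ≃o L)) : Nonempty (A ≃o L) := by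
  obtain ⟨e⟩ := nonempty_orderIso_prodLex hf hfib
  obtain ⟨d⟩ := h.orderIso_rat_prodLex
  have : Countable (I ×ₗ ℚ) := inferInstanceAs (Countable (I × ℚ))
  have : Nonempty (I ×ₗ ℚ) := inferInstanceAs (Nonempty (I × ℚ))
  obtain ⟨c⟩ := Order.iso_of_countable_dense (I ×ₗ ℚ) ℚ
  -- `I × L ≅ I × (ℚ × L) ≅ (I × ℚ) × L ≅ ℚ × L ≅ L`, lexicographically.
  exact ⟨e.trans <| (Prod.Lex.prodLexCongr (OrderIso.refl I) d).trans <|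
    (Prod.Lex.prodLexAssoc I ℚ L).symm.trans <|
    (Prod.Lex.prodLexCongr c (OrderIso.refl L)).trans d.symm⟩

end IsSelfSimilar

/-! ### The monoid of transfinite sequences of rationals -/

/-- A sequence of rational numbers whose length is an ordinal, extended by zeros. -/
@[ext]
structure OrdSeq where
  len : Ordinal.{0}
  val : Ordinal.{0} → ℚ
  val_eq_zero : ∀ i, len ≤ i → val i = 0

namespace OrdSeq

theorem ext_of_lt {x y : OrdSeq} (h : x.len = y.len) (hv : ∀ i < x.len, x.val i = y.val i) :
    x = y := by
  refine OrdSeq.ext h (funext fun i => ?_)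
  rcases lt_or_ge i x.len with hi | hi
  · exact hv i hi
  · rw [x.val_eq_zero i hi, y.val_eq_zero i (h ▸ hi)]

/-- The empty sequence is the neutral element for concatenation. -/
instance : One OrdSeq := ⟨⟨0, fun _ => 0, fun _ _ => rfl⟩⟩

/-- Concatenation of sequences, written multiplicatively. -/
noncomputable instance : Mul OrdSeq :=
  ⟨fun x y => ⟨x.len + y.len, fun i => if i < x.len then x.val i else y.val (i - x.len),
    fun i hi => by
      have h1 : x.len ≤ i := le_self_add.trans hi
      rw [if_neg (not_lt.2 h1), y.val_eq_zero]
      exact (Ordinal.le_sub_of_le h1).2 hi⟩⟩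

@[simp] theorem len_one : (1 : OrdSeq).len = 0 := rfl

@[simp] theorem len_mul (x y : OrdSeq) : (x * y).len = x.len + y.len := rfl

theorem val_mul (x y : OrdSeq) (i : Ordinal) :
    (x * y).val i = if i < x.len then x.val i else y.val (i - x.len) := rfl

theorem val_mul_of_lt {x : OrdSeq} (y : OrdSeq) {i : Ordinal} (h : i < x.len) :
    (x * y).val i = x.val i := if_pos h

@[simp] theorem val_mul_add (x y : OrdSeq) (i : Ordinal) :
    (x * y).val (x.len + i) = y.val i := by
  rw [val_mul, if_neg (not_lt.2 le_self_add), Ordinal.add_sub_cancel]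

theorem lt_or_exists_eq_add (x : OrdSeq) (i : Ordinal) : i < x.len ∨ ∃ j, i = x.len + j := by
  rcases lt_or_ge i x.len with h | h
  · exact Or.inl h
  · exact Or.inr ⟨i - x.len, (Ordinal.add_sub_cancel_of_le h).symm⟩

noncomputable instance : Monoid OrdSeq where
  one_mul x := ext_of_lt (zero_add _) fun i _ => by simpa using val_mul_add 1 x i
  mul_one x := ext_of_lt (add_zero _) fun i hi => val_mul_of_lt _ (by simpa using hi)
  mul_assoc x y z := ext_of_lt (add_assoc _ _ _) fun i _ => by
    rcases x.lt_or_exists_eq_add i with h | ⟨j, rfl⟩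
    · rw [val_mul_of_lt _ h, val_mul_of_lt _ (h.trans_le le_self_add), val_mul_of_lt _ h]
    · rw [val_mul_add]
      rcases y.lt_or_exists_eq_add j with h | ⟨k, rfl⟩
      · rw [val_mul_of_lt _ h, val_mul_of_lt, val_mul_add]
        exact (add_lt_add_iff_left _).2 h
      · rw [val_mul_add, ← add_assoc, ← len_mul, val_mul_add]

/-- The initial segment of length `a` of a sequence. -/
noncomputable def take (x : OrdSeq) (a : Ordinal.{0}) : OrdSeq :=
  ⟨min a x.len, fun i => if i < a then x.val i else 0, fun i hi => by
    split_ifs with h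
    · exact x.val_eq_zero i ((min_le_iff.1 hi).resolve_left (not_le.2 h))
    · rfl⟩

/-- The sequence that remains after removing the initial segment of length `a`. -/
noncomputable def drop (x : OrdSeq) (a : Ordinal.{0}) : OrdSeq :=
  ⟨x.len - a, fun i => x.val (a + i), fun _ hi => x.val_eq_zero _ (Ordinal.sub_le.1 hi)⟩

@[simp] theorem len_take (x : OrdSeq) (a : Ordinal) : (x.take a).len = min a x.len := rfl

theorem len_take_of_le {x : OrdSeq} {a : Ordinal} (h : a ≤ x.len) : (x.take a).len = a :=
  min_eq_left h

theorem val_take_of_lt (x : OrdSeq) {a i : Ordinal} (h : i < a) : (x.take a).val i = x.val i :=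
  if_pos h

@[simp] theorem len_drop (x : OrdSeq) (a : Ordinal) : (x.drop a).len = x.len - a := rfl

@[simp] theorem val_drop (x : OrdSeq) (a i : Ordinal) : (x.drop a).val i = x.val (a + i) := rfl

theorem take_mul_drop {x : OrdSeq} {a : Ordinal} (h : a ≤ x.len) : x.take a * x.drop a = x := by
  refine ext_of_lt ?_ fun i _ => ?_
  · rw [len_mul, len_take_of_le h, len_drop, Ordinal.add_sub_cancel_of_le h]
  · rcases lt_or_ge i a with hi | hi
    · rw [val_mul_of_lt _ (by rwa [len_take_of_le h]), val_take_of_lt _ hi]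
    · obtain ⟨j, rfl⟩ : ∃ j, i = a + j := ⟨_, (Ordinal.add_sub_cancel_of_le hi).symm⟩
      have := val_mul_add (x.take a) (x.drop a) j
      rwa [len_take_of_le h, val_drop] at this

theorem take_of_le {x : OrdSeq} {a : Ordinal} (h : x.len ≤ a) : x.take a = x :=
  ext_of_lt (min_eq_right h) fun _ hi => val_take_of_lt _ (hi.trans_le (min_le_left _ _))

theorem drop_of_le {x : OrdSeq} {a : Ordinal} (h : x.len ≤ a) : x.drop a = 1 := by
  have h0 : (x.drop a).len = 0 := Ordinal.sub_eq_zero_iff_le.2 h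
  exact ext_of_lt h0 fun i hi => absurd (h0 ▸ hi) not_lt_zero

theorem take_mul_of_le {x : OrdSeq} (y : OrdSeq) {a : Ordinal} (h : a ≤ x.len) :
    (x * y).take a = x.take a := by
  refine ext_of_lt ?_ fun i hi => ?_
  · rw [len_take_of_le h, len_take_of_le (h.trans le_self_add)]
  · have hi := hi.trans_le (min_le_left _ _)
    rw [val_take_of_lt _ hi, val_take_of_lt _ hi, val_mul_of_lt _ (hi.trans_le h)]

theorem take_mul_add (x y : OrdSeq) (a : Ordinal) :
    (x * y).take (x.len + a) = x * y.take a := by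
  refine ext_of_lt ?_ fun i hi => ?_
  · simp only [len_take, len_mul, min_add_add_left]
  · rw [val_take_of_lt _ (hi.trans_le (min_le_left _ _))]
    rcases x.lt_or_exists_eq_add i with h | ⟨j, rfl⟩
    · rw [val_mul_of_lt _ h, val_mul_of_lt _ h]
    · rw [val_mul_add, val_mul_add, val_take_of_lt]
      exact (add_lt_add_iff_left _).1 (hi.trans_le (min_le_left _ _))

theorem drop_mul_of_le {x : OrdSeq} (y : OrdSeq) {a : Ordinal} (h : a ≤ x.len) :
    (x * y).drop a = x.drop a * y := by
  have h1 : (x.take a * (x.drop a * y)).drop a = x.drop a * y := by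
    refine ext_of_lt ?_ fun i _ => ?_
    · rw [len_drop, len_mul, len_take_of_le h, Ordinal.add_sub_cancel]
    · have := val_mul_add (x.take a) (x.drop a * y) i
      rwa [len_take_of_le h] at this
  rw [← h1, ← mul_assoc, take_mul_drop h]

theorem drop_mul_add (x y : OrdSeq) (a : Ordinal) : (x * y).drop (x.len + a) = y.drop a := by
  refine ext_of_lt ?_ fun i _ => ?_
  · rw [len_drop, len_mul, len_drop, Ordinal.add_sub_add_cancel]
  · rw [val_drop, add_assoc, val_mul_add, val_drop]

@[simp] theorem drop_mul_len (x y : OrdSeq) : (x * y).drop x.len = y := by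
  have := drop_mul_add x y 0
  rw [add_zero] at this
  rw [this]
  exact ext_of_lt (by simp) fun i _ => by simp

@[simp] theorem take_mul_len (x y : OrdSeq) : (x * y).take x.len = x := by
  rw [take_mul_of_le _ le_rfl, take_of_le le_rfl]

theorem take_take {x : OrdSeq} {a b : Ordinal} (h : a ≤ b) : (x.take b).take a = x.take a := by
  refine ext_of_lt ?_ fun i hi => ?_
  · simp only [len_take, ← min_assoc, min_eq_left h]
  · have hi := hi.trans_le (min_le_left _ _)
    rw [val_take_of_lt _ hi, val_take_of_lt _ hi, val_take_of_lt _ (hi.trans_le h)]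

/-- The sequence of length one with value `q`. -/
noncomputable def single (q : ℚ) : OrdSeq :=
  ⟨1, fun i => if i = 0 then q else 0, fun i hi => if_neg fun h => by
    rw [h] at hi
    exact not_lt.2 hi zero_lt_one⟩

@[simp] theorem len_single (q : ℚ) : (single q).len = 1 := rfl

@[simp] theorem val_single_zero (q : ℚ) : (single q).val 0 = q := if_pos rfl

theorem eq_single {x : OrdSeq} (h : x.len = 1) : x = single (x.val 0) :=
  ext_of_lt h fun i hi => by
    rw [h, Order.lt_one_iff] at hi
    rw [hi, val_single_zero]

/-! #### Infinite concatenations -/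

/-- The concatenation of the first `n` terms of a sequence of sequences. -/
noncomputable def prefixProd (w : ℕ → OrdSeq) : ℕ → OrdSeq
  | 0 => 1
  | n + 1 => prefixProd w n * w n

theorem prefixProd_succ (w : ℕ → OrdSeq) (n : ℕ) :
    prefixProd w (n + 1) = prefixProd w n * w n := rfl

theorem prefixProd_succ' (w : ℕ → OrdSeq) (n : ℕ) :
    prefixProd w (n + 1) = w 0 * prefixProd (fun i => w (i + 1)) n := by
  induction n with
  | zero => rw [prefixProd_succ, prefixProd, prefixProd, one_mul, mul_one]
  | succ n ih => rw [prefixProd_succ, ih, prefixProd_succ, mul_assoc]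

theorem prefixProd_mem {S : Submonoid OrdSeq} {w : ℕ → OrdSeq} (h : ∀ n, w n ∈ S) (n : ℕ) :
    prefixProd w n ∈ S := by
  induction n with
  | zero => exact S.one_mem
  | succ n ih => exact S.mul_mem ih (h n)

theorem exists_prefixProd_eq_mul (w : ℕ → OrdSeq) {m n : ℕ} (h : m ≤ n) :
    ∃ y, prefixProd w n = prefixProd w m * y := by
  induction n, h using Nat.le_induction with
  | base => exact ⟨1, (mul_one _).symm⟩
  | succ n _ ih =>
    obtain ⟨y, hy⟩ := ih
    exact ⟨y * w n, by rw [prefixProd_succ, hy, mul_assoc]⟩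

theorem val_prefixProd_eq (w : ℕ → OrdSeq) {m n : ℕ} {i : Ordinal}
    (hm : i < (prefixProd w m).len) (hn : i < (prefixProd w n).len) :
    (prefixProd w m).val i = (prefixProd w n).val i := by
  wlog h : m ≤ n generalizing m n
  · exact (this hn hm (le_of_not_ge h)).symm
  obtain ⟨y, hy⟩ := exists_prefixProd_eq_mul w h
  rw [hy, val_mul_of_lt _ hm]

open Classical in
/-- The concatenation of infinitely many sequences. -/
noncomputable def infiniteProd (w : ℕ → OrdSeq) : OrdSeq where
  len := ⨆ n, (prefixProd w n).len
  val i := if h : ∃ n, i < (prefixProd w n).len then (prefixProd w h.choose).val i else 0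
  val_eq_zero _ hi := dif_neg fun ⟨n, h⟩ =>
    not_lt.2 (hi.trans' (Ordinal.le_iSup (fun n => (prefixProd w n).len) n)) h

theorem lt_len_infiniteProd {w : ℕ → OrdSeq} {i : Ordinal} :
    i < (infiniteProd w).len ↔ ∃ n, i < (prefixProd w n).len :=
  Ordinal.lt_iSup_iff

theorem val_infiniteProd {w : ℕ → OrdSeq} {i : Ordinal} {n : ℕ} (h : i < (prefixProd w n).len) :
    (infiniteProd w).val i = (prefixProd w n).val i := by
  have hex : ∃ n, i < (prefixProd w n).len := ⟨n, h⟩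
  exact (dif_pos hex).trans (val_prefixProd_eq w hex.choose_spec h)

theorem infiniteProd_eq (w : ℕ → OrdSeq) :
    infiniteProd w = w 0 * infiniteProd fun n => w (n + 1) := by
  have hlen : ∀ i, i < (infiniteProd w).len ↔ i < (w 0 * infiniteProd fun n => w (n + 1)).len := by
    intro i
    rw [lt_len_infiniteProd]
    constructor
    · rintro ⟨n, hn⟩
      obtain ⟨y, hy⟩ := exists_prefixProd_eq_mul w n.le_succ
      have hn' : i < (prefixProd w (n + 1)).len := hn.trans_le (by rw [hy]; exact le_self_add)
      rw [prefixProd_succ'] at hn'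
      rcases (w 0).lt_or_exists_eq_add i with h | ⟨j, rfl⟩
      · exact h.trans_le le_self_add
      · exact (add_lt_add_iff_left _).2
          (lt_len_infiniteProd.2 ⟨n, (add_lt_add_iff_left _).1 hn'⟩)
    · intro hi
      rcases (w 0).lt_or_exists_eq_add i with h | ⟨j, rfl⟩
      · exact ⟨1, by rw [prefixProd_succ']; exact h.trans_le le_self_add⟩
      · obtain ⟨n, hn⟩ := lt_len_infiniteProd.1 ((add_lt_add_iff_left _).1 hi)
        exact ⟨n + 1, by rw [prefixProd_succ']; exact (add_lt_add_iff_left _).2 hn⟩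
  refine ext_of_lt (eq_of_forall_lt_iff hlen) fun i hi => ?_
  obtain ⟨n, hn⟩ := lt_len_infiniteProd.1 hi
  obtain ⟨y, hy⟩ := exists_prefixProd_eq_mul w n.le_succ
  have hn' : i < (prefixProd w (n + 1)).len := hn.trans_le (by rw [hy]; exact le_self_add)
  rw [val_infiniteProd hn']
  rw [prefixProd_succ'] at hn' ⊢
  rcases (w 0).lt_or_exists_eq_add i with h | ⟨j, rfl⟩
  · rw [val_mul_of_lt _ h, val_mul_of_lt _ h]
  · rw [val_mul_add, val_mul_add, val_infiniteProd ((add_lt_add_iff_left _).1 hn')]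

/-! #### Submonoids of sequences -/

/-- The sequences in which each value occurs only finitely many times. -/
def finiteToOne : Submonoid OrdSeq where
  carrier := {x | ∀ q, {i | i < x.len ∧ x.val i = q}.Finite}
  one_mem' q := by simp
  mul_mem' {x y} hx hy q := by
    refine ((hx q).union ((hy q).image (x.len + ·))).subset ?_
    rintro i ⟨hi, hq⟩
    rcases x.lt_or_exists_eq_add i with h | ⟨j, rfl⟩
    · exact Or.inl ⟨h, (val_mul_of_lt y h) ▸ hq⟩
    · exact Or.inr ⟨j, ⟨(add_lt_add_iff_left _).1 hi, val_mul_add x y j ▸ hq⟩, rfl⟩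

/-- The sequences with all values in a given set. -/
def valuesIn (V : Set ℚ) : Submonoid OrdSeq where
  carrier := {x | ∀ i < x.len, x.val i ∈ V}
  one_mem' i hi := (not_lt_zero hi).elim
  mul_mem' {x y} hx hy i hi := by
    rcases x.lt_or_exists_eq_add i with h | ⟨j, rfl⟩
    · exact (val_mul_of_lt y h) ▸ hx i h
    · exact val_mul_add x y j ▸ hy j ((add_lt_add_iff_left _).1 hi)

theorem mem_valuesIn {V : Set ℚ} {x : OrdSeq} : x ∈ valuesIn V ↔ ∀ i < x.len, x.val i ∈ V := Iff.rfl

/-- The sequences of countable length. -/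
def countableLength : Submonoid OrdSeq where
  carrier := {x | x.len < ω₁}
  one_mem' := Ordinal.omega_pos 1
  mul_mem' {x y} hx hy := by
    refine lt_omega_one_of_countable_Iio (((countable_Iio_of_lt_omega_one hx).union
      ((countable_Iio_of_lt_omega_one hy).image (x.len + ·))).mono fun i hi => ?_)
    rcases x.lt_or_exists_eq_add i with h | ⟨j, rfl⟩
    · exact Or.inl h
    · have hi : x.len + j < x.len + y.len := hi
      exact Or.inr ⟨j, (add_lt_add_iff_left _).1 hi, rfl⟩

/-- The sequences all of whose initial and final segments belong to `S`. -/
def segmentsIn (S : Submonoid OrdSeq) : Submonoid OrdSeq where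
  carrier := {x | ∀ a, x.take a ∈ S ∧ x.drop a ∈ S}
  one_mem' a := by
    rw [take_of_le zero_le, drop_of_le zero_le]
    exact ⟨S.one_mem, S.one_mem⟩
  mul_mem' {x y} hx hy a := by
    have hxS : x ∈ S := take_of_le (le_refl x.len) ▸ (hx x.len).1
    have hyS : y ∈ S := take_of_le (le_refl y.len) ▸ (hy y.len).1
    rcases le_total a x.len with h | h
    · rw [take_mul_of_le _ h, drop_mul_of_le _ h]
      exact ⟨(hx a).1, S.mul_mem (hx a).2 hyS⟩
    · obtain ⟨b, rfl⟩ : ∃ b, a = x.len + b := ⟨_, (Ordinal.add_sub_cancel_of_le h).symm⟩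
      rw [take_mul_add, drop_mul_add]
      exact ⟨S.mul_mem hxS (hy b).1, (hy b).2⟩

end OrdSeq

namespace OrdSeq

/-! #### The generating sequences -/

theorem single_mem_countableLength (q : ℚ) : single q ∈ countableLength :=
  Ordinal.one_lt_omega0.trans_le (Ordinal.omega0_le_omega 1)

/-- Unpairing turns an enumeration into one with infinite repetition: `Nat.pair m k` is at least `k`
and has first component `m`. -/
theorem exists_ladder {δ : Ordinal.{0}} (h0 : 0 < δ) (hδ : δ < ω₁) :
    ∃ f : ℕ → Ordinal.{0}, (∀ n, f n < δ) ∧ ∀ β < δ, ∀ k, ∃ n, f (k + n) = β := by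
  obtain ⟨e, he⟩ := (countable_Iio_of_lt_omega_one hδ).exists_eq_range ⟨0, h0⟩
  refine ⟨fun n => e n.unpair.1, fun n => ?_, fun β hβ k => ?_⟩
  · have : e n.unpair.1 ∈ Iio δ := he ▸ ⟨_, rfl⟩
    exact this
  · have : β ∈ range e := he ▸ hβ
    obtain ⟨m, rfl⟩ := this
    obtain ⟨n, hn⟩ := Nat.exists_eq_add_of_le (Nat.right_le_pair m k)
    exact ⟨n, by simp [← hn]⟩

open Classical in
/-- A sequence of ordinals below `δ` in which each ordinal below `δ` occurs infinitely often, if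
`δ` is a nonzero countable ordinal. -/
noncomputable def ladder (δ : Ordinal.{0}) : ℕ → Ordinal.{0} :=
  -- The default value `δ` is not below `δ`, so that the recursion defining `gen` stops there, in
  -- particular at `δ = 0`.
  if h : 0 < δ ∧ δ < ω₁ then (exists_ladder h.1 h.2).choose else fun _ => δ

theorem ladder_lt {δ : Ordinal.{0}} (h0 : 0 < δ) (hδ : δ < ω₁) (n : ℕ) : ladder δ n < δ := by
  rw [ladder, dif_pos ⟨h0, hδ⟩]
  exact (exists_ladder h0 hδ).choose_spec.1 n

theorem exists_ladder_eq {δ : Ordinal.{0}} (hδ : δ < ω₁) {β : Ordinal.{0}} (hβ : β < δ) (k : ℕ) :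
    ∃ n, ladder δ (k + n) = β := by
  have h0 : 0 < δ := zero_le.trans_lt hβ
  rw [ladder, dif_pos ⟨h0, hδ⟩]
  exact (exists_ladder h0 hδ).choose_spec.2 β hβ k

open Classical in
/-- Sequences `gen δ k`, of length at least `δ`, such that `gen δ k` is the concatenation of the
sequences `gen (ladder δ n) n` for `n ≥ k`, with all values of the form `1 / (n + 2)`, `n ≥ k`. -/
noncomputable def gen (δ : Ordinal.{0}) (k : ℕ) : OrdSeq :=
  if h : ∀ n, ladder δ n < δ then
    infiniteProd fun n =>
      have := h (k + n)
      gen (ladder δ (k + n)) (k + n)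
  else single (1 / (k + 2))
termination_by δ

theorem gen_zero (k : ℕ) : gen 0 k = single (1 / (k + 2)) := by
  rw [gen, dif_neg fun h => not_lt_zero (h 0)]

theorem gen_eq_infiniteProd {δ : Ordinal.{0}} (h0 : 0 < δ) (hδ : δ < ω₁) (k : ℕ) :
    gen δ k = infiniteProd fun n => gen (ladder δ (k + n)) (k + n) := by
  rw [gen, dif_pos (ladder_lt h0 hδ)]

/-- The parameter `k` exists for this identity: removing the first factor of a generator leaves a
generator again, which keeps the tree closed under final segments. -/
theorem gen_eq_mul {δ : Ordinal.{0}} (h0 : 0 < δ) (hδ : δ < ω₁) (k : ℕ) :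
    gen δ k = gen (ladder δ k) k * gen δ (k + 1) := by
  rw [gen_eq_infiniteProd h0 hδ, infiniteProd_eq, gen_eq_infiniteProd h0 hδ (k + 1)]
  simp only [add_zero, add_assoc, add_comm 1]

theorem gen_eq_prefixProd_mul {δ : Ordinal.{0}} (h0 : 0 < δ) (hδ : δ < ω₁) (k n : ℕ) :
    gen δ k = prefixProd (fun n => gen (ladder δ (k + n)) (k + n)) n * gen δ (k + n) := by
  induction n with
  | zero => exact (one_mul _).symm
  | succ n ih => rw [prefixProd_succ, mul_assoc, ← add_assoc, ← gen_eq_mul h0 hδ, ← ih]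

theorem gen_induction {p : OrdSeq → Prop} (single : ∀ k : ℕ, p (single (1 / (k + 2))))
    (prod : ∀ δ, 0 < δ → δ < ω₁ → ∀ k, (∀ n, p (gen (ladder δ n) n)) → p (gen δ k))
    {δ : Ordinal.{0}}
    (hδ : δ < ω₁) (k : ℕ) : p (gen δ k) := by
  induction δ using WellFoundedLT.induction generalizing k with
  | ind δ ih =>
    rcases eq_zero_or_pos δ with rfl | h0
    · rw [gen_zero]
      exact single k
    · exact prod δ h0 hδ k fun n => ih _ (ladder_lt h0 hδ n) ((ladder_lt h0 hδ n).trans hδ) n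

theorem len_gen_pos {δ : Ordinal.{0}} (hδ : δ < ω₁) (k : ℕ) : 0 < (gen δ k).len := by
  refine gen_induction (p := fun x => 0 < x.len) (fun k => ?_) (fun δ h0 hδ k ih => ?_) hδ k
  · exact zero_lt_one
  · rw [gen_eq_mul h0 hδ]
    exact (ih k).trans_le le_self_add

/-- Every `β < δ` occurs in the ladder beyond `k`, so some factor has length at least `β`, and a
nonempty tail follows it. -/
theorem le_len_gen {δ : Ordinal.{0}} (hδ : δ < ω₁) (k : ℕ) : δ ≤ (gen δ k).len := by
  induction δ using WellFoundedLT.induction generalizing k with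
  | ind δ ih =>
    refine le_of_forall_lt fun β hβ => ?_
    have h0 : 0 < δ := zero_le.trans_lt hβ
    obtain ⟨n, hn⟩ := exists_ladder_eq hδ hβ k
    rw [gen_eq_prefixProd_mul h0 hδ k n, gen_eq_mul h0 hδ, hn]
    simp only [len_mul]
    calc β ≤ (gen β (k + n)).len := ih β hβ (hβ.trans hδ) _
      _ < (gen β (k + n)).len + (gen δ (k + n + 1)).len :=
        lt_add_of_pos_right _ (len_gen_pos hδ _)
      _ ≤ _ := le_add_self

theorem gen_mem_countableLength {δ : Ordinal.{0}} (hδ : δ < ω₁) (k : ℕ) :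
    gen δ k ∈ countableLength := by
  refine gen_induction (fun k => ?_) (fun δ h0 hδ k ih => ?_) hδ k
  · exact single_mem_countableLength _
  · rw [gen_eq_infiniteProd h0 hδ]
    exact Ordinal.iSup_lt_omega_one fun n => prefixProd_mem (S := countableLength)
      (fun n => ih (k + n)) n

/-- The factor with index `n` is built with second parameter `n ≥ k`, so its values are no larger
than `1 / (n + 2)`. -/
theorem exists_val_gen_eq {δ : Ordinal.{0}} (hδ : δ < ω₁) (k : ℕ) :
    ∀ i < (gen δ k).len, ∃ j : ℕ, k ≤ j ∧ (gen δ k).val i = 1 / (j + 2) := by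
  induction δ using WellFoundedLT.induction generalizing k with
  | ind δ ih =>
    intro i hi
    rcases eq_zero_or_pos δ with rfl | h0
    · rw [gen_zero] at hi ⊢
      obtain rfl : i = 0 := Order.lt_one_iff.1 hi
      exact ⟨k, le_rfl, val_single_zero _⟩
    · rw [gen_eq_infiniteProd h0 hδ] at hi ⊢
      obtain ⟨n, hn⟩ := lt_len_infiniteProd.1 hi
      rw [val_infiniteProd hn]
      have hS : prefixProd (fun n => gen (ladder δ (k + n)) (k + n)) n ∈
          valuesIn {q | ∃ j : ℕ, k ≤ j ∧ q = 1 / (j + 2)} := by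
        refine prefixProd_mem (fun n => mem_valuesIn.2 fun i hi => ?_) n
        obtain ⟨j, h1, h2⟩ := ih _ (ladder_lt h0 hδ (k + n))
          ((ladder_lt h0 hδ (k + n)).trans hδ) (k + n) i hi
        exact ⟨j, (Nat.le_add_right k n).trans h1, h2⟩
      exact hS i hn

theorem gen_mem_valuesIn {δ : Ordinal.{0}} (hδ : δ < ω₁) (k : ℕ) :
    gen δ k ∈ valuesIn (Ioo 0 1) := by
  intro i hi
  obtain ⟨j, -, h⟩ := exists_val_gen_eq hδ k i hi
  rw [h]
  constructor
  · positivity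
  · rw [div_lt_one (by positivity)]
    linarith [(Nat.cast_nonneg j : (0 : ℚ) ≤ j)]

theorem single_mem_finiteToOne (q : ℚ) : single q ∈ finiteToOne := by
  intro r
  refine (finite_singleton 0).subset fun i hi => ?_
  exact Order.lt_one_iff.1 hi.1

/-- A given value `q` is missing from a late enough tail `gen δ (k + n)`, and the finitely many
factors before it are finite-to-one by induction. -/
theorem gen_mem_finiteToOne {δ : Ordinal.{0}} (hδ : δ < ω₁) (k : ℕ) : gen δ k ∈ finiteToOne := by
  refine gen_induction (fun k => single_mem_finiteToOne _) (fun δ h0 hδ k ih q => ?_) hδ k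
  have hn : ∃ n : ℕ, ∀ i < (gen δ (k + n)).len, (gen δ (k + n)).val i ≠ q := by
    by_cases hq : ∃ j : ℕ, q = 1 / (j + 2)
    · obtain ⟨j, rfl⟩ := hq
      refine ⟨j + 1, fun i hi h => ?_⟩
      obtain ⟨j', h1, h2⟩ := exists_val_gen_eq hδ _ i hi
      rw [h2, one_div, one_div, inv_inj] at h
      have : (j' : ℚ) = j := by linarith
      have : j' = j := by exact_mod_cast this
      omega
    · refine ⟨0, fun i hi h => ?_⟩
      obtain ⟨j', -, h2⟩ := exists_val_gen_eq hδ _ i hi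
      exact hq ⟨j', h.symm.trans h2⟩
  obtain ⟨n, hn⟩ := hn
  rw [gen_eq_prefixProd_mul h0 hδ k n]
  have hp : prefixProd (fun n => gen (ladder δ (k + n)) (k + n)) n ∈ finiteToOne :=
    prefixProd_mem (fun n => ih (k + n)) n
  refine ((hp q).union (finite_empty)).subset ?_
  rintro i ⟨hi, hq⟩
  rcases lt_or_exists_eq_add (prefixProd (fun n => gen (ladder δ (k + n)) (k + n)) n) i with
    h | ⟨j, rfl⟩
  · exact Or.inl ⟨h, (val_mul_of_lt _ h) ▸ hq⟩
  · rw [val_mul_add] at hq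
    exact (hn j ((add_lt_add_iff_left _).1 hi) hq).elim

/-! #### The tree of sequences -/

/-- The generators of the tree of height at most `α`. -/
def generators (α : Ordinal.{0}) : Set OrdSeq :=
  range single ∪ {x | ∃ δ < α, ∃ k, x = gen δ k}

/-- The tree of all finite concatenations of generators. -/
noncomputable def tree : Submonoid OrdSeq := Submonoid.closure (generators ω₁)

theorem single_mem_tree (q : ℚ) : single q ∈ tree := Submonoid.subset_closure (Or.inl ⟨q, rfl⟩)

theorem gen_mem_tree {δ : Ordinal.{0}} (hδ : δ < ω₁) (k : ℕ) : gen δ k ∈ tree :=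
  Submonoid.subset_closure (Or.inr ⟨δ, hδ, k, rfl⟩)

theorem tree_le {S : Submonoid OrdSeq} (h1 : ∀ q, single q ∈ S) (h2 : ∀ δ < ω₁, ∀ k, gen δ k ∈ S) :
    tree ≤ S := by
  rw [tree, Submonoid.closure_le]
  rintro _ (⟨q, rfl⟩ | ⟨δ, hδ, k, rfl⟩)
  · exact h1 q
  · exact h2 δ hδ k

theorem tree_le_countableLength : tree ≤ countableLength :=
  tree_le single_mem_countableLength fun _ hδ k => gen_mem_countableLength hδ k

theorem tree_le_finiteToOne : tree ≤ finiteToOne :=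
  tree_le single_mem_finiteToOne fun _ hδ k => gen_mem_finiteToOne hδ k

theorem single_mem_segmentsIn_tree (q : ℚ) : single q ∈ segmentsIn tree := by
  intro a
  rcases eq_zero_or_pos a with rfl | h
  · have h1 := take_mul_len 1 (single q)
    have h2 := drop_mul_len 1 (single q)
    rw [len_one, one_mul] at h1 h2
    rw [h1, h2]
    exact ⟨tree.one_mem, single_mem_tree q⟩
  · have h1 : (single q).len ≤ a := Order.one_le_iff_pos.2 h
    rw [take_of_le h1, drop_of_le h1]
    exact ⟨single_mem_tree q, tree.one_mem⟩

/-- A proper cut of a generator falls inside a finite product of earlier generators, to which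
induction applies, and what follows this product is again a generator. -/
theorem tree_le_segmentsIn : tree ≤ segmentsIn tree := by
  refine tree_le single_mem_segmentsIn_tree fun δ hδ k => ?_
  refine gen_induction (fun k => single_mem_segmentsIn_tree _) (fun δ h0 hδ k ih a => ?_) hδ k
  rcases lt_or_ge a (gen δ k).len with h | h
  · have h' := h
    rw [gen_eq_infiniteProd h0 hδ, lt_len_infiniteProd] at h'
    obtain ⟨n, hn⟩ := h'
    have hp : prefixProd (fun n => gen (ladder δ (k + n)) (k + n)) n ∈ segmentsIn tree :=
      prefixProd_mem (fun n => ih (k + n)) n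
    rw [gen_eq_prefixProd_mul h0 hδ k n, take_mul_of_le _ hn.le, drop_mul_of_le _ hn.le]
    exact ⟨(hp a).1, tree.mul_mem (hp a).2 (gen_mem_tree hδ _)⟩
  · rw [take_of_le h, drop_of_le h]
    exact ⟨gen_mem_tree hδ k, tree.one_mem⟩

theorem take_mem_tree {x : OrdSeq} (hx : x ∈ tree) (a : Ordinal.{0}) : x.take a ∈ tree :=
  (tree_le_segmentsIn hx a).1

theorem drop_mem_tree {x : OrdSeq} (hx : x ∈ tree) (a : Ordinal.{0}) : x.drop a ∈ tree :=
  (tree_le_segmentsIn hx a).2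

theorem countable_closure {S : Set OrdSeq} (hS : S.Countable) :
    (Submonoid.closure S : Set OrdSeq).Countable := by
  have := hS.to_subtype
  refine (countable_range fun l : List S => (l.map Subtype.val).prod).mono fun x hx => ?_
  obtain ⟨l, hl, rfl⟩ := Submonoid.exists_list_of_mem_closure hx
  exact ⟨l.pmap (fun x hx => ⟨x, hx⟩) hl, by simp [List.map_pmap]⟩

/-- A factor is no longer than the product, and `gen δ k` has length at least `δ`. So a product of
length below `α` uses only singles and generators with `δ < α`. -/
theorem countable_tree_level {α : Ordinal.{0}} (hα : α < ω₁) :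
    {x | x ∈ tree ∧ x.len < α}.Countable := by
  have hc : (generators α).Countable := by
    refine (countable_range _).union ?_
    have : {x | ∃ δ < α, ∃ k, x = gen δ k} = ⋃ δ ∈ Iio α, range (gen δ) := by
      ext x
      simp [eq_comm]
    rw [this]
    exact (countable_Iio_of_lt_omega_one hα).biUnion fun δ _ => countable_range _
  refine (countable_closure hc).mono ?_
  rintro x ⟨hx, hlen⟩
  change x ∈ Submonoid.closure (generators α)
  induction hx using Submonoid.closure_induction with
  | mem x hx =>
    refine Submonoid.subset_closure (hx.imp_right ?_)
    rintro ⟨δ, hδ, k, rfl⟩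
    exact ⟨δ, (le_len_gen hδ k).trans_lt hlen, k, rfl⟩
  | one => exact Submonoid.one_mem _
  | mul x y _ _ hx hy =>
    exact Submonoid.mul_mem _ (hx (le_self_add.trans_lt hlen)) (hy (le_add_self.trans_lt hlen))

theorem exists_mem_tree_len_eq {α : Ordinal.{0}} (hα : α < ω₁) :
    ∃ x ∈ tree, x.len = α ∧ x ∈ valuesIn (Ioo 0 1) := by
  have h := le_len_gen hα 0
  refine ⟨_, take_mem_tree (gen_mem_tree hα 0) α, len_take_of_le h, fun i hi => ?_⟩
  rw [len_take_of_le h] at hi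
  rw [val_take_of_lt _ hi]
  exact gen_mem_valuesIn hα 0 i (hi.trans_le h)

end OrdSeq

namespace OrdSeq

/-! #### The order of the sequences extended by `π` -/

/-- The values of a sequence, followed by `π` and then by zeros. -/
noncomputable def valPi (x : OrdSeq) (i : Ordinal.{0}) : ℝ :=
  if i < x.len then (x.val i : ℝ) else if i = x.len then Real.pi else 0

theorem valPi_of_lt {x : OrdSeq} {i : Ordinal} (h : i < x.len) : x.valPi i = x.val i := if_pos h

@[simp] theorem valPi_len (x : OrdSeq) : x.valPi x.len = Real.pi := by simp [valPi]

theorem valPi_of_len_lt {x : OrdSeq} {i : Ordinal} (h : x.len < i) : x.valPi i = 0 := by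
  rw [valPi, if_neg h.not_gt, if_neg h.ne']

@[simp] theorem valPi_mul_add (x y : OrdSeq) (i : Ordinal) :
    (x * y).valPi (x.len + i) = y.valPi i := by
  simp only [valPi, len_mul, add_lt_add_iff_left, add_right_inj, val_mul_add]

theorem rat_ne_pi (q : ℚ) : (q : ℝ) ≠ Real.pi := fun h => irrational_pi ⟨q, h⟩

theorem valPi_eq_pi {x : OrdSeq} {i : Ordinal} : x.valPi i = Real.pi ↔ i = x.len := by
  refine ⟨fun h => ?_, fun h => h ▸ valPi_len x⟩
  by_contra hne
  rcases lt_or_gt_of_ne hne with h' | h'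
  · rw [valPi_of_lt h'] at h
    exact rat_ne_pi _ h
  · rw [valPi_of_len_lt h'] at h
    exact Real.pi_ne_zero h.symm

/-- If two sequences followed by `π` agree below `a`, and `a` is at most the length of the first
one, then it is at most the length of the second one. -/
theorem le_len_of_valPi_eq {x y : OrdSeq} {a : Ordinal} (ha : a ≤ x.len)
    (h : ∀ i < a, x.valPi i = y.valPi i) : a ≤ y.len := by
  by_contra hlt
  have h1 := h _ (not_le.1 hlt)
  rw [valPi_len, valPi_eq_pi] at h1
  exact (h1 ▸ not_le.1 hlt).not_ge ha

theorem take_eq_iff {x y : OrdSeq} {a : Ordinal} (ha : a ≤ x.len) :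
    (a ≤ y.len ∧ y.take a = x.take a) ↔ ∀ i < a, x.valPi i = y.valPi i := by
  constructor
  · rintro ⟨hy, h⟩ i hi
    rw [valPi_of_lt (hi.trans_le ha), valPi_of_lt (hi.trans_le hy), ← val_take_of_lt x hi, ← h,
      val_take_of_lt y hi]
  · intro h
    have hy := le_len_of_valPi_eq ha h
    refine ⟨hy, ext_of_lt ?_ fun i hi => ?_⟩
    · rw [len_take_of_le hy, len_take_of_le ha]
    · rw [len_take_of_le hy] at hi
      have := h i hi
      rw [valPi_of_lt (hi.trans_le ha), valPi_of_lt (hi.trans_le hy)] at this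
      rw [val_take_of_lt _ hi, val_take_of_lt _ hi]
      exact_mod_cast this.symm

theorem eq_of_valPi_eq {x y : OrdSeq} (h : ∀ i ≤ x.len, x.valPi i = y.valPi i) : x = y := by
  have hlen : x.len = y.len := by
    have := h _ le_rfl
    rwa [valPi_len, eq_comm, valPi_eq_pi] at this
  obtain ⟨-, h2⟩ := (take_eq_iff (le_refl x.len)).2 fun i hi => h i hi.le
  rw [take_of_le le_rfl, take_of_le hlen.ge] at h2
  exact h2.symm

/-- `t` is an initial segment of `x`. -/
def IsPrefix (t x : OrdSeq) : Prop := t.len ≤ x.len ∧ x.take t.len = t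

theorem IsPrefix.mul_drop {t x : OrdSeq} (h : IsPrefix t x) : t * x.drop t.len = x := by
  conv_rhs => rw [← take_mul_drop h.1, h.2]

theorem isPrefix_mul (t x : OrdSeq) : IsPrefix t (t * x) := ⟨le_self_add, take_mul_len t x⟩

/-- The sequence `x` is smaller than `y` at the place `i`, where they first differ. -/
def LtAt (x y : OrdSeq) (i : Ordinal.{0}) : Prop :=
  (∀ j < i, x.valPi j = y.valPi j) ∧ x.valPi i < y.valPi i

theorem ltAt_mul_left {t x y : OrdSeq} {i : Ordinal} :
    LtAt (t * x) (t * y) (t.len + i) ↔ LtAt x y i := by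
  unfold LtAt
  rw [valPi_mul_add, valPi_mul_add]
  refine and_congr_left fun _ => ⟨fun h j hj => ?_, fun h j hj => ?_⟩
  · have := h (t.len + j) ((add_lt_add_iff_left _).2 hj)
    rwa [valPi_mul_add, valPi_mul_add] at this
  · rcases t.lt_or_exists_eq_add j with hjt | ⟨k, rfl⟩
    · rw [valPi_of_lt (hjt.trans_le le_self_add), valPi_of_lt (hjt.trans_le le_self_add),
        val_mul_of_lt _ hjt, val_mul_of_lt _ hjt]
    · rw [valPi_mul_add, valPi_mul_add]
      exact h k ((add_lt_add_iff_left _).1 hj)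

theorem exists_ltAt_mul_left {t x y : OrdSeq} :
    (∃ i, LtAt (t * x) (t * y) i) ↔ ∃ i, LtAt x y i := by
  refine ⟨fun ⟨i, hi⟩ => ?_, fun ⟨i, hi⟩ => ⟨_, ltAt_mul_left.2 hi⟩⟩
  rcases t.lt_or_exists_eq_add i with h | ⟨k, rfl⟩
  · have := hi.2
    rw [valPi_of_lt (h.trans_le le_self_add), valPi_of_lt (h.trans_le le_self_add),
        val_mul_of_lt _ h, val_mul_of_lt _ h] at this
    exact (lt_irrefl _ this).elim
  · exact ⟨k, ltAt_mul_left.1 hi⟩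

/-- Agreement up to and including the place of `π` in `x` already gives `x = y`. -/
theorem LtAt.le_len_left {x y : OrdSeq} {i : Ordinal} (h : LtAt x y i) : i ≤ x.len := by
  by_contra hlt
  have : x = y := eq_of_valPi_eq fun j hj => h.1 j (hj.trans_lt (not_le.1 hlt))
  exact (this ▸ h.2).false

theorem LtAt.le_len_right {x y : OrdSeq} {i : Ordinal} (h : LtAt x y i) : i ≤ y.len :=
  le_len_of_valPi_eq h.le_len_left h.1

theorem LtAt.unique {x y : OrdSeq} {i j : Ordinal} (hi : LtAt x y i) (hj : LtAt x y j) : i = j := by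
  rcases lt_trichotomy i j with h | h | h
  · exact (hi.2.ne (hj.1 i h)).elim
  · exact h
  · exact (hj.2.ne (hi.1 j h)).elim

end OrdSeq

/-! ### From `RatSeq` to `OrdSeq` and back -/

namespace RatSeq

open Classical in
/-- A sequence with countable length, considered as a sequence indexed by all ordinals. -/
noncomputable def toOrdSeq (x : RatSeq) : OrdSeq where
  len := x.len.toOrd
  val i := if h : ∃ j : Iio x.len, i = (j : (ω₁ : Ordinal.{0}).ToType).toOrd then x.val h.choose
    else 0
  val_eq_zero i hi := dif_neg fun ⟨j, hj⟩ => by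
    rw [hj] at hi
    exact not_lt.2 hi (Ordinal.ToType.mk.symm.lt_iff_lt.2 j.2)

theorem toOrd_lt_toOrd {i j : (ω₁ : Ordinal.{0}).ToType} :
    (i.toOrd : Ordinal) < j.toOrd ↔ i < j :=
  Ordinal.ToType.mk.symm.lt_iff_lt

theorem toOrd_inj {i j : (ω₁ : Ordinal.{0}).ToType} : (i.toOrd : Ordinal) = j.toOrd ↔ i = j :=
  Subtype.ext_iff.symm.trans Ordinal.ToType.mk.symm.injective.eq_iff

theorem exists_toOrd_eq {a : Ordinal.{0}} (h : a < ω₁) :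
    ∃ i : (ω₁ : Ordinal.{0}).ToType, (i.toOrd : Ordinal) = a :=
  ⟨Ordinal.ToType.mk ⟨a, h⟩, by simp [Ordinal.ToType.toOrd]⟩

theorem toOrd_lt_omega_one (i : (ω₁ : Ordinal.{0}).ToType) : (i.toOrd : Ordinal) < ω₁ := i.toOrd.2

@[simp] theorem len_toOrdSeq (x : RatSeq) : x.toOrdSeq.len = x.len.toOrd := rfl

theorem val_toOrdSeq (x : RatSeq) {i : (ω₁ : Ordinal.{0}).ToType} (h : i < x.len) :
    x.toOrdSeq.val i.toOrd = x.val ⟨i, h⟩ := by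
  have hex : ∃ j : Iio x.len, (i.toOrd : Ordinal) = (j : (ω₁ : Ordinal.{0}).ToType).toOrd :=
    ⟨⟨i, h⟩, rfl⟩
  refine (dif_pos hex).trans (congrArg x.val (Subtype.ext ?_))
  exact (toOrd_inj.1 hex.choose_spec).symm

theorem toOrdSeq_injective : Function.Injective toOrdSeq := by
  intro x y h
  have hlen : x.len = y.len := toOrd_inj.1 (congrArg OrdSeq.len h)
  refine eq_of_len_val hlen fun i hx hy => ?_
  rw [← val_toOrdSeq, ← val_toOrdSeq, h]

theorem exists_toOrdSeq_eq {y : OrdSeq} (hy : y.len < ω₁) : ∃ x : RatSeq, x.toOrdSeq = y := by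
  obtain ⟨l, hl⟩ := exists_toOrd_eq hy
  refine ⟨⟨l, fun i => y.val (i : (ω₁ : Ordinal.{0}).ToType).toOrd⟩, ?_⟩
  refine OrdSeq.ext_of_lt hl fun i hi => ?_
  obtain ⟨j, rfl⟩ := exists_toOrd_eq (hi.trans (toOrd_lt_omega_one _))
  exact val_toOrdSeq _ (toOrd_lt_toOrd.1 hi)

theorem le_iff_toOrdSeq {x y : RatSeq} : x ≤ y ↔
    x.toOrdSeq.len ≤ y.toOrdSeq.len ∧ y.toOrdSeq.take x.toOrdSeq.len = x.toOrdSeq := by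
  have hle : x.toOrdSeq.len ≤ y.toOrdSeq.len ↔ x.len ≤ y.len :=
    Ordinal.ToType.mk.symm.le_iff_le
  constructor
  · rintro ⟨h, hv⟩
    refine ⟨hle.2 h, OrdSeq.ext_of_lt (OrdSeq.len_take_of_le (hle.2 h)) fun i hi => ?_⟩
    rw [OrdSeq.len_take_of_le (hle.2 h)] at hi
    obtain ⟨j, rfl⟩ := exists_toOrd_eq (hi.trans (toOrd_lt_omega_one _))
    have hj : j < x.len := toOrd_lt_toOrd.1 hi
    rw [OrdSeq.val_take_of_lt _ hi, val_toOrdSeq _ hj, val_toOrdSeq _ (hj.trans_le h)]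
    exact hv ⟨j, hj⟩
  · rintro ⟨h, hv⟩
    refine ⟨hle.1 h, fun i => ?_⟩
    have hi : (i.1.toOrd : Ordinal) < x.toOrdSeq.len := toOrd_lt_toOrd.2 i.2
    have h1 := OrdSeq.val_take_of_lt y.toOrdSeq hi
    rw [hv, val_toOrdSeq x i.2, val_toOrdSeq y (lt_of_lt_of_le i.2 (hle.1 h))] at h1
    exact h1.symm

theorem appendPi_apply (x : RatSeq) (i : (ω₁ : Ordinal.{0}).ToType) :
    ofLex x.appendPi i = x.toOrdSeq.valPi i.toOrd := by
  simp only [appendPi, ofLex_toLex, OrdSeq.valPi, len_toOrdSeq, toOrd_lt_toOrd, toOrd_inj]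
  split_ifs with h
  · rw [val_toOrdSeq x h]
  · rfl
  · rfl

theorem appendPi_lt_appendPi {x y : RatSeq} :
    x.appendPi < y.appendPi ↔ ∃ i, OrdSeq.LtAt x.toOrdSeq y.toOrdSeq i := by
  constructor
  · rintro ⟨i, h1, h2⟩
    refine ⟨i.toOrd, fun j hj => ?_, ?_⟩
    · obtain ⟨j, rfl⟩ := exists_toOrd_eq (hj.trans (toOrd_lt_omega_one _))
      rw [← appendPi_apply, ← appendPi_apply]
      exact h1 j (toOrd_lt_toOrd.1 hj)
    · rw [← appendPi_apply, ← appendPi_apply]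
      exact h2
  · rintro ⟨i, hi⟩
    obtain ⟨i, rfl⟩ := exists_toOrd_eq (hi.le_len_left.trans_lt (toOrd_lt_omega_one _))
    refine ⟨i, fun j hj => ?_, ?_⟩
    · have := hi.1 _ (toOrd_lt_toOrd.2 hj)
      rw [← appendPi_apply, ← appendPi_apply] at this
      exact this
    · have := hi.2
      rw [← appendPi_apply, ← appendPi_apply] at this
      exact this

end RatSeq

/-! ### The Aronszajn tree -/

/-- The tree of sequences, as a subset of `RatSeq`. -/
def seqTree : Set RatSeq := {x | x.toOrdSeq ∈ OrdSeq.tree}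

namespace SeqTree

open OrdSeq

/-- The underlying sequence of an element of the tree. -/
noncomputable def seq (x : PiLex seqTree) : OrdSeq := x.1.toOrdSeq

theorem seq_mem (x : PiLex seqTree) : seq x ∈ tree := x.2

theorem seq_injective : Function.Injective seq :=
  RatSeq.toOrdSeq_injective.comp Subtype.val_injective

theorem exists_seq_eq {y : OrdSeq} (hy : y ∈ tree) : ∃ x, seq x = y := by
  obtain ⟨x, rfl⟩ := RatSeq.exists_toOrdSeq_eq (tree_le_countableLength hy)
  exact ⟨⟨x, hy⟩, rfl⟩

/-- The element of the tree with a given underlying sequence. -/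
noncomputable def mk (y : OrdSeq) (hy : y ∈ tree) : PiLex seqTree := (exists_seq_eq hy).choose

@[simp] theorem seq_mk (y : OrdSeq) (hy : y ∈ tree) : seq (mk y hy) = y :=
  (exists_seq_eq hy).choose_spec

theorem lt_iff {x y : PiLex seqTree} : x < y ↔ ∃ i, LtAt (seq x) (seq y) i :=
  RatSeq.appendPi_lt_appendPi

theorem lt_iff_of_seq_eq {t : OrdSeq} {x y x' y' : PiLex seqTree} (hx : seq x = t * seq x')
    (hy : seq y = t * seq y') : x < y ↔ x' < y' := by
  rw [lt_iff, lt_iff, hx, hy, exists_ltAt_mul_left]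

/-- The first coordinate. -/
noncomputable def head (x : PiLex seqTree) : ℝ := (seq x).valPi 0

/-- The elements of the tree with a given initial segment form a copy of the whole order. -/
noncomputable def coneIso (t : OrdSeq) (ht : t ∈ tree) :
    {x : PiLex seqTree // IsPrefix t (seq x)} ≃o PiLex seqTree := by
  have hseq : ∀ x : {x : PiLex seqTree // IsPrefix t (seq x)},
      seq x.1 = t * (seq x.1).drop t.len := fun x => x.2.mul_drop.symm
  let e : {x : PiLex seqTree // IsPrefix t (seq x)} ≃ PiLex seqTree :=
    { toFun := fun x => mk ((seq x.1).drop t.len) (drop_mem_tree (seq_mem _) _)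
      invFun := fun x => ⟨mk (t * seq x) (tree.mul_mem ht (seq_mem x)), by simp [isPrefix_mul]⟩
      left_inv := fun x => Subtype.ext (seq_injective (by rw [seq_mk, seq_mk, ← hseq]))
      right_inv := fun x => seq_injective (by simp) }
  refine { toEquiv := e, map_rel_iff' := ?_ }
  intro x y
  rw [← not_lt, ← not_lt, not_iff_not]
  refine (lt_iff_of_seq_eq (t := t) ?_ ?_).symm
  · exact (hseq y).trans (by simp [e])
  · exact (hseq x).trans (by simp [e])

theorem head_coneIso {t : OrdSeq} {ht : t ∈ tree}
    (x : {x : PiLex seqTree // IsPrefix t (seq x)}) :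
    head (coneIso t ht x) = (seq x.1).valPi t.len := by
  have h1 : seq (coneIso t ht x) = (seq x.1).drop t.len :=
    seq_mk _ (drop_mem_tree (seq_mem _) _)
  have h2 := valPi_mul_add t ((seq x.1).drop t.len) 0
  rw [x.2.mul_drop, add_zero] at h2
  rw [head, h1, h2]

/-- The elements that agree with `x` below `i` and whose value at `i` lies in `S` form a copy of the
elements whose first coordinate lies in `S`. -/
theorem agreeIso (x : PiLex seqTree) {i : Ordinal.{0}} (hi : i ≤ (seq x).len) (S : Set ℝ) :
    Nonempty ({s : PiLex seqTree // (∀ j < i, (seq x).valPi j = (seq s).valPi j) ∧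
      (seq s).valPi i ∈ S} ≃o {w : PiLex seqTree // head w ∈ S}) := by
  have hlen : ((seq x).take i).len = i := len_take_of_le hi
  let e := coneIso ((seq x).take i) (take_mem_tree (seq_mem x) i)
  have he : ∀ s, head (e s) = (seq s.1).valPi i := fun s =>
    (head_coneIso s).trans (congrArg _ hlen)
  let e' : {s : {y // IsPrefix ((seq x).take i) (seq y)} // (seq s.1).valPi i ∈ S} ≃o
      {w : PiLex seqTree // head w ∈ S} :=
    { toEquiv := e.toEquiv.subtypeEquiv fun s => by
        rw [← he]
        rfl
      map_rel_iff' := e.le_iff_le }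
  refine ⟨(OrderIso.subtypeSubtype _ _ fun s => ?_).symm.trans e'⟩
  rw [← take_eq_iff hi]
  refine Iff.trans ?_ (exists_prop (b := (seq s).valPi i ∈ S)).symm
  change _ ↔ (((seq x).take i).len ≤ _ ∧ (seq s).take ((seq x).take i).len = _) ∧ _
  rw [hlen]

/-- The fibre over `q` is the cone above the one-term sequence `q`; the empty sequence has first
coordinate `π`. -/
theorem isSelfSimilar_head : IsSelfSimilar head where
  monotone x y hxy := by
    rcases hxy.eq_or_lt with rfl | h
    · exact le_rfl
    · obtain ⟨i, h1, h2⟩ := lt_iff.1 h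
      rcases eq_zero_or_pos i with rfl | hi
      · exact h2.le
      · exact (h1 0 hi).le
  fiber q := by
    refine ⟨(OrderIso.subtypeCongr fun x => ?_).trans (coneIso (single q) (single_mem_tree q))⟩
    change _ ↔ 1 ≤ (seq x).len ∧ (seq x).take 1 = single q
    constructor
    · intro h
      have h0 : 0 < (seq x).len := by
        by_contra h0
        have : (seq x).len = 0 := by simpa using h0
        rw [head, ← this, valPi_len] at h
        exact rat_ne_pi q h.symm
      have h1 : 1 ≤ (seq x).len := Order.one_le_iff_pos.2 h0
      refine ⟨h1, ?_⟩
      rw [eq_single (len_take_of_le h1), val_take_of_lt _ zero_lt_one]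
      rw [head, valPi_of_lt h0] at h
      rw [Rat.cast_injective h]
    · rintro ⟨h1, h2⟩
      have h0 : 0 < (seq x).len := zero_lt_one.trans_le h1
      rw [head, valPi_of_lt h0, ← val_take_of_lt (seq x) zero_lt_one, h2, val_single_zero]
  eq_or x := by
    rcases eq_zero_or_pos (seq x).len with h | h
    · left
      rw [head, ← h, valPi_len]
    · exact Or.inr ⟨_, valPi_of_lt h⟩

theorem countable_Iic_len (x : PiLex seqTree) : Countable (Iic (seq x).len) :=
  ((countable_Iio_of_lt_omega_one (tree_le_countableLength (seq_mem x))).insert _).mono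
    (fun _ hi => (lt_or_eq_of_le hi).symm) |>.to_subtype

/-- Classify the elements above `x` by the place where they leave `x`. The earlier they leave, the
larger they are, hence the dual order on the places. Each class is a copy of the elements whose
first coordinate lies in an open ray, so of the whole order, and there are countably many places. -/
theorem orderIso_Ioi (x : PiLex seqTree) : Nonempty (Ioi x ≃o PiLex seqTree) := by
  have hex : ∀ s : Ioi x, ∃ i : (Iic (seq x).len)ᵒᵈ,
      LtAt (seq x) (seq s.1) (OrderDual.ofDual i).1 :=
    fun s => by
      obtain ⟨i, hi⟩ := lt_iff.1 s.2
      exact ⟨OrderDual.toDual ⟨i, hi.le_len_left⟩, hi⟩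
  choose f hf using hex
  have := countable_Iic_len x
  have : Countable (Iic (seq x).len)ᵒᵈ := this
  have : Nonempty (Iic (seq x).len)ᵒᵈ := ⟨OrderDual.toDual ⟨_, mem_Iic.2 le_rfl⟩⟩
  refine isSelfSimilar_head.orderIso_of_fibers (f := f) (fun s s' hss => ?_) fun i => ?_
  · by_contra hlt
    have hlt : ((OrderDual.ofDual (f s)).1 : Ordinal) < (OrderDual.ofDual (f s')).1 := not_le.1 hlt
    refine not_lt.2 hss (lt_iff.2 ⟨(OrderDual.ofDual (f s)).1, fun j hj => ?_, ?_⟩)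
    · rw [← (hf s).1 j hj, ← (hf s').1 j (hj.trans hlt)]
    · rw [← (hf s').1 _ hlt]
      exact (hf s).2
  · obtain ⟨e⟩ := agreeIso x (OrderDual.ofDual i).2 (Ioi ((seq x).valPi (OrderDual.ofDual i).1))
    obtain ⟨e'⟩ := isSelfSimilar_head.orderIso_subtype
      (isOpen_Ioi (a := (seq x).valPi (OrderDual.ofDual i).1)) ordConnected_Ioi nonempty_Ioi
    refine ⟨(OrderIso.subtypeSubtype _ _ fun s => ?_).trans (e.trans e')⟩
    constructor
    · intro hs
      have hs : LtAt (seq x) (seq s) (OrderDual.ofDual i).1 := hs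
      refine ⟨lt_iff.2 ⟨_, hs⟩, ?_⟩
      exact OrderDual.ofDual.injective (Subtype.ext ((hf _).unique hs))
    · rintro ⟨hs, rfl⟩
      exact hf ⟨s, hs⟩

/-- As for `orderIso_Ioi`, except that below `x` the elements leaving later are larger, so the
places keep their order. -/
theorem orderIso_Iio (x : PiLex seqTree) : Nonempty (Iio x ≃o PiLex seqTree) := by
  have hex : ∀ s : Iio x, ∃ i : Iic (seq x).len, LtAt (seq s.1) (seq x) i :=
    fun s => by
      obtain ⟨i, hi⟩ := lt_iff.1 s.2
      exact ⟨⟨i, hi.le_len_right⟩, hi⟩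
  choose f hf using hex
  have := countable_Iic_len x
  have : Nonempty (Iic (seq x).len) := ⟨⟨_, mem_Iic.2 le_rfl⟩⟩
  refine isSelfSimilar_head.orderIso_of_fibers (f := f) (fun s s' hss => ?_) fun i => ?_
  · by_contra hlt
    have hlt : ((f s').1 : Ordinal) < (f s).1 := not_le.1 hlt
    refine not_lt.2 hss (lt_iff.2 ⟨(f s').1, fun j hj => ?_, ?_⟩)
    · rw [(hf s).1 j (hj.trans hlt), (hf s').1 j hj]
    · rw [(hf s).1 _ hlt]
      exact (hf s').2
  · obtain ⟨e⟩ := agreeIso x i.2 (Iio ((seq x).valPi i))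
    obtain ⟨e'⟩ := isSelfSimilar_head.orderIso_subtype
      (isOpen_Iio (a := (seq x).valPi i)) ordConnected_Iio nonempty_Iio
    refine ⟨(OrderIso.subtypeSubtype _ _ fun s => ?_).trans (e.trans e')⟩
    constructor
    · intro hs
      have hs : LtAt (seq s) (seq x) i := ⟨fun j hj => (hs.1 j hj).symm, hs.2⟩
      exact ⟨lt_iff.2 ⟨_, hs⟩, Subtype.ext ((hf _).unique hs)⟩
    · rintro ⟨hs, rfl⟩
      exact ⟨fun j hj => ((hf ⟨s, hs⟩).1 j hj).symm, (hf ⟨s, hs⟩).2⟩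

end SeqTree

/-! ### Levels and chains of the tree -/

/-- A partial order with a length function like that of sequences is a tree, and its levels consist
of the elements of a given length. -/
theorem isOrderTree_and_treeLevel_eq {P : Type} [PartialOrder P] {ℓ : P → Ordinal.{0}}
    (hmono : ∀ s t, s < t → ℓ s < ℓ t) (hex : ∀ t, ∀ a < ℓ t, ∃ s < t, ℓ s = a)
    (hcomp : ∀ s s' t : P, s ≤ t → s' ≤ t → s ≤ s' ∨ s' ≤ s) :
    IsOrderTree P ∧ ∀ α : Ordinal.{0}, treeLevel P α = {t | ℓ t = α} := by
  have hlt : ∀ (t : P) (s s' : Iio t), s < s' ↔ ℓ s.1 < ℓ s'.1 := fun t s s' => by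
    refine ⟨fun h => hmono _ _ h, fun h => ?_⟩
    have hne : s ≠ s' := fun h' => h.ne (congrArg (fun r => ℓ r.1) h')
    rcases hcomp s.1 s'.1 t s.2.le s'.2.le with h' | h'
    · exact lt_of_le_of_ne h' hne
    · exact (h.not_gt (hmono _ _ (lt_of_le_of_ne h' fun e => hne (Subtype.ext e.symm)))).elim
  have key : ∀ t, Nonempty (((· < ·) : Iio t → Iio t → Prop) ≃r
      ((· < ·) : (ℓ t).ToType → (ℓ t).ToType → Prop)) := by
    intro t
    let f : Iio t → Iio (ℓ t) := fun s => ⟨ℓ s.1, hmono _ _ s.2⟩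
    have hf : Function.Bijective f := by
      constructor
      · intro s s' h
        have h : ℓ s.1 = ℓ s'.1 := congrArg Subtype.val h
        rcases hcomp s.1 s'.1 t s.2.le s'.2.le with h' | h'
        · rcases h'.eq_or_lt with h' | h'
          · exact Subtype.ext h'
          · exact ((hmono _ _ h').ne h).elim
        · rcases h'.eq_or_lt with h' | h'
          · exact Subtype.ext h'.symm
          · exact ((hmono _ _ h').ne' h).elim
      · rintro ⟨a, ha⟩
        obtain ⟨s, hs, rfl⟩ := hex t a ha
        exact ⟨⟨s, hs⟩, rfl⟩
    refine ⟨⟨(Equiv.ofBijective f hf).trans Ordinal.ToType.mk.toEquiv, ?_⟩⟩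
    intro s s'
    exact (Ordinal.ToType.mk.lt_iff_lt (x := f s) (y := f s')).trans (hlt t s s').symm
  have hwo : IsOrderTree P := fun t => (key t).some.toRelEmbedding.isWellOrder
  refine ⟨hwo, fun α => ?_⟩
  rw [hwo.treeLevel_eq]
  ext t
  have : hwo.rank t = ℓ t := by
    have := hwo t
    exact (Ordinal.type_eq.2 (key t)).trans (Ordinal.type_toType _)
  rw [mem_ofPred_eq, this, mem_ofPred_eq]

/-! ### Incomparable sequences and uncountable incompatible families -/

namespace OrdSeq

theorem isPrefix_or_isPrefix_or_exists (x y : OrdSeq) : IsPrefix x y ∨ IsPrefix y x ∨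
    ∃ i, i < x.len ∧ i < y.len ∧ (∀ j < i, x.val j = y.val j) ∧ x.val i ≠ y.val i := by
  by_cases h : ∃ i, i < x.len ∧ i < y.len ∧ x.val i ≠ y.val i
  · have hwf : WellFounded ((· < ·) : Ordinal.{0} → Ordinal.{0} → Prop) := IsWellFounded.wf
    obtain ⟨i, ⟨h1, h2, h3⟩, hmin⟩ := hwf.has_min {i | i < x.len ∧ i < y.len ∧ x.val i ≠ y.val i} h
    refine Or.inr (Or.inr ⟨i, h1, h2, fun j hj => ?_, h3⟩)
    by_contra hne
    exact hmin j ⟨hj.trans h1, hj.trans h2, hne⟩ hj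
  · push Not at h
    rcases le_total x.len y.len with hle | hle
    · refine Or.inl ⟨hle, ext_of_lt (len_take_of_le hle) fun i hi => ?_⟩
      rw [len_take_of_le hle] at hi
      rw [val_take_of_lt _ hi, h i hi (hi.trans_le hle)]
    · refine Or.inr (Or.inl ⟨hle, ext_of_lt (len_take_of_le hle) fun i hi => ?_⟩)
      rw [len_take_of_le hle] at hi
      rw [val_take_of_lt _ hi, h i (hi.trans_le hle) hi]

theorem isPrefix_take (x : OrdSeq) {a : Ordinal} (h : a ≤ x.len) : IsPrefix (x.take a) x := by
  unfold IsPrefix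
  rw [len_take_of_le h]
  exact ⟨h, rfl⟩

theorem IsPrefix.val_eq {x y : OrdSeq} (h : IsPrefix x y) {i : Ordinal} (hi : i < x.len) :
    y.val i = x.val i := by
  rw [← val_take_of_lt y hi, h.2]

/-- Finite-to-one sequences of all countable successor lengths contain an uncountable family of
pairwise incompatible ones. -/
theorem exists_uncountable_incompatible {t : Ordinal.{0} → OrdSeq}
    (ht : ∀ i < ω₁, t i ∈ finiteToOne ∧ i < (t i).len) :
    ∃ A : Set Ordinal.{0}, A ⊆ Iio ω₁ ∧ ¬ A.Countable ∧
      ∀ i ∈ A, ∀ j ∈ A, i < j → (t i).take (i + 1) ≠ (t j).take (i + 1) := by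
  -- The colour records the value at `i` and how often it occurred before. If `t i` and `t j` agree
  -- up to `i < j` and take the same value at `i` and `j` respectively, that value occurred at least
  -- once more before `j`, so the colours differ. Countably many colours leave an uncountable colour
  -- class.
  let colour : Ordinal.{0} → ℚ × ℕ := fun i =>
    ((t i).val i, {j | j < i ∧ (t i).val j = (t i).val i}.ncard)
  have hc : ∃ c, ¬ {i | i < ω₁ ∧ colour i = c}.Countable := by
    by_contra! h
    have : (Iio (ω₁ : Ordinal.{0})).Countable :=
      (countable_iUnion h).mono fun i hi => by
        exact mem_iUnion_of_mem (colour i) ⟨hi, rfl⟩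
    exact (lt_omega_one_of_countable_Iio this).false
  obtain ⟨c, hc⟩ := hc
  refine ⟨_, fun i hi => hi.1, hc, fun i hi j hj hij heq => ?_⟩
  have hval : ∀ k ≤ i, (t i).val k = (t j).val k := fun k hk => by
    have := congrArg (fun x => x.val k) heq
    rwa [val_take_of_lt _ (Order.lt_add_one_iff.2 hk),
      val_take_of_lt _ (Order.lt_add_one_iff.2 hk)] at this
  have hcol : colour i = colour j := hi.2.trans hj.2.symm
  have h1 : (t i).val i = (t j).val j := congrArg Prod.fst hcol
  have h2 : {k | k < i ∧ (t i).val k = (t i).val i}.ncard =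
      {k | k < j ∧ (t j).val k = (t j).val j}.ncard := congrArg Prod.snd hcol
  have hsub : {k | k < i ∧ (t i).val k = (t i).val i} ⊆
      {k | k < j ∧ (t j).val k = (t j).val j} := fun k hk => by
    refine ⟨hk.1.trans hij, ?_⟩
    rw [← hval k hk.1.le, hk.2, h1]
  refine (Set.ncard_lt_ncard ((Set.ssubset_iff_of_subset hsub).2
    ⟨i, ⟨hij, ?_⟩, fun h => h.1.false⟩) ?_).ne h2
  · rw [← hval i le_rfl, h1]
  · exact ((ht j hj.1).1 _).subset fun k hk => ⟨hk.1.trans (ht j hj.1).2, hk.2⟩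

end OrdSeq

namespace RatSeq

theorem le_iff_isPrefix {x y : RatSeq} : x ≤ y ↔ OrdSeq.IsPrefix x.toOrdSeq y.toOrdSeq :=
  le_iff_toOrdSeq

theorem isOrderTree_and_treeLevel_eq {S : Set RatSeq} (hS : ∀ x ∈ S, ∀ y : RatSeq, y ≤ x → y ∈ S) :
    IsOrderTree S ∧ ∀ α : Ordinal.{0}, treeLevel S α = {t | t.1.toOrdSeq.len = α} := by
  refine _root_.isOrderTree_and_treeLevel_eq (fun s t hst => ?_) (fun t a ha => ?_)
    fun s s' t hs hs' => ?_
  · have hle := le_iff_isPrefix.1 hst.le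
    refine lt_of_le_of_ne hle.1 fun h => hst.ne (Subtype.ext (toOrdSeq_injective ?_))
    rw [← hle.2, h, OrdSeq.take_of_le le_rfl]
  · have hlen : (t.1.toOrdSeq.take a).len = a := OrdSeq.len_take_of_le ha.le
    obtain ⟨y, hy⟩ := exists_toOrdSeq_eq (y := t.1.toOrdSeq.take a)
      (hlen.trans_lt (ha.trans (toOrd_lt_omega_one _)))
    have hle : y ≤ t.1 := le_iff_isPrefix.2 (hy ▸ OrdSeq.isPrefix_take _ ha.le)
    refine ⟨⟨y, hS _ t.2 _ hle⟩, lt_of_le_of_ne hle fun h => ?_, ?_⟩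
    · have h := congrArg (fun z : S => z.1.toOrdSeq.len) h
      dsimp only at h
      rw [hy, hlen] at h
      exact ha.ne h
    · rw [hy, hlen]
  · have hs := le_iff_isPrefix.1 hs
    have hs' := le_iff_isPrefix.1 hs'
    rcases le_total s.1.toOrdSeq.len s'.1.toOrdSeq.len with h | h
    · refine Or.inl (le_iff_isPrefix.2 ⟨h, ?_⟩)
      rw [← hs'.2, OrdSeq.take_take h, hs.2]
    · refine Or.inr (le_iff_isPrefix.2 ⟨h, ?_⟩)
      rw [← hs.2, OrdSeq.take_take h, hs'.2]

end RatSeq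

namespace SeqTree

open OrdSeq

theorem mem_seqTree_of_le (x : RatSeq) (hx : x ∈ seqTree) (y : RatSeq) (hy : y ≤ x) :
    y ∈ seqTree := by
  have h := (RatSeq.le_iff_isPrefix.1 hy).2
  change y.toOrdSeq ∈ tree
  rw [← h]
  exact take_mem_tree hx _

theorem countable_len_lt {α : Ordinal.{0}} (hα : α < ω₁) :
    {x : RatSeq | x ∈ seqTree ∧ x.toOrdSeq.len < α}.Countable :=
  (countable_tree_level hα).preimage_of_injOn RatSeq.toOrdSeq_injective.injOn

theorem countable_seq_len_lt {α : Ordinal.{0}} (hα : α < ω₁) :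
    {x : PiLex seqTree | (seq x).len < α}.Countable :=
  ((countable_tree_level hα).preimage_of_injOn seq_injective.injOn).mono
    fun x hx => by exact ⟨seq_mem x, hx⟩

theorem succ_lt_omega_one {α : Ordinal.{0}} (hα : α < ω₁) : α + 1 < ω₁ :=
  (Cardinal.isSuccLimit_omega 1).succ_lt hα

/-- By countability of the levels, an uncountable chain contains sequences longer than any given
countable ordinal. Finite-to-one sequences of such lengths cannot be pairwise compatible. -/
theorem countable_of_isChain {C : Set seqTree} (hC : IsChain (· ≤ ·) C) : C.Countable := by
  by_contra hunc
  have hex : ∀ i < ω₁, ∃ x ∈ C, i < x.1.toOrdSeq.len := by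
    intro i hi
    by_contra! h
    have hsub : C ⊆ (Subtype.val : seqTree → RatSeq) ⁻¹'
        {x | x ∈ seqTree ∧ x.toOrdSeq.len < i + 1} :=
      fun x hx => ⟨x.2, Order.lt_add_one_iff.2 (h x hx)⟩
    exact hunc (((countable_len_lt (succ_lt_omega_one hi)).preimage_of_injOn
      Subtype.val_injective.injOn).mono hsub)
  have : Nonempty seqTree := by
    obtain ⟨x, -⟩ := hex 0 (Ordinal.omega_pos 1)
    exact ⟨x⟩
  choose! x hxC hx using hex
  obtain ⟨A, hA, hAc, hinc⟩ := exists_uncountable_incompatible (t := fun i => (x i).1.toOrdSeq)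
    fun i hi => ⟨tree_le_finiteToOne (x i).2, hx i hi⟩
  have hA2 : ∃ i ∈ A, ∃ j ∈ A, i < j := by
    by_contra! h
    refine hAc (Set.Subsingleton.countable fun i hi j hj => ?_)
    exact le_antisymm (h j hj i hi) (h i hi j hj)
  obtain ⟨i, hi, j, hj, hij⟩ := hA2
  refine hinc i hi j hj hij ?_
  have h1 : i + 1 ≤ (x i).1.toOrdSeq.len := Order.add_one_le_of_lt (hx i (hA hi))
  have h2 : i + 1 ≤ (x j).1.toOrdSeq.len := Order.add_one_le_of_lt (hij.trans (hx j (hA hj)))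
  rcases hC.total (hxC i (hA hi)) (hxC j (hA hj)) with h | h
  · have h := RatSeq.le_iff_isPrefix.1 h
    conv_lhs => rw [← h.2, take_take h1]
  · have h := RatSeq.le_iff_isPrefix.1 h
    conv_rhs => rw [← h.2, take_take h2]

theorem isAronszajnTree : IsAronszajnTree seqTree := by
  obtain ⟨h1, h2⟩ := RatSeq.isOrderTree_and_treeLevel_eq mem_seqTree_of_le
  refine ⟨h1, fun α => ?_, fun α => ?_, fun C hC => countable_of_isChain hC⟩
  · rw [h2]
    constructor
    · rintro ⟨t, rfl⟩
      exact tree_le_countableLength t.2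
    · intro hα
      obtain ⟨x, hx, hlen, -⟩ := exists_mem_tree_len_eq hα
      obtain ⟨y, rfl⟩ := RatSeq.exists_toOrdSeq_eq (tree_le_countableLength hx)
      exact ⟨⟨y, hx⟩, hlen⟩
  · rw [h2]
    rcases lt_or_ge α ω₁ with hα | hα
    · refine ((countable_len_lt (succ_lt_omega_one hα)).preimage_of_injOn
        Subtype.val_injective.injOn).mono fun x hx => by
          exact ⟨x.2, Order.lt_add_one_iff.2 (le_of_eq hx)⟩
    · have : {t : seqTree | t.1.toOrdSeq.len = α} = ∅ := by
        refine eq_empty_of_forall_notMem fun t ht => ?_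
        exact not_lt.2 hα (ht ▸ tree_le_countableLength t.2)
      rw [this]
      exact countable_empty

/-! ### The order and the space of cuts -/

instance : Nonempty (PiLex seqTree) := ⟨mk 1 tree.one_mem⟩

instance : NoMinOrder (PiLex seqTree) := ⟨fun x => by
  obtain ⟨q, hq⟩ := exists_rat_lt (head x)
  refine ⟨mk (single q) (single_mem_tree q), lt_iff.2 ⟨0, fun j hj => (not_lt_zero hj).elim, ?_⟩⟩
  rw [seq_mk, valPi_of_lt zero_lt_one, val_single_zero]
  exact hq⟩

/-- There are `ℵ₁` possible lengths, each attained by countably many elements. -/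
theorem mk_piLex_le : #(PiLex seqTree) ≤ ℵ₁ := by
  have h := Cardinal.mk_le_mk_mul_of_mk_preimage_le (c := ℵ₀) (fun x : PiLex seqTree => x.1.len)
    fun b => by
      have hsub : (fun x : PiLex seqTree => x.1.len) ⁻¹' {b} ⊆
          {x | (seq x).len < (b.toOrd : Ordinal) + 1} := fun x hx => by
        have hx : x.1.len = b := hx
        have hlen : (seq x).len = (b.toOrd : Ordinal) := by rw [← hx]; rfl
        exact Order.lt_add_one_iff.2 hlen.le
      rw [Cardinal.le_aleph0_iff_set_countable]
      exact (countable_seq_len_lt (succ_lt_omega_one (RatSeq.toOrd_lt_omega_one b))).mono hsub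
  refine h.trans ?_
  rw [Cardinal.mk_toType, ← Cardinal.ord_aleph, Cardinal.card_ord,
    Cardinal.mul_aleph0_eq (Cardinal.aleph0_le_aleph 1)]

/-- If two sequences differ, then so do all their extensions, in the same direction. -/
theorem lt_of_isPrefix {s t : OrdSeq} {i : Ordinal.{0}} (hs : i < s.len) (ht : i < t.len)
    (h : ∀ j < i, s.val j = t.val j) (hlt : s.val i < t.val i) {x y : PiLex seqTree}
    (hx : IsPrefix s (seq x)) (hy : IsPrefix t (seq y)) : x < y := by
  refine lt_iff.2 ⟨i, fun j hj => ?_, ?_⟩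
  · rw [valPi_of_lt ((hj.trans hs).trans_le hx.1), valPi_of_lt ((hj.trans ht).trans_le hy.1),
      hx.val_eq (hj.trans hs), hy.val_eq (hj.trans ht), h j hj]
  · rw [valPi_of_lt (hs.trans_le hx.1), valPi_of_lt (ht.trans_le hy.1), hx.val_eq hs, hy.val_eq ht]
    exact_mod_cast hlt

/-- The cut `f` splits the set of extensions of `t`. -/
def Splits (f : CutSpace (PiLex seqTree)) (t : OrdSeq) : Prop :=
  ∀ b, ∃ x, IsPrefix t (seq x) ∧ f x = b

/-- The cones above incomparable sequences lie entirely on different sides of each other, and a cut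
cannot pass through both. -/
theorem Splits.isPrefix_or_isPrefix {f : CutSpace (PiLex seqTree)} {s t : OrdSeq}
    (hs : Splits f s) (ht : Splits f t) : IsPrefix s t ∨ IsPrefix t s := by
  have key : ∀ {s t : OrdSeq}, Splits f s → Splits f t → ∀ i, i < s.len → i < t.len →
      (∀ j < i, s.val j = t.val j) → ¬ s.val i < t.val i := by
    intro s t hs ht i h1 h2 h3 h4
    obtain ⟨x, hx, hfx⟩ := hs false
    obtain ⟨y, hy, hfy⟩ := ht true
    have := f.eq_true_of_le (lt_of_isPrefix h1 h2 h3 h4 hx hy).le hfy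
    rw [hfx] at this
    exact absurd this Bool.false_ne_true
  rcases isPrefix_or_isPrefix_or_exists s t with h | h | ⟨i, h1, h2, h3, h4⟩
  · exact Or.inl h
  · exact Or.inr h
  · rcases lt_or_gt_of_ne h4 with h4 | h4
    · exact (key hs ht i h1 h2 h3 h4).elim
    · exact (key ht hs i h2 h1 (fun j hj => (h3 j hj).symm) h4).elim

/-- The sequences split by `f` form a chain, so they are countable and their lengths stay below some
`ρ < ω₁`. On each cone above a sequence of length `ρ` the cut is constant, so a long `x` can be
replaced by `x|ρ ⌢ q`, with `q` chosen on the desired side of the value of `x` at `ρ`. -/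
theorem exists_countable_isCofinalIn (f : CutSpace (PiLex seqTree)) :
    ∃ E : Set (PiLex seqTree), E.Countable ∧ CutSpace.IsCofinalIn E f := by
  have hB : {x : seqTree | Splits f x.1.toOrdSeq}.Countable := by
    refine countable_of_isChain fun x hx y hy _ => ?_
    rcases Splits.isPrefix_or_isPrefix hx hy with h | h
    · exact Or.inl (RatSeq.le_iff_isPrefix.2 h)
    · exact Or.inr (RatSeq.le_iff_isPrefix.2 h)
  have := hB.to_subtype
  obtain ⟨ρ, hρ, hb⟩ := exists_bound_lt_omega_one
    (fun x : {x : seqTree | Splits f x.1.toOrdSeq} => x.1.1.toOrdSeq.len)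
    fun x => tree_le_countableLength x.1.2
  have hnot : ∀ t ∈ tree, t.len = ρ → ¬ Splits f t := by
    intro t ht hlen hsp
    obtain ⟨x, rfl⟩ := RatSeq.exists_toOrdSeq_eq (tree_le_countableLength ht)
    exact (hb ⟨⟨x, ht⟩, hsp⟩).ne hlen
  have key : ∀ x : PiLex seqTree, ¬ (seq x).len < ρ + 1 + 1 → ∀ q : ℚ, ∃ e : PiLex seqTree,
      (seq e).len < ρ + 1 + 1 ∧ f e = f x ∧ (((seq x).val ρ < q → x < e) ∧
        (q < (seq x).val ρ → e < x)) := by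
    intro x hx q
    have hρ2 : ρ < (seq x).len := (Order.lt_add_one_iff.2 le_rfl).trans_le
      ((Order.lt_add_one_iff.2 le_rfl).le.trans (not_lt.1 hx))
    have ht := take_mem_tree (seq_mem x) ρ
    have hlen : ((seq x).take ρ).len = ρ := len_take_of_le hρ2.le
    let e := mk ((seq x).take ρ * single q) (tree.mul_mem ht (single_mem_tree q))
    have he : seq e = (seq x).take ρ * single q := seq_mk _ _
    have hlen' : (seq e).len = ρ + 1 := by rw [he, len_mul, hlen, len_single]
    have hval : (seq e).val ρ = q := by
      have := val_mul_add ((seq x).take ρ) (single q) 0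
      rw [hlen, add_zero] at this
      rw [he, this, val_single_zero]
    have hvalj : ∀ j < ρ, (seq x).val j = (seq e).val j := fun j hj => by
      rw [he, val_mul_of_lt _ (by rwa [hlen]), val_take_of_lt _ hj]
    have hρe : ρ < (seq e).len := by rw [hlen']; exact Order.lt_add_one_iff.2 le_rfl
    have hself : ∀ y : PiLex seqTree, IsPrefix (seq y) (seq y) :=
      fun y => ⟨le_rfl, take_of_le le_rfl⟩
    refine ⟨e, ?_, ?_, fun h => ?_, fun h => ?_⟩
    · rw [hlen']
      exact Order.lt_add_one_iff.2 le_rfl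
    · have hns := hnot _ ht hlen
      by_contra hne
      refine hns fun b => ?_
      have : f x = b ∨ f e = b := by
        revert hne
        cases f x <;> cases f e <;> cases b <;> simp
      rcases this with h | h
      · exact ⟨x, isPrefix_take _ hρ2.le, h⟩
      · exact ⟨e, he ▸ isPrefix_mul _ _, h⟩
    · exact lt_of_isPrefix hρ2 hρe hvalj (by rwa [hval]) (hself x) (hself e)
    · exact lt_of_isPrefix hρe hρ2 (fun j hj => (hvalj j hj).symm) (by rwa [hval]) (hself e)
        (hself x)
  -- The replacements `x|ρ ⌢ q` have length `ρ + 1`.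
  refine ⟨{x | (seq x).len < ρ + 1 + 1},
    countable_seq_len_lt (succ_lt_omega_one (succ_lt_omega_one hρ)), fun x hx => ?_, fun x hx => ?_⟩
  · by_cases hlen : (seq x).len < ρ + 1 + 1
    · exact ⟨x, hlen, le_rfl, hx⟩
    · obtain ⟨e, h1, h2, h3, -⟩ := key x hlen ((seq x).val ρ + 1)
      exact ⟨e, h1, (h3 (lt_add_one _)).le, h2.trans hx⟩
  · by_cases hlen : (seq x).len < ρ + 1 + 1
    · exact ⟨x, hlen, le_rfl, hx⟩
    · obtain ⟨e, h1, h2, -, h3⟩ := key x hlen ((seq x).val ρ - 1)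
      exact ⟨e, h1, (h3 (sub_one_lt _)).le, h2.trans hx⟩

/-! ### A tree of clopen sets of cuts -/

/-- The element `x ⌢ q`. -/
noncomputable def extend (x : PiLex seqTree) (q : ℚ) : PiLex seqTree :=
  mk (seq x * single q) (tree.mul_mem (seq_mem x) (single_mem_tree q))

@[simp] theorem seq_extend (x : PiLex seqTree) (q : ℚ) : seq (extend x q) = seq x * single q :=
  seq_mk _ _

theorem isPrefix_seq_extend (x : PiLex seqTree) (q : ℚ) : IsPrefix (seq x) (seq (extend x q)) := by
  rw [seq_extend]
  exact isPrefix_mul _ _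

/-- The cuts between `x ⌢ 0` and `x ⌢ 1`. -/
def clopenAt (x : PiLex seqTree) : Set (CutSpace (PiLex seqTree)) :=
  {f | f (extend x 0) = true ∧ f (extend x 1) = false}

theorem isClopen_clopenAt (x : PiLex seqTree) : IsClopen (clopenAt x) :=
  (CutSpace.isClopen_eval _ true).inter (CutSpace.isClopen_eval _ false)

theorem extend_lt_extend (x : PiLex seqTree) {q r : ℚ} (h : q < r) : extend x q < extend x r := by
  have hl : ∀ q, (seq x).len < (seq (extend x q)).len := fun q => by
    rw [seq_extend, len_mul, len_single]
    exact Order.lt_add_one_iff.2 le_rfl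
  have hv : ∀ q, (seq (extend x q)).val (seq x).len = q := fun q => by
    have := val_mul_add (seq x) (single q) 0
    rw [add_zero] at this
    rw [seq_extend, this, val_single_zero]
  refine lt_of_isPrefix (hl q) (hl r) (fun j hj => ?_) (by rwa [hv, hv])
    ⟨le_rfl, take_of_le le_rfl⟩ ⟨le_rfl, take_of_le le_rfl⟩
  rw [(isPrefix_seq_extend x q).val_eq hj, (isPrefix_seq_extend x r).val_eq hj]

open Classical in
/-- The cut just above an element. -/
noncomputable def cutAbove (x : PiLex seqTree) : CutSpace (PiLex seqTree) :=
  ⟨fun y => decide (y ≤ x), fun y z hyz => by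
    rw [Bool.le_iff_imp]
    simpa using hyz.trans⟩

theorem cutAbove_apply {x y : PiLex seqTree} : cutAbove x y = true ↔ y ≤ x := by
  classical
  exact decide_eq_true_iff

theorem cutAbove_mem_clopenAt (x : PiLex seqTree) : cutAbove (extend x 0) ∈ clopenAt x := by
  refine ⟨cutAbove_apply.2 le_rfl, ?_⟩
  rw [Bool.eq_false_iff, Ne, cutAbove_apply, not_le]
  exact extend_lt_extend x zero_lt_one

/-- The next value of `y` after `x` lies strictly between `0` and `1`, so the whole cone above `y`
lies between `x ⌢ 0` and `x ⌢ 1`. -/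
theorem extend_zero_lt_and_lt {x y : PiLex seqTree} (h : IsPrefix (seq x) (seq y))
    (hlt : (seq x).len < (seq y).len) (hy : seq y ∈ valuesIn (Ioo 0 1)) {z : PiLex seqTree}
    (hz : IsPrefix (seq y) (seq z)) : extend x 0 < z ∧ z < extend x 1 := by
  have hl : ∀ q, (seq x).len < (seq (extend x q)).len := fun q => by
    rw [seq_extend, len_mul, len_single]
    exact Order.lt_add_one_iff.2 le_rfl
  have hv : ∀ q, (seq (extend x q)).val (seq x).len = q := fun q => by
    have := val_mul_add (seq x) (single q) 0
    rw [add_zero] at this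
    rw [seq_extend, this, val_single_zero]
  have hj : ∀ q, ∀ j < (seq x).len, (seq (extend x q)).val j = (seq y).val j := fun q j hj => by
    rw [(isPrefix_seq_extend x q).val_eq hj, h.val_eq hj]
  have hval := hy _ hlt
  constructor
  · exact lt_of_isPrefix (hl 0) hlt (hj 0) (by rw [hv]; exact hval.1)
      ⟨le_rfl, take_of_le le_rfl⟩ hz
  · exact lt_of_isPrefix hlt (hl 1) (fun j hjx => (hj 1 j hjx).symm) (by rw [hv]; exact hval.2)
      hz ⟨le_rfl, take_of_le le_rfl⟩

theorem clopenAt_ssubset {x y : PiLex seqTree} (h : IsPrefix (seq x) (seq y))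
    (hlt : (seq x).len < (seq y).len) (hy : seq y ∈ valuesIn (Ioo 0 1)) :
    clopenAt y ⊂ clopenAt x := by
  have h0 := extend_zero_lt_and_lt h hlt hy (isPrefix_seq_extend y 0)
  have h1 := extend_zero_lt_and_lt h hlt hy (isPrefix_seq_extend y 1)
  have hsub : clopenAt y ⊆ clopenAt x := fun f hf =>
    ⟨f.eq_true_of_le h0.1.le hf.1, f.eq_false_of_le h1.2.le hf.2⟩
  refine (Set.ssubset_iff_of_subset hsub).2 ⟨_, cutAbove_mem_clopenAt x, fun hcon => ?_⟩
  exact not_le.2 h0.1 (cutAbove_apply.1 hcon.1)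

theorem disjoint_clopenAt {x y : PiLex seqTree} {i : Ordinal.{0}} (h1 : i < (seq x).len)
    (h2 : i < (seq y).len) (h3 : ∀ j < i, (seq x).val j = (seq y).val j)
    (h4 : (seq x).val i ≠ (seq y).val i) : Disjoint (clopenAt x) (clopenAt y) := by
  wlog hlt : (seq x).val i < (seq y).val i generalizing x y
  · exact (this h2 h1 (fun j hj => (h3 j hj).symm) h4.symm
      (lt_of_le_of_ne (not_lt.1 hlt) h4.symm)).symm
  refine Set.disjoint_left.2 fun f hf hf' => ?_
  have := f.eq_true_of_le (lt_of_isPrefix h1 h2 h3 hlt (isPrefix_seq_extend x 1)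
    (isPrefix_seq_extend y 0)).le hf'.1
  rw [hf.2] at this
  exact absurd this Bool.false_ne_true

/-- One sequence of each countable successor length gives an uncountable incompatible family, and
incompatible sequences have disjoint sets `clopenAt`. -/
theorem not_satisfiesCCC : ¬ SatisfiesCCC (CutSpace (PiLex seqTree)) := by
  intro hccc
  have hex : ∀ i < ω₁, ∃ x : PiLex seqTree, (seq x).len = i + 1 := by
    intro i hi
    obtain ⟨y, hy, hlen, -⟩ := exists_mem_tree_len_eq (succ_lt_omega_one hi)
    exact ⟨mk y hy, by rw [seq_mk, hlen]⟩
  choose! x hx using hex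
  obtain ⟨A, hA, hAc, hinc⟩ := exists_uncountable_incompatible (t := fun i => seq (x i))
    fun i hi => ⟨tree_le_finiteToOne (seq_mem (x i)), by
      rw [hx i hi]
      exact Order.lt_add_one_iff.2 le_rfl⟩
  have hdisj : ∀ i ∈ A, ∀ j ∈ A, i < j → Disjoint (clopenAt (x i)) (clopenAt (x j)) := by
    intro i hi j hj hij
    have hne := hinc i hi j hj hij
    have hle : i + 1 ≤ (seq (x j)).len := by
      rw [hx j (hA hj)]
      exact (Order.add_one_le_of_lt hij).trans le_self_add
    have hlen : (seq (x i)).len = i + 1 := hx i (hA hi)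
    rcases isPrefix_or_isPrefix_or_exists (seq (x i)) (seq (x j)) with h | h | ⟨k, h1, h2, h3, h4⟩
    · refine (hne ?_).elim
      conv_lhs => rw [← h.2, take_take hlen.ge]
    · refine (hne ?_).elim
      conv_rhs => rw [← h.2, take_take hle]
    · exact disjoint_clopenAt h1 h2 h3 h4
  have hpd : A.PairwiseDisjoint fun i => clopenAt (x i) := by
    intro i hi j hj hij
    rcases lt_or_gt_of_ne hij with h | h
    · exact hdisj i hi j hj h
    · exact (hdisj j hj i hi h).symm
  have hinj : InjOn (fun i => clopenAt (x i)) A := by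
    intro i hi j hj heq
    by_contra hne
    have heq : clopenAt (x i) = clopenAt (x j) := heq
    have hmem := cutAbove_mem_clopenAt (x i)
    refine Set.disjoint_left.1 (hpd hi hj hne) hmem ?_
    rwa [heq] at hmem
  refine hAc (countable_of_injective_of_countable_image hinj (hccc _ ?_ ?_))
  · rintro _ ⟨i, -, rfl⟩
    exact ⟨(isClopen_clopenAt _).isOpen, _, cutAbove_mem_clopenAt _⟩
  · rintro _ ⟨i, hi, rfl⟩ _ ⟨j, hj, rfl⟩ hne
    exact hpd hi hj fun h => hne (by rw [h])

/-- The elements of the tree with all values between `0` and `1`. -/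
def unitTree : Set RatSeq := {x | x ∈ seqTree ∧ x.toOrdSeq ∈ valuesIn (Ioo 0 1)}

theorem mem_unitTree_of_le (x : RatSeq) (hx : x ∈ unitTree) (y : RatSeq) (hy : y ≤ x) :
    y ∈ unitTree := by
  refine ⟨mem_seqTree_of_le x hx.1 y hy, fun i hi => ?_⟩
  have h := RatSeq.le_iff_isPrefix.1 hy
  rw [← h.val_eq hi]
  exact hx.2 i (hi.trans_le h.1)

theorem not_countable_unitTree : ¬ Countable unitTree := by
  intro h
  have hc : (range fun x : unitTree => x.1.toOrdSeq.len).Countable := countable_range _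
  refine (lt_omega_one_of_countable_Iio (hc.mono fun i hi => ?_)).false
  obtain ⟨x, hx, hlen, hval⟩ := exists_mem_tree_len_eq hi
  obtain ⟨y, rfl⟩ := RatSeq.exists_toOrdSeq_eq (tree_le_countableLength hx)
  exact ⟨⟨y, hx, hval⟩, hlen⟩

/-- The sets `clopenAt` over `unitTree` reproduce its tree order by reverse inclusion, and preimages
under a surjection preserve inclusion, strictness and disjointness. So `2^γ` would carry an
uncountable clopen tree with countable levels. -/
theorem not_isContinuousImageOf_lexCube {γ : Ordinal.{0}} (hγ : γ < ω₁) :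
    ¬ IsContinuousImageOf (CutSpace (PiLex seqTree)) (LexCube γ) := by
  rintro ⟨f, hf, hsurj⟩
  obtain ⟨hT, hlev⟩ := RatSeq.isOrderTree_and_treeLevel_eq mem_unitTree_of_le
  let e : unitTree → PiLex seqTree := fun x => ⟨x.1, x.2.1⟩
  have he : ∀ {x y : unitTree}, x ≤ y ↔ IsPrefix (seq (e x)) (seq (e y)) := fun {x y} =>
    RatSeq.le_iff_isPrefix
  have hval : ∀ x, seq (e x) ∈ valuesIn (Ioo 0 1) := fun x => x.2.2
  have hss : ∀ x y : unitTree, x < y → clopenAt (e y) ⊂ clopenAt (e x) := by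
    intro x y hxy
    have h := he.1 hxy.le
    refine clopenAt_ssubset h (lt_of_le_of_ne h.1 fun hlen => hxy.ne ?_) (hval y)
    refine Subtype.ext (RatSeq.toOrdSeq_injective ?_)
    change seq (e x) = seq (e y)
    rw [← h.2, hlen, take_of_le le_rfl]
  have hsub : ∀ x y : unitTree, x ≤ y → clopenAt (e y) ⊆ clopenAt (e x) := by
    intro x y hxy
    rcases hxy.eq_or_lt with rfl | h
    · exact Subset.rfl
    · exact (hss x y h).subset
  have htri : ∀ x y : unitTree, x ≤ y ∨ y ≤ x ∨ Disjoint (clopenAt (e x)) (clopenAt (e y)) := by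
    intro x y
    rcases isPrefix_or_isPrefix_or_exists (seq (e x)) (seq (e y)) with h | h | ⟨k, h1, h2, h3, h4⟩
    · exact Or.inl (he.2 h)
    · exact Or.inr (Or.inl (he.2 h))
    · exact Or.inr (Or.inr (disjoint_clopenAt h1 h2 h3 h4))
  refine not_countable_unitTree (countable_of_clopen_tree hγ hT (fun α => ?_)
    (c := fun x => f ⁻¹' clopenAt (e x)) (fun x => (isClopen_clopenAt _).preimage hf)
    (fun x y => ?_) fun x y => ?_)
  · rw [hlev]
    rcases lt_or_ge α ω₁ with hα | hα
    · refine ((countable_len_lt (succ_lt_omega_one hα)).preimage_of_injOn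
        Subtype.val_injective.injOn).mono fun x hx => by
          exact ⟨x.2.1, Order.lt_add_one_iff.2 (le_of_eq hx)⟩
    · have : {t : unitTree | t.1.toOrdSeq.len = α} = ∅ := by
        refine eq_empty_of_forall_notMem fun t ht => ?_
        exact not_lt.2 hα (ht ▸ tree_le_countableLength t.2.1)
      rw [this]
      exact countable_empty
  · rw [hsurj.preimage_subset_preimage_iff]
    refine ⟨hsub x y, fun h => ?_⟩
    rcases htri x y with h' | h' | h'
    · exact h'
    · by_contra hne
      exact (hss y x (lt_of_le_not_ge h' hne)).not_subset h
    · exact (Set.disjoint_left.1 h' (h (cutAbove_mem_clopenAt (e y)))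
        (cutAbove_mem_clopenAt (e y))).elim
  · exact (htri x y).imp_right (Or.imp_right fun h => h.preimage f)

end SeqTree

theorem theorem3p10 :
    (∃ (X : Type) (_ : TopologicalSpace X),
      IsBooleanSpace X ∧ IsHomogeneousSpace X ∧ spaceWeight X = ℵ₁ ∧
      FirstCountableTopology X ∧ ¬ SatisfiesCCC X ∧
      (∀ γ : Ordinal.{0}, γ < ω₁ → ¬ IsContinuousImageOf X (LexCube γ)) ∧
      -- `X` is the Stone space of the interval algebra of a linear order on an Aronszajn tree
      ∃ T : Set RatSeq, (∀ x ∈ T, ∀ y : RatSeq, y ≤ x → y ∈ T) ∧ IsAronszajnTree T ∧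
        Nonempty (X ≃ₜ BoolUltrafilter (intervalAlgebra (PiLex T)))) ∧
    -- trees of clopen subsets of `2^γ`, ordered by reverse inclusion, with countable levels
    (∀ γ : Ordinal.{0}, γ < ω₁ → ∀ 𝒯 : Set (Clopens (LexCube γ)),
      IsOrderTree (↥𝒯)ᵒᵈ → (∀ a ∈ 𝒯, ∀ b ∈ 𝒯, a ≤ b ∨ b ≤ a ∨ Disjoint a b) →
      (∀ α : Ordinal.{0}, (treeLevel (↥𝒯)ᵒᵈ α).Countable) → 𝒯.Countable) := by
  refine ⟨⟨CutSpace (PiLex seqTree), inferInstance, CutSpace.isBooleanSpace, ?_, ?_, ?_,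
    SeqTree.not_satisfiesCCC, fun γ hγ => SeqTree.not_isContinuousImageOf_lexCube hγ, seqTree,
    SeqTree.mem_seqTree_of_le, SeqTree.isAronszajnTree, ⟨CutSpace.homeomorphUltrafilter⟩⟩,
    fun γ hγ 𝒯 h1 h2 h3 => countable_of_clopens_tree hγ 𝒯 h1 h2 h3⟩
  · exact CutSpace.isHomogeneousSpace SeqTree.orderIso_Iio SeqTree.orderIso_Ioi
      SeqTree.exists_countable_isCofinalIn
  · have : Infinite (PiLex seqTree) := NoMinOrder.infinite
    exact le_antisymm (CutSpace.spaceWeight_le.trans SeqTree.mk_piLex_le)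
      (aleph_one_le_spaceWeight SeqTree.not_satisfiesCCC)
  · exact CutSpace.firstCountableTopology SeqTree.exists_countable_isCofinalIn
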